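/- **Setting.** Let $X=(X_t)_{t\in\mathbb R}$ be a centered Gaussian process with continuous paths on a probability space $(\Omega,\mathcal F,P)$, let $R(s,t)=E(X_sX_t)$, and let $-\infty<a<b<\infty$. Consider the problem of minimizing $$\int\!\!\int R(s,t)\,\nu(ds)\,\nu(dt)\qquad(*)$$ over all Borel probability measures $\nu$ on $[a,b]$. Assume that (a) or (b) holds. (a) All of the following hold: (1) $R(s,t)=\sum_{m,n\ge0}r_{mn}s^mt^n$ for all $s,t\in\mathbb R$, as an (unconditionally convergent) double power series with real coefficients; (2) $\iint R\,d\nu\,d\nu>0$ for every Borel probability measure $\nu$ on any compact interval; (3) almost surely the sample paths are $C^\infty$, and the covariance matrix of every finite sub-collection of $(X^{(n)}_t:t\in\mathbb R,\ n\ge 0)$, where $X^{(n)}_t$ is the $n$-th derivative of the path at $t$, is non-singular; (4) $\limsup_{t\to\infty}R(s,t)\le0$ for every fixed $s\in[a,b]$; (5) problem $(*)$ has a minimizer whose support is finite. (b) $X$ is stationary, with spectral measure $F$ (the finite symmetric Borel measure with $R(s,t)=\int e^{i(t-s)x}F(dx)$), such that $\int e^{tx}F(dx)<\infty$ for all $t\in\mathbb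 R$ and the support of $F$ has an accumulation point. **Theorem 6.4.** The problem $(*)$ has exactly one minimizer $\nu_*$, and its support $S$ is finite. Write $S=\{t_1<\dots<t_k\}$. Let $\Sigma=(R(t_i,t_j))_{i,j\le k}$, let $\theta=\Sigma^{-1}\mathbf 1$, and let $\mu(t)=E(X_t\mid X_s=1 \text{ for all } s\in S)$, that is, $\mu(t)=\sum_j a_j(t)$ where $E(X_t\mid X_{t_1},\dots,X_{t_k})=\sum_j a_j(t)X_{t_j}$ and $(a_1(t),\dots,a_k(t))=(R(t,t_1),\dots,R(t,t_k))\,\Sigma^{-1}$. Assume that $\mu''(s)>0$ for every $s\in S\cap(a,b)$. For $\varepsilon>0$ and $1\le j\le k$ let $$M_{j\varepsilon}=\min_{s\in[t_j-\varepsilon,t_j+\varepsilon]\cap[a,b]}X_s .$$ Then $$\lim_{\varepsilon\downarrow0}\ \liminf_{u\to\infty}\ P\Bigl(\min_{1\le j\le k}M_{j\varepsilon}=\min_{t\in[a,b]}X_t\ \Bigm|\ \min_{t\in[a,b]}X_t>u\Bigr)=1 .$$ Moreover $\theta_j>0$ for all $j$, and for all sufficiently small $\varepsilon>0$, as $u\to\infty$,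 the conditional law of $\bigl(u(M_{1\varepsilon}-u),\dots,u(M_{k\varepsilon}-u)\bigr)$ given $\min_{t\in[a,b]}X_t>u$ converges weakly on $\mathbb R^k$ to the law of $(E_1,\dots,E_k)$, where $E_1,\dots,E_k$ are independent exponential random variables with respective rates $\theta_1,\dots,\theta_k$. -/

import Mathlib

open MeasureTheory ProbabilityTheory Filter Topology Set

noncomputable section

namespace HighMinima

variable {Ω : Type*} [MeasurableSpace Ω]

/-- The covariance function `R(s,t) = E(X_s X_t)` of a centered process. -/
def covFun (X : ℝ → Ω → ℝ) (P : Measure Ω) (s t : ℝ) : ℝ :=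
  ∫ ω, X s ω * X t ω ∂P

/-- `X` is a centered Gaussian process on `ℝ` with continuous paths. -/
structure IsCenteredContinuousGaussian (X : ℝ → Ω → ℝ) (P : Measure Ω) : Prop where
  measurable : ∀ t, Measurable (X t)
  gaussian : IsGaussianProcess X P
  centered : ∀ t, ∫ ω, X t ω ∂P = 0
  continuous : ∀ ω, Continuous (fun t => X t ω)

/-- `R` is the sum of a double power series on all of `ℝ × ℝ`. -/
def HasPowerExpansion (R : ℝ → ℝ → ℝ) : Prop :=
  ∃ r : ℕ → ℕ → ℝ, ∀ s t : ℝ,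
    HasSum (fun p : ℕ × ℕ => r p.1 p.2 * s ^ p.1 * t ^ p.2) (R s t)

/-- The quadratic functional `ν ↦ ∫∫ R(s,t) ν(ds) ν(dt)`. -/
def energy (R : ℝ → ℝ → ℝ) (ν : Measure ℝ) : ℝ :=
  ∫ t, ∫ s, R s t ∂ν ∂ν

/-- `ν` is a Borel probability measure on the interval `[c,d]`. -/
def IsProbOn (c d : ℝ) (ν : Measure ℝ) : Prop :=
  IsProbabilityMeasure ν ∧ ν (Icc c d)ᶜ = 0

/-- Non-negative non-degeneracy, on every compact interval. -/
def NonnegNondegenerate (R : ℝ → ℝ → ℝ) : Prop :=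
  ∀ (c d : ℝ) (ν : Measure ℝ), IsProbOn c d ν → 0 < energy R ν

/-- The process of `n`-th derivatives `X_t^{(n)}` of the sample paths. -/
def derivProc (X : ℝ → Ω → ℝ) (n : ℕ) (t : ℝ) (ω : Ω) : ℝ :=
  iteratedDeriv n (fun s => X s ω) t

/-- The sample paths are (almost surely) infinitely differentiable, and the covariance matrix of
any finite sub-collection of `(X_t^{(n)} : t ∈ ℝ, n = 0, 1, …)` is non-singular. -/
structure SmoothNondegenerate (X : ℝ → Ω → ℝ) (P : Measure Ω) : Prop where
  smooth : ∀ᵐ ω ∂P, ContDiff ℝ ((⊤ : ℕ∞) : WithTop ℕ∞) (fun t => X t ω)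
  nonsingular : ∀ I : Finset (ℝ × ℕ),
    (Matrix.of fun p q : I =>
      cov[derivProc X p.1.2 p.1.1, derivProc X q.1.2 q.1.1; P]).det ≠ 0

/-- For every fixed `s ∈ [a,b]`, `limsup_{t → ∞} R(s,t) ≤ 0` (an upper limit in `[-∞, ∞]`). -/
def LimsupNonpos (R : ℝ → ℝ → ℝ) (a b : ℝ) : Prop :=
  ∀ s ∈ Icc a b, limsup (fun t => ((R s t : ℝ) : EReal)) atTop ≤ 0

/-- `F` is the spectral measure of a stationary centered Gaussian process with covariance
function `R`: a finite symmetric Borel measure with `R(s,t) = ∫ exp(i(t-s)x) F(dx)`. In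
particular `R(s,t)` depends on `t - s` only, which for centered Gaussian processes is
stationarity. -/
structure IsSpectralMeasure (R : ℝ → ℝ → ℝ) (F : Measure ℝ) : Prop where
  finite : IsFiniteMeasure F
  symmetric : F.map (fun x => -x) = F
  repr : ∀ s t : ℝ,
    ((R s t : ℝ) : ℂ) = ∫ x : ℝ, Complex.exp (Complex.I * (((t - s) * x : ℝ) : ℂ)) ∂F

/-- The stationary case: there is a spectral measure, it has all exponential moments, and its
support has an accumulation point. -/
def StationaryCase (R : ℝ → ℝ → ℝ) : Prop :=
  ∃ F : Measure ℝ, IsSpectralMeasure R F ∧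
    (∀ t : ℝ, Integrable (fun x => Real.exp (t * x)) F) ∧
    ∃ x : ℝ, AccPt x (𝓟 F.support)

/-- `ν` minimizes the energy among the Borel probability measures on `[a,b]`. -/
def IsMinimizer (R : ℝ → ℝ → ℝ) (a b : ℝ) (ν : Measure ℝ) : Prop :=
  IsProbOn a b ν ∧ ∀ ν' : Measure ℝ, IsProbOn a b ν' → energy R ν ≤ energy R ν'

section FinitePoints

variable {k : ℕ}

/-- The covariance matrix `Σ` of `(X_{t_1}, …, X_{t_k})`. -/
def covMat (R : ℝ → ℝ → ℝ) (t : Fin k → ℝ) : Matrix (Fin k) (Fin k) ℝ :=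
  Matrix.of fun i j => R (t i) (t j)

/-- `θ = Σ⁻¹ 1`. -/
def theta (R : ℝ → ℝ → ℝ) (t : Fin k → ℝ) : Fin k → ℝ :=
  Matrix.mulVec (covMat R t)⁻¹ (fun _ => 1)

/-- The coefficients `a_j(s)` in `E(X_s | X_{t_1}, …, X_{t_k}) = ∑ j, a_j(s) X_{t_j}`, by the
Gaussian regression formula: the row vector `(R(s,t_i))_i` times `Σ⁻¹`. -/
def regressionCoeff (R : ℝ → ℝ → ℝ) (t : Fin k → ℝ) (s : ℝ) : Fin k → ℝ :=
  Matrix.vecMul (fun i => R s (t i)) (covMat R t)⁻¹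

/-- `μ(s) = E(X_s | X_{t_j} = 1 for all j) = ∑ j, a_j(s)`. -/
def condMean (R : ℝ → ℝ → ℝ) (t : Fin k → ℝ) (s : ℝ) : ℝ :=
  ∑ j, regressionCoeff R t s j * 1

end FinitePoints

/-- `min_{s ∈ K} X_s` (used for nonempty compact `K` only). -/
def minOn (X : ℝ → Ω → ℝ) (K : Set ℝ) (ω : Ω) : ℝ :=
  sInf ((fun s => X s ω) '' K)

/-- The event `{min_{t ∈ [a,b]} X_t > u}`. -/
def highEvent (X : ℝ → Ω → ℝ) (a b u : ℝ) : Set Ω :=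
  {ω | u < minOn X (Icc a b) ω}

/-- `M_ε(c) = min_{s ∈ [c-ε, c+ε] ∩ [a,b]} X_s`. -/
def localMin (X : ℝ → Ω → ℝ) (a b ε c : ℝ) (ω : Ω) : ℝ :=
  minOn X (Icc (c - ε) (c + ε) ∩ Icc a b) ω

end HighMinima

end

open MeasureTheory ProbabilityTheory Filter Topology Set

noncomputable section

namespace HighMinima

/-! Let `ν` minimize the energy, let `E` be its energy and `g(t) = ∫ R(s,t) ν(ds)` its potential.
Perturbing `ν` towards a point mass gives `g ≥ E` on `[a,b]`; the `ν`-average of `g` is `E`, so `ν`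
lives on the contact set `T = {g = E}`. In both cases `g` is real-analytic and not constant, so `T`
is finite. Non-singularity of the finite covariance matrices then yields `E > 0` and uniqueness
(`IsMinimizer.unique_and_isOptimalDual`). With `θ_p = ν{p}/E` the profile `m = ∑ θ_p R(p,·) = g/E`
is at least 1 on `[a,b]`, with equality exactly on `T`. The set `T` may exceed the support of `ν`:
some contact points may carry zero weight.

Concentration. The variable `W = ∑ θ_p X_p` has variance `τ = ∑ θ_p` and covariance `m(t)` with
`X_t`, so `X = (m/τ) W + Z` with `Z` independent of `W`. A minimum above `u` forces `W ≥ τu`, at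
cost about `exp(-τu²/2)`. Conversely, `W` slightly above `τu` and `Z` small produce a high minimum.
Fernique's bound makes deviations of `Z` of order `u` exponentially more expensive, so, given a high
minimum, `X/u` is uniformly close to `m` (`IsOptimalDual.tendsto_bad`).

Local structure. Shift the path by `h/u`, where `h = ∑ c_p R(p,·)` takes prescribed values on `T`.
The Cameron–Martin density is `exp(-∑ c_p X_p/u - O(u⁻²))`. Since `X_p ≈ u` on `T`, its exponent is
close to `-∑ c_p`, which equals `-∑ θ_p h(p)` by symmetry of `R`. Away from `T` the profile exceeds
1 by a fixed gap, so a shift of order `1/u` is harmless there. Hence raising the level near each `p`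
by `x_p/u` multiplies the probability by `exp(-∑ θ_p x_p)` in the limit
(`IsOptimalDual.tendsto_levelEvent`). This is the joint tail of independent exponentials, and
convergence on orthants gives weak convergence. At a contact point of zero weight the level rises by
`L/u` for free, whereas the minimum near the support lies within `L/u` of `u` with probability close
to 1 for large `L`; so the global minimum is found near the support. -/

/-! ### Fernique's exponential integrability for Gaussian sequences -/

theorem fernique_constant_ne_top {K : ℝ} (hK : 0 < K) :
    ∑' n : ℕ, ENNReal.ofReal (Real.exp (-2⁻¹ * K * 2 ^ n)) ≠ ⊤ := by
  have hs : Summable fun n : ℕ => Real.exp (-2⁻¹ * K * 2 ^ n) := by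
    have hg : Summable fun n : ℕ => (Real.exp (-2⁻¹ * K)) ^ n :=
      summable_geometric_of_lt_one (Real.exp_nonneg _) (by
        rw [Real.exp_lt_one_iff]; linarith)
    refine Summable.of_nonneg_of_le (fun _ => Real.exp_nonneg _) (fun n => ?_) hg
    rw [← Real.exp_nat_mul]
    apply Real.exp_le_exp.2
    have h2 : (n : ℝ) ≤ 2 ^ n := by exact_mod_cast Nat.lt_two_pow_self.le
    nlinarith
  rw [← ENNReal.ofReal_tsum_of_nonneg (fun _ => Real.exp_nonneg _) hs]
  exact ENNReal.ofReal_ne_top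

/-- Fernique's bound for a centered Gaussian sequence with bounded paths. -/
theorem exists_lintegral_iSup_exp_sq_lt_top {Ω : Type*} [MeasurableSpace Ω] {P : Measure Ω}
    [IsProbabilityMeasure P] {Z : ℕ → Ω → ℝ} (hZ : IsGaussianProcess Z P)
    (hm : ∀ n, Measurable (Z n)) (h0 : ∀ n, ∫ ω, Z n ω ∂P = 0)
    (hb : ∀ ω, BddAbove (range fun n => |Z n ω|)) :
    ∃ c > 0, ∫⁻ ω, ⨆ n, ENNReal.ofReal (Real.exp (c * (Z n ω) ^ 2)) ∂P < ⊤ := by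
  -- Fernique's argument needs a ball of probability more than 1/2; boundedness of the paths
  -- supplies one, and 3/4 is an arbitrary choice in `(1/2, 1)`.
  obtain ⟨m, hm1, hma⟩ : ∃ m : ℕ, 0 < m ∧ (3 / 4 : ENNReal) < P {ω | ∀ n, |Z n ω| ≤ m} := by
    have hmono : Monotone fun m : ℕ => {ω | ∀ n, |Z n ω| ≤ m} := by
      intro i j hij ω hω n
      exact (hω n).trans (by exact_mod_cast hij)
    have hU : ⋃ m : ℕ, {ω | ∀ n, |Z n ω| ≤ m} = univ := by
      refine eq_univ_of_forall fun ω => ?_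
      obtain ⟨B, hB⟩ := hb ω
      obtain ⟨m, hmB⟩ := exists_nat_ge B
      exact mem_iUnion.2 ⟨m, fun n => (hB ⟨n, rfl⟩).trans hmB⟩
    have ht := tendsto_measure_iUnion_atTop (μ := P) hmono
    rw [hU, measure_univ] at ht
    have h34 : (3 / 4 : ENNReal) < 1 := by
      rw [ENNReal.div_lt_iff (by simp) (by simp)]; norm_num
    obtain ⟨m, h1, h2⟩ := ((ht.eventually (lt_mem_nhds h34)).and (eventually_gt_atTop 0)).exists
    exact ⟨m, h2, h1⟩
  set q : ENNReal := 3 / 4 with hq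
  have hq1 : q < 1 := by
    rw [hq, ENNReal.div_lt_iff (by simp) (by simp)]; norm_num
  have hq2 : 2⁻¹ < q := by
    rw [hq, ENNReal.lt_div_iff_mul_lt (by simp) (by simp)]
    calc (2⁻¹ : ENNReal) * 4 = 2⁻¹ * 2 * 2 := by rw [mul_assoc]; norm_num
      _ = 2 := by rw [ENNReal.inv_mul_cancel (by simp) (by simp), one_mul]
      _ < 3 := by norm_num
  have hlr := Fernique.logRatio_pos hq2 hq1
  set c : ℝ := Fernique.logRatio q * (m : ℝ)⁻¹ ^ 2 with hc
  have hmpos : (0 : ℝ) < m := by exact_mod_cast hm1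
  have hc0 : 0 < c := by positivity
  set C : ENNReal := ENNReal.ofReal (Real.exp (Fernique.logRatio q)) +
    ∑' n : ℕ, ENNReal.ofReal (Real.exp (-2⁻¹ * Real.log (q / (1 - q)).toReal * 2 ^ n)) with hC
  have hCtop : C < ⊤ := by
    refine ENNReal.add_lt_top.2 ⟨ENNReal.ofReal_lt_top, lt_top_iff_ne_top.2
      (fernique_constant_ne_top ?_)⟩
    -- The sign of `log (q / (1 - q))` is read off from the positivity of `Fernique.logRatio q`, of
    -- which it is the numerator.
    by_contra hneg
    have : Fernique.logRatio q ≤ 0 := by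
      unfold Fernique.logRatio
      rw [← ENNReal.toReal_div]
      exact div_nonpos_of_nonpos_of_nonneg (not_lt.1 hneg) (by positivity)
    linarith
  refine ⟨c, hc0, lt_of_le_of_lt ?_ hCtop⟩
  -- Neither `c` nor `C` depends on the dimension `N + 1`, so the finite-dimensional bounds in the
  -- sup norm survive monotone convergence.
  have hfin : ∀ N : ℕ, ∫⁻ ω, ⨆ n ∈ Finset.range (N + 1),
      ENNReal.ofReal (Real.exp (c * (Z n ω) ^ 2)) ∂P ≤ C := by
    intro N
    set I := Finset.range (N + 1)
    have hY : Measurable fun ω => I.restrict (Z · ω) := by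
      apply measurable_pi_lambda; intro i; exact hm i
    have hg : IsGaussian (P.map fun ω => I.restrict (Z · ω)) := (hZ.hasGaussianLaw I).isGaussian_map
    have hcen : (P.map fun ω => I.restrict (Z · ω))[id] = 0 := by
      rw [integral_map hY.aemeasurable (by fun_prop)]
      ext i
      simp only [id]
      rw [eval_integral]
      · exact h0 i
      · intro j
        exact (hZ.hasGaussianLaw_eval (j : ℕ)).integrable
    have hprob : IsProbabilityMeasure (P.map fun ω => I.restrict (Z · ω)) :=
      Measure.isProbabilityMeasure_map hY.aemeasurable
    have hle : q ≤ (P.map fun ω => I.restrict (Z · ω)) {x | ‖x‖ ≤ (m : ℝ)} := by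
      rw [Measure.map_apply hY (measurableSet_le measurable_norm measurable_const)]
      refine hma.le.trans (measure_mono fun ω hω => ?_)
      simp only [mem_preimage, mem_ofPred_eq]
      rw [pi_norm_le_iff_of_nonneg hmpos.le]
      intro i
      exact hω i
    have := lintegral_exp_mul_sq_norm_le_of_map_rotation_eq_self
      (IsGaussian.map_rotation_eq_self hcen _) hle hq2
    rw [lintegral_map (by fun_prop) hY] at this
    refine le_trans (lintegral_mono fun ω => ?_) this
    refine iSup₂_le fun n hn => ENNReal.ofReal_le_ofReal (Real.exp_le_exp.2 ?_)
    refine mul_le_mul_of_nonneg_left ?_ hc0.le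
    have hn' := norm_le_pi_norm (I.restrict (Z · ω)) ⟨n, hn⟩
    rw [← sq_abs (Z n ω)]
    exact pow_le_pow_left₀ (abs_nonneg _) hn' 2
  have heq : ∀ ω, ⨆ n, ENNReal.ofReal (Real.exp (c * (Z n ω) ^ 2)) =
      ⨆ N : ℕ, ⨆ n ∈ Finset.range (N + 1), ENNReal.ofReal (Real.exp (c * (Z n ω) ^ 2)) := by
    intro ω
    apply le_antisymm
    · refine iSup_le fun n => le_iSup_of_le n (le_iSup₂_of_le n (by simp) le_rfl)
    · exact iSup_le fun N => iSup₂_le fun n _ =>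
        le_iSup (fun n => ENNReal.ofReal (Real.exp (c * (Z n ω) ^ 2))) n
  simp_rw [heq]
  rw [lintegral_iSup]
  · exact iSup_le hfin
  · intro N
    refine Measurable.iSup fun n => Measurable.iSup fun _ => ?_
    have := hm n
    fun_prop
  · intro i j hij ω
    refine iSup₂_le fun n hn => le_iSup₂_of_le n ?_ le_rfl
    simp only [Finset.mem_range] at hn ⊢
    omega

/-! ### Regression on one Gaussian variable and the Cameron–Martin shift -/

/-- Translate Lebesgue measure by the variance: the ratio of the densities at `w + v` and `w` is
`exp(-w - v/2)`. -/
theorem lintegral_gaussianReal_shift {v : NNReal} (hv : v ≠ 0) {f : ℝ → ENNReal}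
    (hf : Measurable f) :
    ∫⁻ w, f w ∂(gaussianReal 0 v) =
      ∫⁻ w, f (w + v) * ENNReal.ofReal (Real.exp (-w - v / 2)) ∂(gaussianReal 0 v) := by
  rw [gaussianReal_of_var_ne_zero _ hv,
    lintegral_withDensity_eq_lintegral_mul _ (measurable_gaussianPDF _ _) hf,
    lintegral_withDensity_eq_lintegral_mul _ (measurable_gaussianPDF _ _) (by fun_prop),
    ← lintegral_add_right_eq_self (μ := volume) _ (v : ℝ)]
  refine lintegral_congr fun w => ?_
  simp only [Pi.mul_apply]
  rw [mul_comm (f (w + v)), ← mul_assoc]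
  congr 1
  simp only [gaussianPDF]
  rw [← ENNReal.ofReal_mul (gaussianPDFReal_nonneg _ _ _)]
  congr 1
  simp only [gaussianPDFReal, mul_assoc, ← Real.exp_add]
  congr 2
  have : (v : ℝ) ≠ 0 := by exact_mod_cast hv
  field_simp
  ring

/-- The residuals of the linear regression of a Gaussian process on a Gaussian variable form a
Gaussian process. -/
theorem isGaussianProcess_residual {Ω ι : Type*} [MeasurableSpace Ω] {P : Measure Ω}
    {X : ι → Ω → ℝ} {W : Ω → ℝ}
    (hXW : IsGaussianProcess (fun o : Option ι => o.elim W X) P) (c : ι → ℝ) :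
    IsGaussianProcess (Sum.elim (fun _ : Unit => W) (fun i ω => X i ω - c i * W ω)) P := by
  classical
  refine hXW.of_isGaussianProcess fun s => ?_
  rcases s with _ | i
  · exact ⟨{none}, ContinuousLinearMap.proj ⟨none, by simp⟩, fun ω => rfl⟩
  · refine ⟨{none, some i}, ContinuousLinearMap.proj ⟨some i, by simp⟩ -
      c i • ContinuousLinearMap.proj ⟨none, by simp⟩, fun ω => ?_⟩
    simp

/-- The regression coefficient `E(X_i W)/E(W²)` makes every residual uncorrelated with `W`, and for
jointly Gaussian families this is independence. -/
theorem indepFun_residual {Ω ι : Type*} [MeasurableSpace Ω] {P : Measure Ω}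
    [IsProbabilityMeasure P] {X : ι → Ω → ℝ} {W : Ω → ℝ}
    (hXW : IsGaussianProcess (fun o : Option ι => o.elim W X) P)
    (hX : ∀ i, Measurable (X i)) (hW : Measurable W) (hW0 : ∫ ω, W ω ∂P = 0)
    (hv : ∫ ω, W ω ^ 2 ∂P ≠ 0) :
    IndepFun W (fun ω i => X i ω - (∫ ω', X i ω' * W ω' ∂P) / (∫ ω', W ω' ^ 2 ∂P) * W ω) P := by
  have hWL2 : MemLp W 2 P := (hXW.hasGaussianLaw_eval none).memLp_two
  have hXL2 : ∀ i, MemLp (X i) 2 P := fun i => (hXW.hasGaussianLaw_eval (some i)).memLp_two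
  have h := IsGaussianProcess.indepFun_of_covariance_eq_zero (isGaussianProcess_residual hXW
    (fun i => (∫ ω', X i ω' * W ω' ∂P) / (∫ ω', W ω' ^ 2 ∂P))) (fun _ => hW.aemeasurable)
    (fun i => ((hX i).sub (measurable_const.mul hW)).aemeasurable) (by
      intro _ i
      have hR : MemLp (fun ω => X i ω -
          (∫ ω', X i ω' * W ω' ∂P) / (∫ ω', W ω' ^ 2 ∂P) * W ω) 2 P :=
        (hXL2 i).sub (hWL2.const_mul _)
      rw [covariance_comm, covariance_eq_sub hR hWL2, hW0, mul_zero, sub_zero]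
      simp only [Pi.mul_apply]
      have h1 : Integrable (fun ω => X i ω * W ω) P := (hXL2 i).integrable_mul hWL2
      have h2 : Integrable (fun ω => W ω ^ 2) P := hWL2.integrable_sq
      have : (fun ω => (X i ω - (∫ ω', X i ω' * W ω' ∂P) / (∫ ω', W ω' ^ 2 ∂P) * W ω) * W ω) =
          fun ω => X i ω * W ω - (∫ ω', X i ω' * W ω' ∂P) / (∫ ω', W ω' ^ 2 ∂P) * W ω ^ 2 := by
        ext ω; ring
      rw [this, integral_sub h1 (h2.const_mul _), integral_const_mul, div_mul_cancel₀ _ hv,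
        sub_self])
  exact h.comp (φ := fun f : Unit → ℝ => f ()) (measurable_pi_apply _) measurable_id

theorem map_eq_gaussianReal_of_centered {Ω : Type*} [MeasurableSpace Ω] {P : Measure Ω}
    [IsProbabilityMeasure P] {W : Ω → ℝ} (hG : HasGaussianLaw W P) (hW : Measurable W)
    (hW0 : ∫ ω, W ω ∂P = 0) :
    P.map W = gaussianReal 0 (∫ ω, W ω ^ 2 ∂P).toNNReal := by
  rw [hG.map_eq_gaussianReal, hW0, variance_of_integral_eq_zero hW.aemeasurable hW0]

/-- Cameron–Martin formula for shifts along a single Gaussian variable. -/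
theorem measure_preimage_eq_lintegral_shift {Ω ι : Type*} [MeasurableSpace Ω] {P : Measure Ω}
    [IsProbabilityMeasure P] {X : ι → Ω → ℝ} {W : Ω → ℝ}
    (hXW : IsGaussianProcess (fun o : Option ι => o.elim W X) P)
    (hX : ∀ i, Measurable (X i)) (hW : Measurable W) (hW0 : ∫ ω, W ω ∂P = 0)
    {B : Set (ι → ℝ)} (hB : MeasurableSet B) :
    P {ω | (fun i => X i ω) ∈ B} =
      ∫⁻ ω in {ω | (fun i => X i ω + ∫ ω', X i ω' * W ω' ∂P) ∈ B},
        ENNReal.ofReal (Real.exp (-W ω - (∫ ω', W ω' ^ 2 ∂P) / 2)) ∂P := by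
  have hWlaw : HasGaussianLaw W P := hXW.hasGaussianLaw_eval none
  have hWL2 : MemLp W 2 P := hWlaw.memLp_two
  set v : ℝ := ∫ ω', W ω' ^ 2 ∂P with hv
  -- If `v = 0` then `W = 0` almost surely: the shift vanishes and the density is 1. Otherwise one
  -- may divide by `v`.
  rcases eq_or_ne v 0 with hv0 | hv0
  · have hWz : W =ᵐ[P] 0 := by
      have := (integral_eq_zero_iff_of_nonneg (fun ω => sq_nonneg (W ω)) hWL2.integrable_sq).1 hv0
      filter_upwards [this] with ω hω
      simpa using hω
    have hh0 : ∀ i, ∫ ω', X i ω' * W ω' ∂P = 0 := fun i => by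
      rw [integral_eq_zero_of_ae]
      filter_upwards [hWz] with ω hω
      simp [hω]
    simp only [hh0, add_zero, hv0]
    have : ∫⁻ ω in {ω | (fun i => X i ω) ∈ B}, ENNReal.ofReal (Real.exp (-W ω - 0 / 2)) ∂P =
        ∫⁻ ω in {ω | (fun i => X i ω) ∈ B}, 1 ∂P := by
      refine lintegral_congr_ae (ae_restrict_of_ae ?_)
      filter_upwards [hWz] with ω hω
      simp [hω]
    rw [this, setLIntegral_one]
  · set h : ι → ℝ := fun i => ∫ ω', X i ω' * W ω' ∂P with hh
    set Z : Ω → ι → ℝ := fun ω i => X i ω - h i / v * W ω with hZ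
    have hZm : Measurable Z := measurable_pi_lambda _ fun i => (hX i).sub (measurable_const.mul hW)
    have hind : IndepFun W Z P := indepFun_residual hXW hX hW hW0 hv0
    have hvpos : 0 < v := lt_of_le_of_ne (integral_nonneg fun ω => sq_nonneg _) (Ne.symm hv0)
    have hjoint : P.map (fun ω => (W ω, Z ω)) = (gaussianReal 0 v.toNNReal).prod (P.map Z) := by
      rw [(indepFun_iff_map_prod_eq_prod_map_map hW.aemeasurable hZm.aemeasurable).1 hind,
        map_eq_gaussianReal_of_centered hWlaw hW hW0]
    have hpr : IsProbabilityMeasure (P.map Z) := Measure.isProbabilityMeasure_map hZm.aemeasurable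
    have hvN : v.toNNReal ≠ 0 := by simpa using hvpos
    have hvc : (v.toNNReal : ℝ) = v := Real.coe_toNNReal _ hvpos.le
    have hmS : Measurable fun p : ℝ × (ι → ℝ) => fun i => p.2 i + h i / v * p.1 := by
      apply measurable_pi_lambda; intro i
      exact ((measurable_pi_apply i).comp measurable_snd).add (measurable_const.mul measurable_fst)
    have hmS' : Measurable fun p : ℝ × (ι → ℝ) => fun i => p.2 i + h i / v * p.1 + h i := by
      apply measurable_pi_lambda; intro i
      exact (measurable_pi_iff.1 hmS i).add measurable_const
    have hXZ : ∀ ω i, X i ω = Z ω i + h i / v * W ω := fun ω i => by simp [hZ]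
    have hWZ : Measurable fun ω => (W ω, Z ω) := hW.prodMk hZm
    have hA : Measurable (B.indicator (fun _ => (1 : ENNReal))) :=
      measurable_const.indicator hB
    have hA1 : Measurable fun p : ℝ × (ι → ℝ) => B.indicator (fun _ => (1 : ENNReal))
        (fun i => p.2 i + h i / v * p.1) := hA.comp hmS
    have hA2 : Measurable fun p : ℝ × (ι → ℝ) => B.indicator (fun _ => (1 : ENNReal))
        (fun i => p.2 i + h i / v * p.1 + h i) * ENNReal.ofReal (Real.exp (-p.1 - v / 2)) :=
      (hA.comp hmS').mul (by fun_prop)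
    have hS0 : MeasurableSet {ω | (fun i => X i ω) ∈ B} :=
      (show Measurable fun ω => fun i => X i ω from measurable_pi_lambda _ hX) hB
    have hL : P {ω | (fun i => X i ω) ∈ B} = ∫⁻ p, B.indicator (fun _ => (1 : ENNReal))
        (fun i => p.2 i + h i / v * p.1) ∂(P.map fun ω => (W ω, Z ω)) := by
      rw [lintegral_map hA1 hWZ, ← lintegral_indicator_one hS0]
      refine lintegral_congr fun ω => ?_
      simp only [← hXZ]
      rfl
    have hR : ∫⁻ ω in {ω | (fun i => X i ω + h i) ∈ B},
        ENNReal.ofReal (Real.exp (-W ω - v / 2)) ∂P =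
        ∫⁻ p, B.indicator (fun _ => (1 : ENNReal)) (fun i => p.2 i + h i / v * p.1 + h i) *
          ENNReal.ofReal (Real.exp (-p.1 - v / 2)) ∂(P.map fun ω => (W ω, Z ω)) := by
      have hS : MeasurableSet {ω | (fun i => X i ω + h i) ∈ B} :=
        hB.preimage (measurable_pi_lambda _ fun i => (hX i).add measurable_const)
      rw [lintegral_map hA2 hWZ, ← lintegral_indicator hS]
      refine lintegral_congr fun ω => ?_
      have e : (fun i => X i ω + h i) = fun i => Z ω i + h i / v * W ω + h i := by
        ext i; rw [hXZ]
      by_cases hmem : (fun i => X i ω + h i) ∈ B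
      · rw [indicator_of_mem (by exact hmem), ← e, indicator_of_mem hmem, one_mul]
      · rw [indicator_of_notMem (by exact hmem), ← e, indicator_of_notMem hmem, zero_mul]
    rw [hL, hR, hjoint, lintegral_prod_symm' _ hA1, lintegral_prod_symm' _ hA2]
    -- With the residual `z` frozen, translating `W` by `v` moves `z_i + (h_i / v) W` by exactly
    -- `h_i`, so the one-dimensional formula applies.
    refine lintegral_congr fun z => ?_
    have hA1z : Measurable fun w : ℝ => B.indicator (fun _ => (1 : ENNReal))
        (fun i => z i + h i / v * w) :=
      hA1.comp (measurable_id.prodMk measurable_const : Measurable fun w : ℝ => (w, z))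
    refine (lintegral_gaussianReal_shift hvN hA1z).trans ?_
    refine lintegral_congr fun w => ?_
    simp only []
    rw [hvc]
    congr 3
    ext i
    field_simp
    ring

/-- On `A` the shifted process lies in `B` and the Cameron–Martin density is at least `exp(-m -
v/2)`, where `v` is the variance of `W`. The set `A` itself need not be measurable. -/
theorem exp_mul_measure_le_of_shift {Ω ι : Type*} [MeasurableSpace Ω] {P : Measure Ω}
    [IsProbabilityMeasure P] {X : ι → Ω → ℝ} {W : Ω → ℝ}
    (hXW : IsGaussianProcess (fun o : Option ι => o.elim W X) P)
    (hX : ∀ i, Measurable (X i)) (hW : Measurable W) (hW0 : ∫ ω, W ω ∂P = 0)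
    {B : Set (ι → ℝ)} (hB : MeasurableSet B) {A : Set Ω} {m : ℝ}
    (hAB : ∀ ω ∈ A, (fun i => X i ω + ∫ ω', X i ω' * W ω' ∂P) ∈ B) (hAW : ∀ ω ∈ A, W ω ≤ m) :
    ENNReal.ofReal (Real.exp (-m - (∫ ω', W ω' ^ 2 ∂P) / 2)) * P A ≤
      P {ω | (fun i => X i ω) ∈ B} := by
  set S := {ω | (fun i => X i ω + ∫ ω', X i ω' * W ω' ∂P) ∈ B} ∩ {ω | W ω ≤ m}
  have hS : MeasurableSet S := (hB.preimage (measurable_pi_lambda _ fun i =>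
    (hX i).add measurable_const)).inter (measurableSet_le hW measurable_const)
  rw [measure_preimage_eq_lintegral_shift hXW hX hW hW0 hB]
  calc _ ≤ ENNReal.ofReal (Real.exp (-m - (∫ ω', W ω' ^ 2 ∂P) / 2)) * P S := by
        gcongr
        exact fun ω hω => ⟨hAB ω hω, hAW ω hω⟩
    _ = ∫⁻ ω in S, ENNReal.ofReal (Real.exp (-m - (∫ ω', W ω' ^ 2 ∂P) / 2)) ∂P := by
        rw [setLIntegral_const]
    _ ≤ ∫⁻ ω in S, ENNReal.ofReal (Real.exp (-W ω - (∫ ω', W ω' ^ 2 ∂P) / 2)) ∂P := by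
        refine setLIntegral_mono' hS fun ω hω => ENNReal.ofReal_le_ofReal (Real.exp_le_exp.2 ?_)
        have : W ω ≤ m := hω.2
        linarith
    _ ≤ _ := lintegral_mono_set inter_subset_left

/-! ### Reduction to countably many times and Gaussian envelopes -/

theorem exists_denseSeq_of_nonempty {K : Set ℝ} (hK : K.Nonempty) :
    ∃ d : ℕ → ℝ, (∀ n, d n ∈ K) ∧ K ⊆ closure (range d) := by
  have : Nonempty K := hK.to_subtype
  refine ⟨fun n => (TopologicalSpace.denseSeq K n : ℝ), fun n => (TopologicalSpace.denseSeq K n).2,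
    fun x hx => ?_⟩
  have h := TopologicalSpace.denseRange_denseSeq K (⟨x, hx⟩ : K)
  have h2 := image_closure_subset_closure_image continuous_subtype_val (mem_image_of_mem _ h)
  rwa [← range_comp] at h2

/-- For a path which is continuous on `K`, closed conditions propagate from a dense sequence. -/
theorem forall_mem_of_forall_denseSeq {K : Set ℝ} {d : ℕ → ℝ} (hdK : ∀ n, d n ∈ K)
    (hd : K ⊆ closure (range d)) {f : ℝ → ℝ} (hf : ContinuousOn f K) {C : Set ℝ} (hC : IsClosed C)
    (h : ∀ n, f (d n) ∈ C) {t : ℝ} (ht : t ∈ K) : f t ∈ C := by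
  have h1 : (𝓝[range d] t).NeBot := mem_closure_iff_nhdsWithin_neBot.1 (hd ht)
  have h2 : Tendsto f (𝓝[range d] t) (𝓝 (f t)) :=
    (hf t ht).mono_left (nhdsWithin_mono _ (range_subset_iff.2 hdK))
  refine hC.mem_of_tendsto h2 ?_
  filter_upwards [self_mem_nhdsWithin] with s hs
  obtain ⟨n, rfl⟩ := hs
  exact h n

/-- Since the minimum is attained, a strict bound leaves a margin `1/(m+1)`; the condition becomes a
non-strict one on countably many times, hence measurable in the product σ-algebra. -/
theorem forall_lt_iff_exists_denseSeq {K : Set ℝ} (hK : IsCompact K) (hne : K.Nonempty)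
    {d : ℕ → ℝ} (hdK : ∀ n, d n ∈ K) (hd : K ⊆ closure (range d)) {f : ℝ → ℝ}
    (hf : ContinuousOn f K) (r : ℝ) :
    (∀ t ∈ K, r < f t) ↔ ∃ m : ℕ, ∀ n, r + 1 / ((m : ℝ) + 1) ≤ f (d n) := by
  constructor
  · intro h
    obtain ⟨s, hs, hmin⟩ := hK.exists_isMinOn hne hf
    obtain ⟨m, hm⟩ := exists_nat_one_div_lt (sub_pos.2 (h s hs))
    refine ⟨m, fun n => ?_⟩
    have : f s ≤ f (d n) := hmin (hdK n)
    linarith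
  · rintro ⟨m, hm⟩ t ht
    have := forall_mem_of_forall_denseSeq hdK hd hf isClosed_Ici hm ht
    have h2 : (0 : ℝ) < 1 / ((m : ℝ) + 1) := Nat.one_div_pos_of_nat
    simp only [mem_Ici] at this
    linarith

/-- An exponentially square integrable envelope of a continuous Gaussian process. -/
theorem exists_envelope {Ω : Type*} [MeasurableSpace Ω] {P : Measure Ω} [IsProbabilityMeasure P]
    {Z : ℝ → Ω → ℝ} (hZ : IsGaussianProcess Z P) (hm : ∀ t, Measurable (Z t))
    (h0 : ∀ t, ∫ ω, Z t ω ∂P = 0) {K : Set ℝ} (hK : IsCompact K) (hne : K.Nonempty)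
    (hc : ∀ ω, ContinuousOn (fun t => Z t ω) K) :
    ∃ c > 0, ∃ G : Ω → ENNReal, Measurable G ∧ ∫⁻ ω, G ω ∂P < ⊤ ∧
      ∀ ω, ∀ t ∈ K, ENNReal.ofReal (Real.exp (c * (Z t ω) ^ 2)) ≤ G ω := by
  obtain ⟨d, hdK, hd⟩ := exists_denseSeq_of_nonempty hne
  obtain ⟨c, hc0, hlt⟩ := exists_lintegral_iSup_exp_sq_lt_top (Z := fun n => Z (d n))
    (hZ.comp_right d) (fun n => hm _) (fun n => h0 _) (fun ω => by
      obtain ⟨B, hB⟩ := (hK.bddAbove_image (hc ω).abs)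
      refine ⟨B, ?_⟩
      rintro _ ⟨n, rfl⟩
      exact hB ⟨d n, hdK n, rfl⟩)
  refine ⟨c, hc0, _, ?_, hlt, fun ω t ht => ?_⟩
  · refine Measurable.iSup fun n => ?_
    have := hm (d n)
    fun_prop
  · have hcl : IsClosed {x : ℝ | ENNReal.ofReal (Real.exp (c * x ^ 2)) ≤
        ⨆ n, ENNReal.ofReal (Real.exp (c * (Z (d n) ω) ^ 2))} :=
      isClosed_le (ENNReal.continuous_ofReal.comp (by fun_prop)) continuous_const
    exact forall_mem_of_forall_denseSeq hdK hd (hc ω) hcl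
      (fun n => le_iSup (fun n => ENNReal.ofReal (Real.exp (c * (Z (d n) ω) ^ 2))) n) ht

theorem tail_le_of_envelope {Ω : Type*} [MeasurableSpace Ω] {P : Measure Ω} {Z : ℝ → Ω → ℝ}
    {K : Set ℝ} {G : Ω → ENNReal} {c r : ℝ} (hc : 0 < c) (hr : 0 ≤ r) (hG : Measurable G)
    (hZ : ∀ ω, ∀ t ∈ K, ENNReal.ofReal (Real.exp (c * (Z t ω) ^ 2)) ≤ G ω) :
    P {ω | ∃ t ∈ K, r < |Z t ω|} ≤ (∫⁻ ω, G ω ∂P) * ENNReal.ofReal (Real.exp (-(c * r ^ 2))) := by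
  have h := mul_meas_ge_le_lintegral (μ := P) hG (ENNReal.ofReal (Real.exp (c * r ^ 2)))
  have hsub : {ω | ∃ t ∈ K, r < |Z t ω|} ⊆ {ω | ENNReal.ofReal (Real.exp (c * r ^ 2)) ≤ G ω} := by
    rintro ω ⟨t, ht, hn⟩
    refine le_trans (ENNReal.ofReal_le_ofReal (Real.exp_le_exp.2 ?_)) (hZ ω t ht)
    rw [← sq_abs (Z t ω)]
    gcongr
  have hpos : ENNReal.ofReal (Real.exp (-(c * r ^ 2))) * ENNReal.ofReal (Real.exp (c * r ^ 2))
      = 1 := by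
    rw [← ENNReal.ofReal_mul (Real.exp_nonneg _), ← Real.exp_add]; simp
  calc P {ω | ∃ t ∈ K, r < |Z t ω|} ≤ _ := measure_mono hsub
    _ = ENNReal.ofReal (Real.exp (-(c * r ^ 2))) * (ENNReal.ofReal (Real.exp (c * r ^ 2)) *
        P {ω | ENNReal.ofReal (Real.exp (c * r ^ 2)) ≤ G ω}) := by
        rw [← mul_assoc, hpos, one_mul]
    _ ≤ _ := by
        rw [mul_comm]
        gcongr

/-! ### Covariance function and linear combinations of the process -/

section GaussianPaths

variable {Ω : Type*} [MeasurableSpace Ω] {P : Measure Ω} {X : ℝ → Ω → ℝ}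

theorem covFun_comm (s t : ℝ) : covFun X P s t = covFun X P t s := by
  simp only [covFun, mul_comm]

theorem IsCenteredContinuousGaussian.memLp (hX : IsCenteredContinuousGaussian X P) (t : ℝ) :
    MemLp (X t) 2 P := (hX.gaussian.hasGaussianLaw_eval t).memLp_two

theorem IsCenteredContinuousGaussian.integrable_mul (hX : IsCenteredContinuousGaussian X P)
    (s t : ℝ) : Integrable (fun ω => X s ω * X t ω) P := (hX.memLp s).integrable_mul (hX.memLp t)

/-- The Fernique envelope `G` dominates `exp(c X_t²) ≥ c X_t²`, so `G/c` bounds all squares and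
hence all products. It serves as the majorant in dominated convergence for `covFun` and in Fubini
for the energy. -/
theorem IsCenteredContinuousGaussian.exists_integrable_bound
    [IsProbabilityMeasure P] (hX : IsCenteredContinuousGaussian X P) (a b : ℝ) :
    ∃ H : Ω → ℝ, Integrable H P ∧ ∀ᵐ ω ∂P, ∀ s ∈ Icc a b, ∀ t ∈ Icc a b,
      |X s ω * X t ω| ≤ H ω := by
  rcases (Icc a b).eq_empty_or_nonempty with he | hne
  · exact ⟨0, integrable_zero _ _ _, by simp [he]⟩
  obtain ⟨c, hc, G, hGm, hG, hle⟩ := exists_envelope hX.gaussian hX.measurable hX.centered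
    isCompact_Icc hne (fun ω => (hX.continuous ω).continuousOn)
  refine ⟨fun ω => (G ω).toReal / c, (integrable_toReal_of_lintegral_ne_top hGm.aemeasurable
    hG.ne).div_const c, ?_⟩
  filter_upwards [ae_lt_top hGm hG.ne] with ω hω s hs t ht
  have key : ∀ t ∈ Icc a b, X t ω ^ 2 ≤ (G ω).toReal / c := fun t ht => by
    rw [le_div_iff₀ hc, mul_comm]
    have h1 := (ENNReal.ofReal_le_iff_le_toReal hω.ne).1 (hle ω t ht)
    have h2 := Real.add_one_le_exp (c * X t ω ^ 2)
    linarith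
  have h1 := key s hs
  have h2 := key t ht
  rw [abs_le]
  constructor <;> nlinarith [sq_nonneg (X s ω + X t ω), sq_nonneg (X s ω - X t ω)]

theorem IsCenteredContinuousGaussian.continuous_covFun [IsProbabilityMeasure P] (hX : IsCenteredContinuousGaussian X P) :
    Continuous (fun p : ℝ × ℝ => covFun X P p.1 p.2) := by
  rw [continuous_iff_continuousAt]
  rintro ⟨s, t⟩
  set M := max |s| |t| + 1
  obtain ⟨H, hH, hle⟩ := hX.exists_integrable_bound (-M) M
  have hev : ∀ᶠ p : ℝ × ℝ in 𝓝 (s, t), p.1 ∈ Icc (-M) M ∧ p.2 ∈ Icc (-M) M := by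
    have h1 : |s| < M := lt_of_le_of_lt (le_max_left _ _) (lt_add_one _)
    have h2 : |t| < M := lt_of_le_of_lt (le_max_right _ _) (lt_add_one _)
    exact (continuousAt_fst.eventually (Icc_mem_nhds (abs_lt.1 h1).1 (abs_lt.1 h1).2)).and
      (continuousAt_snd.eventually (Icc_mem_nhds (abs_lt.1 h2).1 (abs_lt.1 h2).2))
  refine continuousAt_of_dominated (bound := H) (Eventually.of_forall fun p =>
    (hX.integrable_mul _ _).aestronglyMeasurable) ?_ hH ?_
  · filter_upwards [hev] with p hp
    filter_upwards [hle] with ω hω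
    exact hω _ hp.1 _ hp.2
  · refine Eventually.of_forall fun ω => ?_
    have := hX.continuous ω
    exact ((this.comp continuous_fst).mul (this.comp continuous_snd)).continuousAt

/-- The index `none` carries the linear combination that serves as the regressor in the
decomposition and as the direction of the Cameron–Martin shift. -/
theorem IsCenteredContinuousGaussian.isGaussianProcess_option
    (hX : IsCenteredContinuousGaussian X P) {ι : Type*} (p : ι → ℝ) (T : Finset ℝ) (c : ℝ → ℝ) :
    IsGaussianProcess (fun o : Option ι =>
      o.elim (fun ω => ∑ q ∈ T, c q * X q ω) (fun i => X (p i))) P := by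
  refine hX.gaussian.of_isGaussianProcess fun s => ?_
  rcases s with _ | i
  · refine ⟨T, ∑ q : T, c q • ContinuousLinearMap.proj q, fun ω => ?_⟩
    simp only [Option.elim, sum_apply, smul_apply,
      ContinuousLinearMap.proj_apply, Finset.restrict, smul_eq_mul]
    exact (Finset.sum_coe_sort T (fun q => c q * X q ω)).symm
  · exact ⟨{p i}, ContinuousLinearMap.proj ⟨p i, by simp⟩, fun ω => rfl⟩

theorem IsCenteredContinuousGaussian.measurable_sum (hX : IsCenteredContinuousGaussian X P)
    (T : Finset ℝ) (c : ℝ → ℝ) : Measurable fun ω => ∑ q ∈ T, c q * X q ω :=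
  Finset.measurable_fun_sum _ fun q _ => (hX.measurable q).const_mul _

theorem IsCenteredContinuousGaussian.integral_sum [IsProbabilityMeasure P] (hX : IsCenteredContinuousGaussian X P)
    (T : Finset ℝ) (c : ℝ → ℝ) : ∫ ω, ∑ q ∈ T, c q * X q ω ∂P = 0 := by
  rw [integral_finsetSum _ fun q _ => ((hX.memLp q).integrable one_le_two).const_mul _]
  simp [integral_const_mul, hX.centered]

theorem IsCenteredContinuousGaussian.integral_mul_sum (hX : IsCenteredContinuousGaussian X P)
    (T : Finset ℝ) (c : ℝ → ℝ) (t : ℝ) :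
    ∫ ω, X t ω * ∑ q ∈ T, c q * X q ω ∂P = ∑ q ∈ T, c q * covFun X P q t := by
  simp_rw [Finset.mul_sum]
  rw [integral_finsetSum]
  · refine Finset.sum_congr rfl fun q _ => ?_
    rw [covFun, ← integral_const_mul]
    congr 1; ext ω; ring
  · intro q _
    have := (hX.integrable_mul q t).const_mul (c q)
    refine this.congr (Eventually.of_forall fun ω => ?_)
    simp only []; ring

theorem IsCenteredContinuousGaussian.integral_sum_sq (hX : IsCenteredContinuousGaussian X P)
    (T : Finset ℝ) (c : ℝ → ℝ) :
    ∫ ω, (∑ q ∈ T, c q * X q ω) ^ 2 ∂P = ∑ p ∈ T, c p * ∑ q ∈ T, c q * covFun X P q p := by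
  have : ∀ ω, (∑ q ∈ T, c q * X q ω) ^ 2 = ∑ p ∈ T, c p * (X p ω * ∑ q ∈ T, c q * X q ω) := by
    intro ω
    rw [sq, Finset.sum_mul]
    exact Finset.sum_congr rfl fun p _ => by ring
  simp_rw [this]
  rw [integral_finsetSum]
  · refine Finset.sum_congr rfl fun p _ => ?_
    rw [integral_const_mul, hX.integral_mul_sum]
  · intro p _
    refine Integrable.const_mul ?_ _
    exact (hX.memLp p).integrable_mul (memLp_finsetSum _ fun q _ => (hX.memLp q).const_mul _)

end GaussianPaths

theorem lt_minOn_iff {Ω : Type*} [MeasurableSpace Ω] {X : ℝ → Ω → ℝ} {K : Set ℝ} {ω : Ω} {r : ℝ}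
    (hK : IsCompact K) (hne : K.Nonempty) (hc : Continuous fun t => X t ω) :
    r < minOn X K ω ↔ ∀ t ∈ K, r < X t ω := by
  have hmem : minOn X K ω ∈ (fun s => X s ω) '' K :=
    (hK.image hc).sInf_mem (hne.image _)
  constructor
  · intro h t ht
    exact h.trans_le (csInf_le (hK.image hc).bddBelow ⟨t, ht, rfl⟩)
  · intro h
    obtain ⟨t, ht, he⟩ := hmem
    rw [← he]
    exact h t ht

/-! ### One-dimensional Gaussian tail bounds -/

/-- Chernoff's bound with the optimal exponent `r/τ`. -/
theorem gaussian_tail_le {Ω : Type*} [MeasurableSpace Ω] {P : Measure Ω} [IsProbabilityMeasure P]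
    {W : Ω → ℝ} {τ r : ℝ} (hτ : 0 < τ) (hW : P.map W = gaussianReal 0 τ.toNNReal) (hr : 0 ≤ r) :
    P {ω | r ≤ W ω} ≤ ENNReal.ofReal (Real.exp (-(r ^ 2 / (2 * τ)))) := by
  have hWm : AEMeasurable W P := aemeasurable_of_map_neZero (by rw [hW]; infer_instance)
  have hint : Integrable (fun ω => Real.exp (r / τ * W ω)) P := by
    have := integrable_exp_mul_gaussianReal (μ := 0) (v := τ.toNNReal) (r / τ)
    rw [← hW] at this
    exact this.comp_aemeasurable hWm
  have h := measure_ge_le_exp_mul_mgf r (div_nonneg hr hτ.le) hint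
  rw [mgf_gaussianReal hW, ← Real.exp_add] at h
  rw [measureReal_def, ← ENNReal.le_ofReal_iff_toReal_le (measure_ne_top _ _)
    (Real.exp_nonneg _)] at h
  refine h.trans (ENNReal.ofReal_le_ofReal (Real.exp_le_exp.2 (le_of_eq ?_)))
  rw [Real.coe_toNNReal _ hτ.le]
  field_simp
  ring

/-- On `(r, r+1]` the density is at least its value at `r + 1`; the crude `+1` does not matter at
the scale `exp(-r²/(2τ))` up to `exp(o(r²))`. -/
theorem le_gaussian_tail {Ω : Type*} [MeasurableSpace Ω] {P : Measure Ω}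
    {W : Ω → ℝ} {τ r : ℝ} (hτ : 0 < τ) (hWm : Measurable W)
    (hW : P.map W = gaussianReal 0 τ.toNNReal) (hr : 0 ≤ r) :
    ENNReal.ofReal ((√(2 * Real.pi * τ))⁻¹ * Real.exp (-((r + 1) ^ 2 / (2 * τ)))) ≤
      P {ω | r < W ω} := by
  have h1 : P {ω | r < W ω} = gaussianReal 0 τ.toNNReal (Ioi r) := by
    rw [← hW, Measure.map_apply hWm measurableSet_Ioi]; rfl
  rw [h1, gaussianReal_apply _ (by simpa using hτ)]
  calc _ = ∫⁻ _ in Ioc r (r + 1), ENNReal.ofReal ((√(2 * Real.pi * τ))⁻¹ *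
        Real.exp (-((r + 1) ^ 2 / (2 * τ)))) := by
        rw [setLIntegral_const]; simp
    _ ≤ ∫⁻ x in Ioc r (r + 1), gaussianPDF 0 τ.toNNReal x := by
        refine setLIntegral_mono' measurableSet_Ioc fun x hx => ENNReal.ofReal_le_ofReal ?_
        simp only [gaussianPDFReal, Real.coe_toNNReal _ hτ.le, sub_zero, neg_div]
        have : x ^ 2 ≤ (r + 1) ^ 2 := by
          have h1 := hx.1
          have h2 := hx.2
          exact pow_le_pow_left₀ (by linarith) h2 2
        gcongr
    _ ≤ _ := lintegral_mono_set Ioc_subset_Ioi_self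

/-! ### Optimal duals and concentration of the path around the profile -/

/-- A function `t ↦ ∑ p ∈ T, θ p * R(p,t)` with `θ ≥ 0` which is at least `1` on `[a,b]`, and equal
to `1` exactly on `T`, where the covariance matrix on `T` is invertible. -/
structure IsOptimalDual {Ω : Type*} [MeasurableSpace Ω] (X : ℝ → Ω → ℝ) (P : Measure Ω)
    (a b : ℝ) (T : Finset ℝ) (θ : ℝ → ℝ) : Prop where
  subset : ∀ p ∈ T, p ∈ Icc a b
  nonneg : ∀ p ∈ T, 0 ≤ θ p
  one_le : ∀ t ∈ Icc a b, 1 ≤ ∑ p ∈ T, θ p * covFun X P p t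
  eq_one_iff : ∀ t ∈ Icc a b, ∑ p ∈ T, θ p * covFun X P p t = 1 ↔ t ∈ T
  solvable : ∀ z : ℝ → ℝ, ∃ c : ℝ → ℝ, ∀ q ∈ T, ∑ p ∈ T, c p * covFun X P p q = z q

section

variable {Ω : Type*} [MeasurableSpace Ω] {P : Measure Ω} {X : ℝ → Ω → ℝ} {a b : ℝ}
  {T : Finset ℝ} {θ : ℝ → ℝ}

theorem mem_highEvent (hX : IsCenteredContinuousGaussian X P) (hab : a < b) {u : ℝ} {ω : Ω} :
    ω ∈ highEvent X a b u ↔ ∀ t ∈ Icc a b, u < X t ω :=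
  lt_minOn_iff isCompact_Icc (nonempty_Icc.2 hab.le) (hX.continuous ω)

theorem IsOptimalDual.sum_pos (h : IsOptimalDual X P a b T θ) (hab : a < b) :
    0 < ∑ p ∈ T, θ p := by
  refine Finset.sum_pos' h.nonneg ?_
  by_contra! hcon
  have := h.one_le a (left_mem_Icc.2 hab.le)
  rw [Finset.sum_eq_zero] at this
  · linarith
  · intro p hp
    rw [le_antisymm (hcon p hp) (h.nonneg p hp), zero_mul]

/-- The left side is the variance of `W = ∑ θ_p X_p`; it collapses to the total weight because the
inner sum is 1 on `T`. -/
theorem IsOptimalDual.sum_mul_eq (h : IsOptimalDual X P a b T θ) :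
    ∑ p ∈ T, θ p * ∑ q ∈ T, θ q * covFun X P q p = ∑ p ∈ T, θ p := by
  refine Finset.sum_congr rfl fun p hp => ?_
  rw [(h.eq_one_iff p (h.subset p hp)).2 hp, mul_one]

theorem IsCenteredContinuousGaussian.continuous_potential [IsProbabilityMeasure P]
    (hX : IsCenteredContinuousGaussian X P) (T : Finset ℝ) (c : ℝ → ℝ) :
    Continuous fun t => ∑ p ∈ T, c p * covFun X P p t :=
  continuous_finsetSum _ fun _ _ => continuous_const.mul
    (hX.continuous_covFun.comp (continuous_const.prodMk continuous_id))

variable [IsProbabilityMeasure P]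

/-- The part of the process which is independent of `∑ p ∈ T, θ p * X p`, together with the
Gaussian facts about the decomposition. -/
theorem IsOptimalDual.exists_decomposition (hX : IsCenteredContinuousGaussian X P) (hab : a < b)
    (h : IsOptimalDual X P a b T θ) :
    ∃ Z : ℝ → Ω → ℝ, (∀ t ω, X t ω = (∑ p ∈ T, θ p * covFun X P p t) / (∑ p ∈ T, θ p) *
        (∑ p ∈ T, θ p * X p ω) + Z t ω) ∧
      (∀ (r : ℝ) (A : Set ℝ), MeasurableSet A →
        P ({ω | ∑ p ∈ T, θ p * X p ω ∈ A} ∩ {ω | ∃ t ∈ Icc a b, r < |Z t ω|}) =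
          P {ω | ∑ p ∈ T, θ p * X p ω ∈ A} * P {ω | ∃ t ∈ Icc a b, r < |Z t ω|} ∧
        P ({ω | ∑ p ∈ T, θ p * X p ω ∈ A} ∩ {ω | ∃ t ∈ Icc a b, r < |Z t ω|}ᶜ) =
          P {ω | ∑ p ∈ T, θ p * X p ω ∈ A} * P {ω | ∃ t ∈ Icc a b, r < |Z t ω|}ᶜ) ∧
      (∀ r, MeasurableSet {ω | ∃ t ∈ Icc a b, r < |Z t ω|}) ∧
      ∃ c > 0, ∃ C : ENNReal, C ≠ ⊤ ∧ ∀ r, 0 ≤ r →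
        P {ω | ∃ t ∈ Icc a b, r < |Z t ω|} ≤ C * ENNReal.ofReal (Real.exp (-(c * r ^ 2))) := by
  set τ := ∑ p ∈ T, θ p with hτ
  have hτ0 : 0 < τ := h.sum_pos hab
  have hG := hX.isGaussianProcess_option (fun t : ℝ => t) T θ
  have hWm := hX.measurable_sum T θ
  have hW0 := hX.integral_sum T θ
  have hvar : ∫ ω, (∑ q ∈ T, θ q * X q ω) ^ 2 ∂P = τ := by
    rw [hX.integral_sum_sq, h.sum_mul_eq]
  set W : Ω → ℝ := fun ω => ∑ q ∈ T, θ q * X q ω with hWdef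
  set Z : ℝ → Ω → ℝ := fun t ω => X t ω - (∑ p ∈ T, θ p * covFun X P p t) / τ * W ω with hZdef
  have hind : IndepFun W (fun ω t => Z t ω) P := by
    have := indepFun_residual hG hX.measurable hWm hW0 (by rw [hvar]; exact hτ0.ne')
    have e : ∀ t, ∫ ω, X t ω * W ω ∂P = ∑ p ∈ T, θ p * covFun X P p t := hX.integral_mul_sum T θ
    have e2 : ∫ ω, W ω ^ 2 ∂P = τ := hvar
    simpa only [e, e2] using this
  have hZG : IsGaussianProcess Z P :=
    (isGaussianProcess_residual hG fun t => (∑ p ∈ T, θ p * covFun X P p t) / τ).comp_right Sum.inr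
  have hZm : ∀ t, Measurable (Z t) := fun t => (hX.measurable t).sub (hWm.const_mul _)
  have hWi : Integrable W P :=
    integrable_finsetSum _ fun q _ => ((hX.memLp q).integrable one_le_two).const_mul _
  have hZ0 : ∀ t, ∫ ω, Z t ω ∂P = 0 := fun t => by
    rw [hZdef]
    simp only
    rw [integral_sub ((hX.memLp t).integrable one_le_two) (hWi.const_mul _), hX.centered,
      integral_const_mul, hW0]
    simp
  have hZc : ∀ ω, Continuous fun t => Z t ω := fun ω =>
    (hX.continuous ω).sub (((hX.continuous_potential T θ).div_const _).mul continuous_const)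
  obtain ⟨c, hc, G, hGm, hGlt, hGle⟩ := exists_envelope hZG hZm hZ0 isCompact_Icc
    (nonempty_Icc.2 hab.le) (fun ω => (hZc ω).continuousOn)
  obtain ⟨d, hdK, hd⟩ := exists_denseSeq_of_nonempty (nonempty_Icc.2 hab.le)
  have hset : ∀ r, {ω | ∃ t ∈ Icc a b, r < |Z t ω|} =
      (fun ω t => Z t ω) ⁻¹' {f : ℝ → ℝ | ∃ n, r < |f (d n)|} := by
    intro r
    ext ω
    simp only [mem_ofPred_eq, mem_preimage]
    constructor
    · rintro ⟨t, ht, htr⟩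
      by_contra! hcon
      exact absurd (forall_mem_of_forall_denseSeq hdK hd (hZc ω).abs.continuousOn isClosed_Iic
        hcon ht) (not_le.2 htr)
    · rintro ⟨n, hn⟩
      exact ⟨d n, hdK n, hn⟩
  have hmeas : ∀ r, MeasurableSet {f : ℝ → ℝ | ∃ n, r < |f (d n)|} := by
    intro r
    rw [ofPred_exists]
    exact MeasurableSet.iUnion fun n =>
      measurableSet_lt measurable_const (measurable_pi_apply (d n)).abs
  have hZmm : Measurable fun ω t => Z t ω := measurable_pi_lambda _ hZm
  refine ⟨Z, fun t ω => by simp only [hZdef, hWdef]; ring, fun r A hA => ⟨?_, ?_⟩, fun r => ?_, c, hc, _, hGlt.ne,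
    fun r hr => tail_le_of_envelope hc hr hGm hGle⟩
  · rw [hset]
    exact hind.measure_inter_preimage_eq_mul A _ hA (hmeas r)
  · rw [hset, ← preimage_compl]
    exact hind.measure_inter_preimage_eq_mul A _ hA (hmeas r).compl
  · rw [hset]
    exact hZmm (hmeas r)

theorem IsOptimalDual.map_eq (hX : IsCenteredContinuousGaussian X P)
    (h : IsOptimalDual X P a b T θ) :
    P.map (fun ω => ∑ q ∈ T, θ q * X q ω) = gaussianReal 0 (∑ p ∈ T, θ p).toNNReal := by
  have hG : HasGaussianLaw (fun ω => ∑ q ∈ T, θ q * X q ω) P :=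
    (hX.isGaussianProcess_option (fun t : ℝ => t) T θ).hasGaussianLaw_eval none
  rw [map_eq_gaussianReal_of_centered hG (hX.measurable_sum T θ) (hX.integral_sum T θ), hX.integral_sum_sq, h.sum_mul_eq]

/-- A high minimum already forces `W ≥ τu`, costing `exp(-τu²/2)`. A deviation from the profile
requires in addition an excess of `W` over `τu` of order `u`, or a residual of order `u`; the
residual is independent of `W`, so either way an extra factor `exp(-γu²)` appears. -/
theorem IsOptimalDual.measure_highEvent_bad_le (hX : IsCenteredContinuousGaussian X P)
    (hab : a < b) (h : IsOptimalDual X P a b T θ) {δ : ℝ} (hδ : 0 < δ) :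
    ∃ γ > 0, ∃ C : ENNReal, C ≠ ⊤ ∧ ∀ u > 0,
      P (highEvent X a b u ∩
          {ω | ∃ t ∈ Icc a b, δ * u < |X t ω - u * ∑ p ∈ T, θ p * covFun X P p t|}) ≤
        C * ENNReal.ofReal (Real.exp (-(((∑ p ∈ T, θ p) / 2 + γ) * u ^ 2))) := by
  obtain ⟨Z, hdec, hindep, -, c, hc, C, hC, htail⟩ := h.exists_decomposition hX hab
  have hmap := h.map_eq hX
  set τ := ∑ p ∈ T, θ p with hτ
  have hτ0 : 0 < τ := h.sum_pos hab
  set μ : ℝ → ℝ := fun t => ∑ p ∈ T, θ p * covFun X P p t with hμ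
  set W : Ω → ℝ := fun ω => ∑ q ∈ T, θ q * X q ω with hWdef
  have hμc : Continuous μ := hX.continuous_potential T θ
  obtain ⟨M, hM⟩ := isCompact_Icc.bddAbove_image (hμc.continuousOn (s := Icc a b))
  have hM' : ∀ t ∈ Icc a b, μ t ≤ M := fun t ht => hM ⟨t, ht, rfl⟩
  have hM1 : 1 ≤ M := (h.one_le a (left_mem_Icc.2 hab.le)).trans (hM' a (left_mem_Icc.2 hab.le))
  -- The deviation is at most `M δ' u` from the excess of `W` plus `δ' u` from the residual, hence
  -- `δ u` in total.
  set δ' := δ / (M + 1) with hδ'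
  have hδ'0 : 0 < δ' := by positivity
  have hδM : δ' * (M + 1) = δ := by rw [hδ']; field_simp
  refine ⟨min (τ * δ') (c * δ' ^ 2), by positivity, 1 + C, by simp [hC], fun u hu => ?_⟩
  have hsub : highEvent X a b u ∩ {ω | ∃ t ∈ Icc a b, δ * u < |X t ω - u * μ t|} ⊆
      {ω | τ * u * (1 + δ') ≤ W ω} ∪
        ({ω | W ω ∈ Ici (τ * u)} ∩ {ω | ∃ t ∈ Icc a b, δ' * u < |Z t ω|}) := by
    rintro ω ⟨hω, t, ht, htb⟩
    rw [mem_highEvent hX hab] at hω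
    have hW1 : τ * u ≤ W ω := by
      rw [hτ, Finset.sum_mul]
      exact Finset.sum_le_sum fun p hp =>
        mul_le_mul_of_nonneg_left (hω p (h.subset p hp)).le (h.nonneg p hp)
    by_contra hcon
    simp only [mem_union, mem_inter_iff, mem_ofPred_eq, mem_Ici, not_or, not_le, not_and,
      not_exists, not_lt] at hcon
    have hZ := hcon.2 hW1 t ht
    have h1 : 1 ≤ μ t := h.one_le t ht
    have h2 := hM' t ht
    have e : X t ω - u * μ t = μ t / τ * (W ω - τ * u) + Z t ω := by
      rw [hdec t ω]
      change μ t / τ * W ω + Z t ω - u * μ t = _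
      field_simp
      ring
    have h3 : |μ t / τ * (W ω - τ * u)| ≤ M * (u * δ') := by
      rw [abs_of_nonneg (mul_nonneg (by positivity) (by linarith))]
      calc μ t / τ * (W ω - τ * u) ≤ M / τ * (τ * u * δ') := by
            apply mul_le_mul _ (by linarith [hcon.1]) (by linarith) (by positivity)
            gcongr
        _ = _ := by field_simp
    have : |X t ω - u * μ t| ≤ δ * u := by
      rw [e, ← hδM]
      refine (abs_add_le _ _).trans ?_
      nlinarith
    exact absurd htb (not_lt.2 this)
  have hexp : ∀ x y : ℝ, x ≤ y → ENNReal.ofReal (Real.exp x) ≤ ENNReal.ofReal (Real.exp y) :=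
    fun x y hxy => ENNReal.ofReal_le_ofReal (Real.exp_le_exp.2 hxy)
  refine (measure_mono hsub).trans ((measure_union_le _ _).trans ?_)
  rw [add_mul, one_mul]
  refine add_le_add ?_ ?_
  · refine (gaussian_tail_le hτ0 hmap (by positivity)).trans (hexp _ _ ?_)
    have e : (τ * u * (1 + δ')) ^ 2 / (2 * τ) = τ / 2 * u ^ 2 * (1 + δ') ^ 2 := by
      field_simp
    rw [e]
    have h1 : min (τ * δ') (c * δ' ^ 2) * u ^ 2 ≤ τ * δ' * u ^ 2 := by
      gcongr; exact min_le_left _ _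
    nlinarith [mul_nonneg (mul_nonneg hτ0.le (sq_nonneg u)) (sq_nonneg δ')]
  · rw [(hindep (δ' * u) (Ici (τ * u)) measurableSet_Ici).1]
    have h1 := gaussian_tail_le hτ0 hmap (r := τ * u) (by positivity)
    have h2 := htail (δ' * u) (by positivity)
    refine (mul_le_mul' h1 h2).trans ?_
    rw [mul_left_comm, ← ENNReal.ofReal_mul (Real.exp_nonneg _), ← Real.exp_add]
    gcongr
    have e : (τ * u) ^ 2 / (2 * τ) = τ / 2 * u ^ 2 := by field_simp
    rw [e]
    have h1 : min (τ * δ') (c * δ' ^ 2) * u ^ 2 ≤ c * δ' ^ 2 * u ^ 2 := by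
      gcongr; exact min_le_right _ _
    nlinarith

/-- As the profile is at least 1, having `W` slightly above `τu` and a residual of small order `u`
suffices for a high minimum; by independence the probabilities multiply. -/
theorem IsOptimalDual.le_measure_highEvent (hX : IsCenteredContinuousGaussian X P)
    (hab : a < b) (h : IsOptimalDual X P a b T θ) {γ : ℝ} (hγ : 0 < γ) :
    ∃ c : ENNReal, c ≠ 0 ∧ c ≠ ⊤ ∧ ∀ᶠ u in atTop,
      c * ENNReal.ofReal (Real.exp (-(((∑ p ∈ T, θ p) / 2 + γ) * u ^ 2))) ≤
        P (highEvent X a b u) := by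
  obtain ⟨Z, hdec, hindep, hZm, c, hc, C, hC, htail⟩ := h.exists_decomposition hX hab
  have hmap := h.map_eq hX
  have hWm := hX.measurable_sum T θ
  set τ := ∑ p ∈ T, θ p with hτ
  have hτ0 : 0 < τ := h.sum_pos hab
  set μ : ℝ → ℝ := fun t => ∑ p ∈ T, θ p * covFun X P p t with hμ
  set W : Ω → ℝ := fun ω => ∑ q ∈ T, θ q * X q ω with hWdef
  set η := min 1 (γ / (8 * τ)) with hη
  have hη0 : 0 < η := lt_min one_pos (by positivity)
  have hη1 : η ≤ 1 := min_le_left _ _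
  have hη2 : 8 * τ * η ≤ γ := by
    have := min_le_right 1 (γ / (8 * τ))
    rw [← hη, le_div_iff₀ (by positivity)] at this
    linarith
  have hs : 0 < √(2 * Real.pi * τ) := Real.sqrt_pos.2 (by positivity)
  refine ⟨ENNReal.ofReal (√(2 * Real.pi * τ))⁻¹ * 2⁻¹, ?_, ENNReal.mul_ne_top (by simp) (by simp),
    ?_⟩
  · exact mul_ne_zero (by simpa using hs) (by simp)
  have hlim : Tendsto (fun u : ℝ => C * ENNReal.ofReal (Real.exp (-(c * (η * u) ^ 2)))) atTop
      (𝓝 0) := by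
    have h1 : Tendsto (fun u : ℝ => Real.exp (-(c * (η * u) ^ 2))) atTop (𝓝 0) := by
      refine Real.tendsto_exp_neg_atTop_nhds_zero.comp ?_
      refine Tendsto.const_mul_atTop hc ?_
      exact (tendsto_pow_atTop two_ne_zero).comp (tendsto_id.const_mul_atTop hη0)
    have h2 := ENNReal.tendsto_ofReal h1
    rw [ENNReal.ofReal_zero] at h2
    have := ENNReal.Tendsto.const_mul (a := C) h2 (Or.inr hC)
    simpa using this
  have hhalf : (0 : ENNReal) < 2⁻¹ := by simp
  -- The bound `τηu ≥ 1` absorbs the `+1` of the tail estimate by replacing `2η` with `3η`; the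
  -- other limit makes the residual small with probability at least 1/2.
  filter_upwards [eventually_gt_atTop 0, eventually_ge_atTop (1 / (τ * η)),
    hlim.eventually (gt_mem_nhds hhalf)] with u hu hu1 hu2
  have hτη : 1 ≤ τ * η * u := by
    rw [div_le_iff₀ (by positivity)] at hu1; linarith
  have hsub : {ω | W ω ∈ Ioi (τ * u * (1 + 2 * η))} ∩ {ω | ∃ t ∈ Icc a b, η * u < |Z t ω|}ᶜ ⊆
      highEvent X a b u := by
    rintro ω ⟨hω1, hω2⟩
    rw [mem_highEvent hX hab]
    intro t ht
    simp only [mem_compl_iff, mem_ofPred_eq, not_exists, not_and, not_lt] at hω2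
    have hZ := abs_le.1 (hω2 t ht)
    have h1 : 1 ≤ μ t := h.one_le t ht
    have hWω : τ * u * (1 + 2 * η) < W ω := hω1
    rw [hdec t ω]
    change u < μ t / τ * W ω + Z t ω
    have h2 : u * (1 + 2 * η) ≤ μ t / τ * W ω := by
      calc u * (1 + 2 * η) = 1 / τ * (τ * u * (1 + 2 * η)) := by field_simp
        _ ≤ _ := by gcongr
    nlinarith
  refine le_trans ?_ (measure_mono hsub)
  rw [(hindep (η * u) (Ioi (τ * u * (1 + 2 * η))) measurableSet_Ioi).2, mul_right_comm]
  refine mul_le_mul' ?_ ?_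
  · refine le_trans ?_ (le_gaussian_tail hτ0 hWm hmap (r := τ * u * (1 + 2 * η)) (by positivity))
    rw [ENNReal.ofReal_mul (by positivity)]
    gcongr
    rw [div_le_iff₀ (by positivity)]
    have h1 : (τ * u * (1 + 2 * η) + 1) ^ 2 ≤ (τ * u * (1 + 3 * η)) ^ 2 := by
      refine pow_le_pow_left₀ (by positivity) ?_ 2
      nlinarith
    refine h1.trans ?_
    have h2 : (1 + 3 * η) ^ 2 ≤ 1 + 16 * η := by nlinarith
    have h3 : τ * (1 + 3 * η) ^ 2 ≤ τ + 2 * γ := by nlinarith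
    calc (τ * u * (1 + 3 * η)) ^ 2 = τ * u ^ 2 * (τ * (1 + 3 * η) ^ 2) := by ring
      _ ≤ τ * u ^ 2 * (τ + 2 * γ) := by gcongr
      _ = _ := by ring
  · have h1 := (htail (η * u) (by positivity)).trans hu2.le
    rw [prob_compl_eq_one_sub (hZm _)]
    calc (2⁻¹ : ENNReal) = 1 - 2⁻¹ := by simp
      _ ≤ _ := tsub_le_tsub_left h1 1

theorem IsOptimalDual.measure_highEvent_ne_zero (hX : IsCenteredContinuousGaussian X P)
    (hab : a < b) (h : IsOptimalDual X P a b T θ) (u : ℝ) : P (highEvent X a b u) ≠ 0 := by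
  obtain ⟨c, hc, -, hev⟩ := h.le_measure_highEvent hX hab one_pos
  obtain ⟨v, hv, huv⟩ := (hev.and (eventually_ge_atTop u)).exists
  have h1 : P (highEvent X a b v) ≤ P (highEvent X a b u) :=
    measure_mono fun ω (hω : v < _) => lt_of_le_of_lt huv hω
  intro h0
  rw [h0] at h1
  have h2 := hv.trans h1
  rw [nonpos_iff_eq_zero, mul_eq_zero] at h2
  rcases h2 with h2 | h2
  · exact hc h2
  · simp only [ENNReal.ofReal_eq_zero, not_le.2 (Real.exp_pos _)] at h2

/-- Conditionally on a high minimum, the path divided by the level concentrates near the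
optimal profile. -/
theorem IsOptimalDual.tendsto_bad (hX : IsCenteredContinuousGaussian X P)
    (hab : a < b) (h : IsOptimalDual X P a b T θ) {δ : ℝ} (hδ : 0 < δ) :
    Tendsto (fun u => P (highEvent X a b u ∩
        {ω | ∃ t ∈ Icc a b, δ * u < |X t ω - u * ∑ p ∈ T, θ p * covFun X P p t|}) /
          P (highEvent X a b u)) atTop (𝓝 0) := by
  obtain ⟨γ, hγ, C, hC, hup⟩ := h.measure_highEvent_bad_le hX hab hδ
  -- Losing only `γ/2` in the lower bound leaves a factor `exp(-γu²/2)` in the quotient.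
  obtain ⟨c, hc, hc', hlow⟩ := h.le_measure_highEvent hX hab (half_pos hγ)
  set τ := ∑ p ∈ T, θ p with hτ
  have hlim : Tendsto (fun u : ℝ => C / c * ENNReal.ofReal (Real.exp (-(γ / 2 * u ^ 2)))) atTop
      (𝓝 0) := by
    have h1 : Tendsto (fun u : ℝ => Real.exp (-(γ / 2 * u ^ 2))) atTop (𝓝 0) := by
      refine Real.tendsto_exp_neg_atTop_nhds_zero.comp ?_
      exact Tendsto.const_mul_atTop (half_pos hγ) (tendsto_pow_atTop two_ne_zero)
    have h2 := ENNReal.tendsto_ofReal h1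
    rw [ENNReal.ofReal_zero] at h2
    have := ENNReal.Tendsto.const_mul (a := C / c) h2
      (Or.inr (ENNReal.div_ne_top hC hc))
    simpa using this
  refine tendsto_of_tendsto_of_tendsto_of_le_of_le' tendsto_const_nhds hlim
    (Eventually.of_forall fun _ => zero_le) ?_
  filter_upwards [hlow, eventually_gt_atTop 0] with u hu hu0
  refine ENNReal.div_le_of_le_mul ((hup u hu0).trans ?_)
  calc C * ENNReal.ofReal (Real.exp (-((τ / 2 + γ) * u ^ 2)))
      = C / c * ENNReal.ofReal (Real.exp (-(γ / 2 * u ^ 2))) *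
        (c * ENNReal.ofReal (Real.exp (-((τ / 2 + γ / 2) * u ^ 2)))) := by
        rw [mul_mul_mul_comm, ENNReal.div_mul_cancel hc hc', ← ENNReal.ofReal_mul
          (Real.exp_nonneg _), ← Real.exp_add]
        congr 4
        ring
    _ ≤ _ := by gcongr

end

/-! ### Level events and their asymptotic probabilities -/

/-- The event that the path stays above `u` on `[a,b]`, and above `u + x p / u` in the
`ε`-neighbourhood of each point `p` of `T`. -/
def levelEvent {Ω : Type*} (X : ℝ → Ω → ℝ) (a b ε : ℝ) (T : Finset ℝ) (x : ℝ → ℝ) (u : ℝ) : Set Ω :=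
  {ω | (∀ t ∈ Icc a b, u < X t ω) ∧
    ∀ p ∈ T, ∀ t ∈ Icc (p - ε) (p + ε) ∩ Icc a b, u + x p / u < X t ω}

/-- A measurable set of functions whose continuous elements are the paths in `levelEvent`. -/
theorem exists_measurableSet_levelEvent {a b ε : ℝ} (hab : a < b) (hε : 0 < ε) {T : Finset ℝ}
    (hT : ∀ p ∈ T, p ∈ Icc a b) (x : ℝ → ℝ) (u : ℝ) :
    ∃ B : Set (ℝ → ℝ), MeasurableSet B ∧ ∀ f : ℝ → ℝ, Continuous f →
      (f ∈ B ↔ (∀ t ∈ Icc a b, u < f t) ∧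
        ∀ p ∈ T, ∀ t ∈ Icc (p - ε) (p + ε) ∩ Icc a b, u + x p / u < f t) := by
  have hne : ∀ p ∈ T, (Icc (p - ε) (p + ε) ∩ Icc a b).Nonempty := fun p hp =>
    ⟨p, ⟨by linarith, by linarith⟩, hT p hp⟩
  obtain ⟨d, hdK, hd⟩ := exists_denseSeq_of_nonempty (nonempty_Icc.2 hab.le)
  choose! e heK he using fun p hp => exists_denseSeq_of_nonempty (hne p hp)
  have hM : ∀ (r : ℝ) (d : ℕ → ℝ),
      MeasurableSet {f : ℝ → ℝ | ∃ m : ℕ, ∀ n, r + 1 / ((m : ℝ) + 1) ≤ f (d n)} := by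
    intro r d
    rw [ofPred_exists]
    refine MeasurableSet.iUnion fun m => ?_
    rw [ofPred_forall]
    exact MeasurableSet.iInter fun n => measurableSet_le measurable_const (measurable_pi_apply _)
  refine ⟨{f | ∃ m : ℕ, ∀ n, u + 1 / ((m : ℝ) + 1) ≤ f (d n)} ∩
    ⋂ p ∈ T, {f | ∃ m : ℕ, ∀ n, u + x p / u + 1 / ((m : ℝ) + 1) ≤ f (e p n)},
    (hM _ _).inter (T.measurableSet_biInter fun p _ => hM _ _), fun f hf => ?_⟩
  rw [mem_inter_iff, mem_iInter₂]
  refine and_congr ?_ (forall₂_congr fun p hp => ?_)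
  · exact (forall_lt_iff_exists_denseSeq isCompact_Icc (nonempty_Icc.2 hab.le) hdK hd
      hf.continuousOn u).symm
  · exact (forall_lt_iff_exists_denseSeq (isCompact_Icc.inter isCompact_Icc) (hne p hp)
      (heK p hp) (he p hp) hf.continuousOn _).symm

section

variable {Ω : Type*} [MeasurableSpace Ω] {P : Measure Ω}
  {X : ℝ → Ω → ℝ} {a b ε : ℝ} {T : Finset ℝ} {θ : ℝ → ℝ}

theorem measurableSet_levelEvent (hX : IsCenteredContinuousGaussian X P) (hab : a < b)
    (hε : 0 < ε) (hT : ∀ p ∈ T, p ∈ Icc a b) (x : ℝ → ℝ) (u : ℝ) :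
    MeasurableSet (levelEvent X a b ε T x u) := by
  obtain ⟨B, hB, hBiff⟩ := exists_measurableSet_levelEvent hab hε hT x u
  have : levelEvent X a b ε T x u = (fun ω t => X t ω) ⁻¹' B := by
    ext ω
    exact (hBiff _ (hX.continuous ω)).symm
  rw [this]
  exact (measurable_pi_lambda (fun ω t => X t ω) hX.measurable) hB

theorem levelEvent_zero (hX : IsCenteredContinuousGaussian X P) (hab : a < b) (u : ℝ) :
    levelEvent X a b ε T (fun _ => 0) u = highEvent X a b u := by
  ext ω
  rw [mem_highEvent hX hab]
  simp only [levelEvent, zero_div, add_zero, mem_ofPred_eq]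
  exact ⟨fun h => h.1, fun h => ⟨h, fun p _ t ht => h t ht.2⟩⟩

variable [IsProbabilityMeasure P]

/-- Away from `T` the optimal profile is bounded away from its minimum. -/
theorem IsOptimalDual.exists_gap (hX : IsCenteredContinuousGaussian X P)
    (h : IsOptimalDual X P a b T θ) (hε : 0 < ε) :
    ∃ κ > 0, ∀ t ∈ Icc a b, (∀ p ∈ T, ε ≤ |t - p|) →
      1 + κ ≤ ∑ p ∈ T, θ p * covFun X P p t := by
  have hc := hX.continuous_potential T θ
  have hK : IsCompact (Icc a b ∩ ⋂ p ∈ T, {t : ℝ | ε ≤ |t - p|}) := by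
    refine isCompact_Icc.inter_right ?_
    exact isClosed_biInter fun p _ => isClosed_le continuous_const (by fun_prop)
  rcases (Icc a b ∩ ⋂ p ∈ T, {t : ℝ | ε ≤ |t - p|}).eq_empty_or_nonempty with he | hne
  · refine ⟨1, one_pos, fun t ht htp => ?_⟩
    have : t ∈ Icc a b ∩ ⋂ p ∈ T, {t : ℝ | ε ≤ |t - p|} := ⟨ht, mem_iInter₂.2 htp⟩
    rw [he] at this
    exact this.elim
  · obtain ⟨s, hs, hmin⟩ := hK.exists_isMinOn hne hc.continuousOn
    refine ⟨(∑ p ∈ T, θ p * covFun X P p s) - 1, ?_, fun t ht htp => ?_⟩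
    · have h1 := h.one_le s hs.1
      have h2 : ∑ p ∈ T, θ p * covFun X P p s ≠ 1 := by
        intro he
        have hsT := (h.eq_one_iff s hs.1).1 he
        have := mem_iInter₂.1 hs.2 s hsT
        simp only [sub_self, abs_zero, mem_ofPred_eq] at this
        linarith
      exact sub_pos.2 (lt_of_le_of_ne h1 (Ne.symm h2))
    · have h1 : ∑ p ∈ T, θ p * covFun X P p s ≤ ∑ p ∈ T, θ p * covFun X P p t :=
        hmin (⟨ht, mem_iInter₂.2 htp⟩ : t ∈ Icc a b ∩ ⋂ p ∈ T, {t : ℝ | ε ≤ |t - p|})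
      linarith

/-- Comparison of the probabilities of two level events by a Cameron–Martin shift. -/
theorem IsOptimalDual.le_measure_levelEvent (hX : IsCenteredContinuousGaussian X P) (hab : a < b)
    (h : IsOptimalDual X P a b T θ) (hε : 0 < ε)
    (hsep : ∀ p ∈ T, ∀ q ∈ T, p ≠ q → 2 * ε < |p - q|) {x y : ℝ → ℝ}
    (hx : ∀ p ∈ T, 0 ≤ x p) {ρ : ℝ} (hρ : 0 < ρ) :
    ∃ δ > 0, ∀ᶠ u in atTop,
      ENNReal.ofReal (Real.exp (-(∑ p ∈ T, θ p * (x p - y p)) - ρ)) *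
        P (levelEvent X a b ε T y u ∩
          {ω | ∃ t ∈ Icc a b, δ * u < |X t ω - u * ∑ p ∈ T, θ p * covFun X P p t|}ᶜ) ≤
        P (levelEvent X a b ε T x u) := by
  have hτ0 := h.sum_pos hab
  set τ := ∑ p ∈ T, θ p with hτ
  set μ : ℝ → ℝ := fun t => ∑ p ∈ T, θ p * covFun X P p t with hμ
  set η := ρ / (3 * τ) with hη
  have hη0 : 0 < η := by positivity
  have hητ : τ * η = ρ / 3 := by rw [hη]; field_simp
  -- The shift `g/u` turns level `y` into level `x` at each `p`; the surplus `η` keeps the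
  -- inequality strict on a neighbourhood of `p`.
  obtain ⟨c, hc⟩ := h.solvable fun p => x p - y p + η
  set g : ℝ → ℝ := fun t => ∑ p ∈ T, c p * covFun X P p t with hg
  have hgc : Continuous g := hX.continuous_potential T c
  obtain ⟨ε', hε'0, hε'ε, hε'⟩ : ∃ ε' > 0, ε' ≤ ε ∧
      ∀ p ∈ T, ∀ t, |t - p| < ε' → x p - y p < g t := by
    have h1 : ∀ p ∈ T, ∀ᶠ e in 𝓝[>] (0 : ℝ), ∀ t, |t - p| < e → x p - y p < g t := by
      intro p hp
      have hgp : x p - y p < g p := by rw [hg]; simp only; rw [hc p hp]; linarith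
      have h2 := hgc.continuousAt.eventually (lt_mem_nhds hgp)
      obtain ⟨e, he, hball⟩ := Metric.eventually_nhds_iff.1 h2
      filter_upwards [Ioo_mem_nhdsGT he] with e' he' t ht
      exact hball (by rw [Real.dist_eq]; exact ht.trans he'.2)
    have h2 := (Finset.eventually_all T).2 h1
    obtain ⟨e, he1, he2⟩ := (h2.and (Ioc_mem_nhdsGT hε)).exists
    exact ⟨e, he2.1, he2.2, he1⟩
  obtain ⟨κ, hκ0, hκ⟩ := h.exists_gap hX hε'0
  set S := ∑ p ∈ T, |c p| + 1 with hS
  have hS0 : 0 < S := by positivity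
  set Mx := ∑ p ∈ T, x p with hMx
  have hxM : ∀ p ∈ T, x p ≤ Mx := fun p hp => Finset.single_le_sum hx hp
  have hMx0 : 0 ≤ Mx := Finset.sum_nonneg hx
  obtain ⟨Mg, hMg⟩ := isCompact_Icc.bddAbove_image (hgc.abs.continuousOn (s := Icc a b))
  have hgM : ∀ t ∈ Icc a b, |g t| ≤ Mg := fun t ht => hMg ⟨t, ht, rfl⟩
  have hMg0 : 0 ≤ Mg := (abs_nonneg _).trans (hgM a (left_mem_Icc.2 hab.le))
  set v := ∫ ω, (∑ p ∈ T, c p * X p ω) ^ 2 ∂P with hv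
  have hv0 : 0 ≤ v := integral_nonneg fun ω => sq_nonneg _
  -- With `κ/2` half of the gap away from `T` survives. With `ρ/(3S)` the error of replacing `X p`
  -- by `u` in the exponent is at most `ρ/3`; the surplus `η` and the variance term account for the
  -- other two thirds of `ρ`.
  refine ⟨min (κ / 2) (ρ / (3 * S)), by positivity, ?_⟩
  set δ := min (κ / 2) (ρ / (3 * S)) with hδ
  have hδ0 : 0 < δ := by positivity
  have hδκ : δ ≤ κ / 2 := min_le_left _ _
  have hδS : δ * S ≤ ρ / 3 := by
    have : δ ≤ ρ / (3 * S) := min_le_right _ _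
    calc δ * S ≤ ρ / (3 * S) * S := by gcongr
      _ = ρ / 3 := by field_simp
  -- Insert `1 = ∑ q, θ q * R(q,p)` and exchange the sums: by symmetry of `R` the coefficients `c`
  -- add up to the `θ`-weighted values of `g`.
  have hcsum : ∑ p ∈ T, c p = ∑ p ∈ T, θ p * (x p - y p) + ρ / 3 := by
    calc ∑ p ∈ T, c p = ∑ p ∈ T, c p * ∑ q ∈ T, θ q * covFun X P q p := by
          refine Finset.sum_congr rfl fun p hp => ?_
          rw [(h.eq_one_iff p (h.subset p hp)).2 hp, mul_one]
      _ = ∑ q ∈ T, θ q * ∑ p ∈ T, c p * covFun X P p q := by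
          simp_rw [Finset.mul_sum]
          rw [Finset.sum_comm]
          refine Finset.sum_congr rfl fun q _ => Finset.sum_congr rfl fun p _ => ?_
          rw [covFun_comm q p]; ring
      _ = ∑ q ∈ T, (θ q * (x q - y q) + θ q * η) := by
          refine Finset.sum_congr rfl fun q hq => ?_
          rw [hc q hq]; ring
      _ = _ := by rw [Finset.sum_add_distrib, ← Finset.sum_mul, ← hτ, hητ]
  filter_upwards [eventually_ge_atTop 1, eventually_ge_atTop (2 * (Mx + Mg + 1) / κ),
    eventually_ge_atTop (3 * v / (2 * ρ))] with u hu1 hu2 hu3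
  have hu0 : 0 < u := by linarith
  obtain ⟨B, hB, hBiff⟩ := exists_measurableSet_levelEvent hab hε h.subset x u
  have hlev : levelEvent X a b ε T x u = {ω | (fun t => X t ω) ∈ B} := by
    ext ω
    exact (hBiff _ (hX.continuous ω)).symm
  have hgu : ∀ t, ∫ ω, X t ω * ∑ p ∈ T, c p / u * X p ω ∂P = g t / u := by
    intro t
    rw [hX.integral_mul_sum, hg, Finset.sum_div]
    exact Finset.sum_congr rfl fun p _ => by ring
  have hvu : ∫ ω, (∑ p ∈ T, c p / u * X p ω) ^ 2 ∂P = v / u ^ 2 := by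
    rw [hv, ← integral_div]
    congr 1; ext ω
    rw [← div_pow, Finset.sum_div]
    congr 1
    exact Finset.sum_congr rfl fun p _ => by ring
  have hcm := exp_mul_measure_le_of_shift (A := levelEvent X a b ε T y u ∩
      {ω | ∃ t ∈ Icc a b, δ * u < |X t ω - u * μ t|}ᶜ)
    (m := ∑ p ∈ T, θ p * (x p - y p) + 2 * ρ / 3)
    (hX.isGaussianProcess_option (fun t : ℝ => t) T fun p => c p / u) hX.measurable
    (hX.measurable_sum T _) (hX.integral_sum T _) hB ?_ ?_
  · rw [hlev]
    refine le_trans (mul_le_mul' (ENNReal.ofReal_le_ofReal (Real.exp_le_exp.2 ?_)) le_rfl) hcm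
    rw [hvu]
    have : v / u ^ 2 / 2 ≤ ρ / 3 := by
      rw [div_le_iff₀ (by positivity)] at hu3
      rw [div_div, div_le_iff₀ (by positivity)]
      have h1 : u ≤ u ^ 2 := by nlinarith
      have h2 : u * ρ ≤ u ^ 2 * ρ := mul_le_mul_of_nonneg_right h1 hρ.le
      nlinarith
    linarith
  · rintro ω ⟨hωy, hωg⟩
    simp only [mem_compl_iff, mem_ofPred_eq, not_exists, not_and, not_lt] at hωg
    simp only [hgu]
    refine (hBiff (fun t => X t ω + g t / u) ((hX.continuous ω).add (hgc.div_const u))).2 ?_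
    -- Here the path is at least `(1 + κ/2)u`, and a shift of order `1/u` cannot use up a surplus of
    -- order `u`.
    have hfar : ∀ t ∈ Icc a b, (∀ p ∈ T, ε' ≤ |t - p|) → u + Mx / u < X t ω + g t / u := by
      intro t ht htp
      have h1 := (abs_le.1 (hωg t ht)).1
      have h2 := hκ t ht htp
      have h3 := (abs_le.1 (hgM t ht)).1
      have h4 : u * (1 + κ) ≤ u * μ t := by gcongr
      have h5 : δ * u ≤ κ / 2 * u := by gcongr
      have h6 : (Mx + Mg) / u < κ / 2 * u := by
        rw [div_lt_iff₀ hu0]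
        rw [div_le_iff₀ hκ0] at hu2
        have h7 : u * κ ≤ u * u * κ :=
          mul_le_mul_of_nonneg_right (by nlinarith) hκ0.le
        nlinarith
      have h7 : -Mg / u ≤ g t / u := by gcongr
      have h8 : (Mx + Mg) / u = Mx / u - -Mg / u := by ring
      linarith
    have hnear : ∀ p ∈ T, ∀ t ∈ Icc a b, |t - p| < ε' → u + x p / u < X t ω + g t / u := by
      intro p hp t ht htp
      have h1 := hωy.2 p hp t ⟨by
        have := abs_lt.1 htp
        exact ⟨by linarith, by linarith⟩, ht⟩
      have h2 : (x p - y p) / u < g t / u := by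
        have := hε' p hp t htp
        gcongr
      rw [sub_div] at h2
      linarith
    refine ⟨fun t ht => ?_, fun p hp t ht => ?_⟩
    · by_cases hcase : ∀ p ∈ T, ε' ≤ |t - p|
      · have := hfar t ht hcase
        have : 0 ≤ Mx / u := by positivity
        linarith
      · push Not at hcase
        obtain ⟨p, hp, hpt⟩ := hcase
        have := hnear p hp t ht hpt
        have : 0 ≤ x p / u := div_nonneg (hx p hp) hu0.le
        linarith
    · by_cases hcase : ∀ p ∈ T, ε' ≤ |t - p|
      · have h1 := hfar t ht.2 hcase
        have h2 : x p / u ≤ Mx / u := by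
          have := hxM p hp
          gcongr
        linarith
      · push Not at hcase
        obtain ⟨q, hq, hqt⟩ := hcase
        rcases eq_or_ne p q with rfl | hpq
        · exact hnear p hp t ht.2 hqt
        · exfalso
          have h1 := hsep p hp q hq hpq
          have h2 : |t - p| ≤ ε := by
            rw [abs_le]; constructor <;> linarith [ht.1.1, ht.1.2]
          have h3 : |p - q| ≤ |t - p| + |t - q| := by
            have := abs_sub_le p t q
            rwa [abs_sub_comm p t] at this
          linarith
  · rintro ω ⟨-, hωg⟩
    simp only [mem_compl_iff, mem_ofPred_eq, not_exists, not_and, not_lt] at hωg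
    have h1 : ∑ p ∈ T, c p / u * X p ω ≤ ∑ p ∈ T, (c p + δ * |c p|) := by
      refine Finset.sum_le_sum fun p hp => ?_
      have h2 := hωg p (h.subset p hp)
      have h3 : μ p = 1 := (h.eq_one_iff p (h.subset p hp)).2 hp
      rw [h3, mul_one] at h2
      have h4 : c p * (X p ω - u) ≤ |c p| * (δ * u) := by
        refine (le_abs_self _).trans ?_
        rw [abs_mul]
        gcongr
      rw [div_mul_eq_mul_div, div_le_iff₀ hu0]
      nlinarith
    refine h1.trans ?_
    rw [Finset.sum_add_distrib, ← Finset.mul_sum, hcsum]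
    have : δ * ∑ p ∈ T, |c p| ≤ δ * S := by gcongr; linarith
    linarith

/-- Shift from level 0 to `x` for the lower bound and from `x` back to 0 for the upper bound. The
paths off the profile are negligible, and the tolerance `ρ` is sent to 0 last. -/
theorem IsOptimalDual.tendsto_levelEvent (hX : IsCenteredContinuousGaussian X P) (hab : a < b)
    (h : IsOptimalDual X P a b T θ) (hε : 0 < ε)
    (hsep : ∀ p ∈ T, ∀ q ∈ T, p ≠ q → 2 * ε < |p - q|) {x : ℝ → ℝ} (hx : ∀ p ∈ T, 0 ≤ x p) :
    Tendsto (fun u => P.real (levelEvent X a b ε T x u) / P.real (highEvent X a b u)) atTop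
      (𝓝 (Real.exp (-∑ p ∈ T, θ p * x p))) := by
  set L := Real.exp (-∑ p ∈ T, θ p * x p) with hL
  have hL0 : 0 < L := Real.exp_pos _
  have hH0 : ∀ u, 0 < P.real (highEvent X a b u) := fun u => by
    rw [measureReal_def]
    exact ENNReal.toReal_pos (h.measure_highEvent_ne_zero hX hab u) (measure_ne_top _ _)
  set bad : ℝ → ℝ → Set Ω := fun δ u =>
    {ω | ∃ t ∈ Icc a b, δ * u < |X t ω - u * ∑ p ∈ T, θ p * covFun X P p t|} with hbad
  have hbadlim : ∀ δ > 0, Tendsto (fun u => P.real (highEvent X a b u ∩ bad δ u) /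
      P.real (highEvent X a b u)) atTop (𝓝 0) := by
    intro δ hδ
    have := (ENNReal.tendsto_toReal (a := 0) (by simp)).comp (h.tendsto_bad hX hab hδ)
    simpa only [Function.comp_def, measureReal_def, hbad, ENNReal.toReal_div,
      ENNReal.toReal_zero] using this
  have hlevsub : ∀ u, levelEvent X a b ε T x u ⊆ highEvent X a b u := fun u ω hω =>
    (mem_highEvent hX hab).2 hω.1
  have hreal : ∀ {r : ℝ} {A B : Set Ω}, ENNReal.ofReal (Real.exp r) * P A ≤ P B →
      Real.exp r * P.real A ≤ P.real B := by
    intro r A B hAB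
    have := ENNReal.toReal_mono (measure_ne_top _ _) hAB
    rwa [ENNReal.toReal_mul, ENNReal.toReal_ofReal (Real.exp_nonneg _)] at this
  have hlow : ∀ ρ > 0, ∃ δ > 0, ∀ᶠ u in atTop, L * Real.exp (-ρ) *
      (1 - P.real (highEvent X a b u ∩ bad δ u) / P.real (highEvent X a b u)) ≤
        P.real (levelEvent X a b ε T x u) / P.real (highEvent X a b u) := by
    intro ρ hρ
    obtain ⟨δ, hδ, hev⟩ := h.le_measure_levelEvent hX hab hε hsep (y := fun _ => 0) hx hρ
    refine ⟨δ, hδ, ?_⟩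
    filter_upwards [hev] with u hu
    rw [levelEvent_zero hX hab] at hu
    have h1 := hreal hu
    have h2 : P.real (highEvent X a b u) ≤ P.real (highEvent X a b u ∩ (bad δ u)ᶜ) +
        P.real (highEvent X a b u ∩ bad δ u) := by
      refine le_trans (measureReal_mono ?_) (measureReal_union_le _ _)
      intro ω hω
      by_cases hb : ω ∈ bad δ u
      · exact Or.inr ⟨hω, hb⟩
      · exact Or.inl ⟨hω, hb⟩
    rw [le_div_iff₀ (hH0 u), mul_assoc, sub_mul, one_mul, div_mul_cancel₀ _ (hH0 u).ne']
    refine le_trans ?_ h1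
    rw [hL, ← Real.exp_add]
    simp only [sub_zero]
    rw [← sub_eq_add_neg]
    gcongr
    linarith
  have hup : ∀ ρ > 0, ∃ δ > 0, ∀ᶠ u in atTop,
        P.real (levelEvent X a b ε T x u) / P.real (highEvent X a b u) ≤
      L * Real.exp ρ + P.real (highEvent X a b u ∩ bad δ u) / P.real (highEvent X a b u) := by
    intro ρ hρ
    obtain ⟨δ, hδ, hev⟩ := h.le_measure_levelEvent hX hab hε hsep (x := fun _ => 0) (y := x)
      (fun _ _ => le_rfl) hρ
    refine ⟨δ, hδ, ?_⟩
    filter_upwards [hev] with u hu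
    rw [levelEvent_zero hX hab] at hu
    have h1 := hreal hu
    have h2 : P.real (levelEvent X a b ε T x u) ≤
        P.real (levelEvent X a b ε T x u ∩ (bad δ u)ᶜ) +
        P.real (highEvent X a b u ∩ bad δ u) := by
      refine le_trans (measureReal_mono ?_) (measureReal_union_le _ _)
      intro ω hω
      by_cases hb : ω ∈ bad δ u
      · exact Or.inr ⟨hlevsub u hω, hb⟩
      · exact Or.inl ⟨hω, hb⟩
    have h3 : P.real (levelEvent X a b ε T x u ∩ (bad δ u)ᶜ) ≤
        L * Real.exp ρ * P.real (highEvent X a b u) := by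
      have e : L * Real.exp ρ * Real.exp (-(∑ p ∈ T, θ p * (0 - x p)) - ρ) = 1 := by
        rw [hL, ← Real.exp_add, ← Real.exp_add]
        simp
      calc P.real (levelEvent X a b ε T x u ∩ (bad δ u)ᶜ) =
          L * Real.exp ρ * (Real.exp (-(∑ p ∈ T, θ p * (0 - x p)) - ρ) *
            P.real (levelEvent X a b ε T x u ∩ (bad δ u)ᶜ)) := by
            rw [← mul_assoc, e, one_mul]
        _ ≤ _ := by gcongr
    rw [div_le_iff₀ (hH0 u), add_mul, div_mul_cancel₀ _ (hH0 u).ne']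
    linarith
  rw [tendsto_order]
  constructor
  · intro r hr
    have hcont : Tendsto (fun ρ : ℝ => L * Real.exp (-ρ)) (𝓝[>] 0) (𝓝 L) := by
      have : Continuous fun ρ : ℝ => L * Real.exp (-ρ) := by fun_prop
      simpa using (this.tendsto 0).mono_left nhdsWithin_le_nhds
    obtain ⟨ρ, h1, hρ⟩ := ((hcont.eventually (lt_mem_nhds hr)).and self_mem_nhdsWithin).exists
    obtain ⟨δ, hδ, hev⟩ := hlow ρ hρ
    have hl := ((hbadlim δ hδ).const_sub 1).const_mul (L * Real.exp (-ρ))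
    rw [sub_zero, mul_one] at hl
    filter_upwards [hev, hl.eventually (lt_mem_nhds h1)] with u h2 h3
    exact h3.trans_le h2
  · intro r hr
    have hcont : Tendsto (fun ρ : ℝ => L * Real.exp ρ) (𝓝[>] 0) (𝓝 L) := by
      have : Continuous fun ρ : ℝ => L * Real.exp ρ := by fun_prop
      simpa using (this.tendsto 0).mono_left nhdsWithin_le_nhds
    obtain ⟨ρ, h1, hρ⟩ := ((hcont.eventually (gt_mem_nhds hr)).and self_mem_nhdsWithin).exists
    obtain ⟨δ, hδ, hev⟩ := hup ρ hρ
    have hl := (hbadlim δ hδ).const_add (L * Real.exp ρ)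
    rw [add_zero] at hl
    filter_upwards [hev, hl.eventually (gt_mem_nhds h1)] with u h2 h3
    exact h2.trans_lt h3

end

/-! ### Weak convergence from orthant probabilities -/

/-- Convergence of the probabilities of all upper orthants implies weak convergence. -/
theorem tendsto_probabilityMeasure_of_tendsto_orthant {ι κ : Type*} [Fintype κ] {l : Filter ι}
    [l.IsCountablyGenerated] {μ : ι → ProbabilityMeasure (κ → ℝ)} {ν : ProbabilityMeasure (κ → ℝ)}
    (h : ∀ y : κ → ℝ, Tendsto (fun i => (μ i : Measure (κ → ℝ)).real (univ.pi fun j => Ioi (y j))) l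
      (𝓝 ((ν : Measure (κ → ℝ)).real (univ.pi fun j => Ioi (y j))))) :
    Tendsto μ l (𝓝 ν) := by
  classical
  set orth : (κ → ℝ) → Set (κ → ℝ) := fun y => univ.pi fun j => Ioi (y j) with horth
  have horm : ∀ y, MeasurableSet (orth y) := fun y => MeasurableSet.univ_pi fun _ => measurableSet_Ioi
  have hpi : IsPiSystem (range orth) := by
    rintro _ ⟨x, rfl⟩ _ ⟨y, rfl⟩ -
    refine ⟨fun j => max (x j) (y j), ?_⟩
    simp only [horth, ← pi_inter_distrib, Ioi_inter_Ioi]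
  -- A half-open box is an orthant minus a finite union of smaller orthants. The `max` keeps those
  -- inside the large one even when the box is empty.
  have hbox : ∀ (ρ : Measure (κ → ℝ)) [IsProbabilityMeasure ρ] (x y : κ → ℝ),
      ρ.real (univ.pi fun j => Ioc (x j) (y j)) = ρ.real (orth x) -
        ρ.real (⋃ s ∈ Finset.univ.image fun j => orth (Function.update x j (max (x j) (y j))), s) := by
    intro ρ _ x y
    have hsub : (⋃ s ∈ Finset.univ.image fun j => orth (Function.update x j (max (x j) (y j))), s) ⊆
        orth x := by
      refine iUnion₂_subset fun s hs => ?_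
      obtain ⟨j, -, rfl⟩ := Finset.mem_image.1 hs
      intro v hv i _
      have := hv i (mem_univ i)
      rcases eq_or_ne i j with rfl | hij
      · simp only [Function.update_self, mem_Ioi, max_lt_iff] at this
        exact this.1
      · simpa only [Function.update_of_ne hij] using this
    rw [← measureReal_sdiff hsub (Finset.measurableSet_biUnion _ fun s hs => by
      obtain ⟨j, -, rfl⟩ := Finset.mem_image.1 hs
      exact horm _)]
    congr 1
    ext v
    simp only [Set.mem_sdiff, mem_iUnion, Finset.mem_image, Finset.mem_univ, true_and, exists_prop,
      exists_exists_eq_and, not_exists, horth, mem_univ_pi, mem_Ioc, mem_Ioi]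
    constructor
    · intro hv
      refine ⟨fun j => (hv j).1, fun j hj => ?_⟩
      have := hj j
      simp only [Function.update_self, max_lt_iff] at this
      exact absurd this.2 (not_lt.2 (hv j).2)
    · rintro ⟨h1, h2⟩ j
      refine ⟨h1 j, ?_⟩
      by_contra! hlt
      refine h2 j fun i => ?_
      rcases eq_or_ne i j with rfl | hij
      · simp [h1 i, hlt]
      · simp [Function.update_of_ne hij, h1 i]
  refine IsPiSystem.tendsto_probabilityMeasure_of_tendsto_of_mem
    (S := {s | ∃ x y : κ → ℝ, s = univ.pi fun j => Ioc (x j) (y j)}) ?_ ?_ ?_ ?_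
  · rintro _ ⟨x, y, rfl⟩ _ ⟨x', y', rfl⟩ -
    refine ⟨fun j => max (x j) (x' j), fun j => min (y j) (y' j), ?_⟩
    simp only [← pi_inter_distrib, Ioc_inter_Ioc]
  · rintro _ ⟨x, y, rfl⟩
    exact MeasurableSet.univ_pi fun _ => measurableSet_Ioc
  · intro U hU v hv
    obtain ⟨e, he, hball⟩ := Metric.isOpen_iff.1 hU v hv
    refine ⟨_, ⟨fun j => v j - e / 2, fun j => v j + e / 2, rfl⟩, ?_, fun w hw => hball ?_⟩
    · exact set_pi_mem_nhds finite_univ fun j _ =>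
        Ioc_mem_nhds (by linarith) (by linarith)
    · rw [Metric.mem_ball]
      refine lt_of_le_of_lt ((dist_pi_le_iff (half_pos he).le).2 fun j => ?_) (half_lt_self he)
      have := hw j (mem_univ j)
      rw [Real.dist_eq, abs_le]
      constructor <;> linarith [this.1, this.2]
  · rintro _ ⟨x, y, rfl⟩
    have hreal : Tendsto (fun i => (μ i : Measure (κ → ℝ)).real (univ.pi fun j => Ioc (x j) (y j))) l
        (𝓝 ((ν : Measure (κ → ℝ)).real (univ.pi fun j => Ioc (x j) (y j)))) := by
      simp_rw [hbox]
      refine (h x).sub (hpi.tendsto_measureReal_biUnion ?_ ?_ ?_)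
      · intro s hs
        obtain ⟨j, -, rfl⟩ := Finset.mem_image.1 hs
        exact ⟨_, rfl⟩
      · rintro _ ⟨y, rfl⟩
        exact horm y
      · rintro _ ⟨y, rfl⟩
        exact h y
    rw [← NNReal.tendsto_coe]
    exact hreal

theorem measureReal_expMeasure_Ioi {r : ℝ} (hr : 0 < r) (x : ℝ) :
    (expMeasure r).real (Ioi x) = Real.exp (-(r * max x 0)) := by
  have := isProbabilityMeasure_expMeasure hr
  have h1 : (expMeasure r).real (Ioi x) = 1 - cdf (expMeasure r) x := by
    rw [cdf_eq_real, ← compl_Iic, probReal_compl_eq_one_sub measurableSet_Iic]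
  rw [h1, cdf_expMeasure_eq hr]
  split_ifs with h
  · rw [max_eq_left h]; ring
  · rw [max_eq_right (not_le.1 h).le]; simp

/-! ### Location of the minimum and the exponential limit -/

section

variable {Ω : Type*} [MeasurableSpace Ω] {P : Measure Ω} {X : ℝ → Ω → ℝ} {a b ε : ℝ}

theorem measurable_minOn (hX : IsCenteredContinuousGaussian X P) {K : Set ℝ} (hK : IsCompact K)
    (hne : K.Nonempty) : Measurable (minOn X K) := by
  obtain ⟨d, hdK, hd⟩ := exists_denseSeq_of_nonempty hne
  refine measurable_of_Ioi fun r => ?_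
  have : minOn X K ⁻¹' Ioi r = ⋃ m : ℕ, ⋂ n, {ω | r + 1 / ((m : ℝ) + 1) ≤ X (d n) ω} := by
    ext ω
    simp only [mem_preimage, mem_Ioi, mem_iUnion, mem_iInter, mem_ofPred_eq]
    rw [lt_minOn_iff hK hne (hX.continuous ω),
      forall_lt_iff_exists_denseSeq hK hne hdK hd (hX.continuous ω).continuousOn]
  rw [this]
  exact MeasurableSet.iUnion fun m => MeasurableSet.iInter fun n =>
    measurableSet_le measurable_const (hX.measurable _)

theorem measurableSet_highEvent (hX : IsCenteredContinuousGaussian X P) (hab : a < b) (u : ℝ) :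
    MeasurableSet (highEvent X a b u) :=
  measurableSet_lt measurable_const (measurable_minOn hX isCompact_Icc (nonempty_Icc.2 hab.le))

theorem measureReal_cond (hX : IsCenteredContinuousGaussian X P) (hab : a < b) (u : ℝ)
    (s : Set Ω) : (cond P (highEvent X a b u)).real s =
      P.real (highEvent X a b u ∩ s) / P.real (highEvent X a b u) := by
  rw [measureReal_def, cond_apply (measurableSet_highEvent hX hab u), ENNReal.toReal_mul,
    ENNReal.toReal_inv, inv_mul_eq_div, measureReal_def, measureReal_def]

variable [IsProbabilityMeasure P] {T : Finset ℝ} {θ : ℝ → ℝ} {k : ℕ} {t : Fin k → ℝ}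

theorem nonempty_Icc_inter (hε : 0 < ε) {p : ℝ} (hp : p ∈ Icc a b) :
    (Icc (p - ε) (p + ε) ∩ Icc a b).Nonempty :=
  ⟨p, ⟨by linarith, by linarith⟩, hp⟩

theorem sum_eq_sum_of_support (ht : Function.Injective t) (htT : ∀ j, t j ∈ T)
    {f : ℝ → ℝ} (hf : ∀ p ∈ T, p ∉ range t → f p = 0) : ∑ p ∈ T, f p = ∑ j, f (t j) := by
  classical
  rw [← Finset.sum_image (s := Finset.univ) (f := f) (g := t) (fun _ _ _ _ h => ht h)]
  refine (Finset.sum_subset ?_ ?_).symm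
  · intro p hp
    obtain ⟨j, -, rfl⟩ := Finset.mem_image.1 hp
    exact htT j
  · intro p hp hp'
    refine hf p hp fun ⟨j, hj⟩ => hp' (Finset.mem_image.2 ⟨j, Finset.mem_univ _, hj⟩)

/-- With conditional probability tending to one the minimum is attained near a point carrying
positive weight. -/
theorem IsOptimalDual.tendsto_cond_iInf_localMin (hX : IsCenteredContinuousGaussian X P)
    (hab : a < b) (h : IsOptimalDual X P a b T θ) (hε : 0 < ε)
    (hsep : ∀ p ∈ T, ∀ q ∈ T, p ≠ q → 2 * ε < |p - q|)
    (htT : ∀ j, t j ∈ T) (hθ0 : ∀ p ∈ T, p ∉ range t → θ p = 0) :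
    Tendsto (fun u => (cond P (highEvent X a b u))
      {ω | (⨅ j, localMin X a b ε (t j) ω) = minOn X (Icc a b) ω}) atTop (𝓝 1) := by
  classical
  have hτ0 := h.sum_pos hab
  set τ := ∑ p ∈ T, θ p with hτ
  set Good : Set Ω := {ω | (⨅ j, localMin X a b ε (t j) ω) = minOn X (Icc a b) ω} with hGood
  have hprob : ∀ u, IsProbabilityMeasure (cond P (highEvent X a b u)) := fun u =>
    cond_isProbabilityMeasure (h.measure_highEvent_ne_zero hX hab u)
  have hH0 : ∀ u, 0 < P.real (highEvent X a b u) := fun u => by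
    rw [measureReal_def]
    exact ENNReal.toReal_pos (h.measure_highEvent_ne_zero hX hab u) (measure_ne_top _ _)
  have hlim : Tendsto (fun u => (cond P (highEvent X a b u)).real Goodᶜ) atTop (𝓝 0) := by
    obtain ⟨κ, hκ0, hκ⟩ := h.exists_gap hX hε
    refine tendsto_order.2 ⟨fun r hr => Eventually.of_forall fun u =>
      hr.trans_le measureReal_nonneg, fun r hr => ?_⟩
    obtain ⟨L, hL0, hL⟩ : ∃ L > 0, Real.exp (-(τ * L)) < r := by
      have h1 : Tendsto (fun L : ℝ => Real.exp (-(τ * L))) atTop (𝓝 0) :=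
        Real.tendsto_exp_neg_atTop_nhds_zero.comp (tendsto_id.const_mul_atTop hτ0)
      exact (((eventually_gt_atTop 0).and (h1.eventually (gt_mem_nhds hr))).exists)
    -- Level `x` raises only contact points of zero weight, so its conditional probability tends to
    -- 1. Level `y` raises only the weighted points, and its conditional probability tends to
    -- `exp(-τL)`, which is below `r`.
    set x : ℝ → ℝ := fun p => if p ∈ range t then 0 else L with hx
    set y : ℝ → ℝ := fun p => if p ∈ range t then L else 0 with hy
    have hx0 : ∀ p ∈ T, 0 ≤ x p := fun p _ => by simp only [hx]; split_ifs <;> linarith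
    have hy0 : ∀ p ∈ T, 0 ≤ y p := fun p _ => by simp only [hy]; split_ifs <;> linarith
    have hsx : ∑ p ∈ T, θ p * x p = 0 := Finset.sum_eq_zero fun p hp => by
      simp only [hx]
      split_ifs with hpt
      · simp
      · rw [hθ0 p hp hpt, zero_mul]
    have hsy : ∑ p ∈ T, θ p * y p = τ * L := by
      rw [hτ, Finset.sum_mul]
      refine Finset.sum_congr rfl fun p hp => ?_
      simp only [hy]
      split_ifs with hpt
      · rfl
      · rw [hθ0 p hp hpt, zero_mul, zero_mul]
    have h1 := h.tendsto_levelEvent hX hab hε hsep hx0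
    have h2 := h.tendsto_levelEvent hX hab hε hsep hy0
    have h3 := (ENNReal.tendsto_toReal (a := 0) (by simp)).comp
      (h.tendsto_bad hX hab (half_pos hκ0))
    rw [hsx, neg_zero, Real.exp_zero] at h1
    rw [hsy] at h2
    have h4 := ((h1.const_sub 1).add h2).add h3
    rw [sub_self, zero_add, ENNReal.toReal_zero, add_zero] at h4
    filter_upwards [h4.eventually (gt_mem_nhds hL), eventually_ge_atTop 1,
      eventually_gt_atTop (2 * L / κ)] with u hu hu1 hu2
    refine lt_of_le_of_lt ?_ hu
    have hu0 : 0 < u := by linarith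
    simp only [Function.comp, ENNReal.toReal_div]
    rw [measureReal_cond hX hab]
    set bad : Set Ω :=
      {ω | ∃ t ∈ Icc a b, κ / 2 * u < |X t ω - u * ∑ p ∈ T, θ p * covFun X P p t|} with hbad
    -- If level `y` fails, the minimum is at most `u + L/u`. Off the bad event it is then attained
    -- near `T`, and under level `x` not near a zero-weight point, so it is attained near some `t
    -- j`.
    have hsub : highEvent X a b u ∩ Goodᶜ ⊆
        (highEvent X a b u \ levelEvent X a b ε T x u) ∪ levelEvent X a b ε T y u ∪
          (highEvent X a b u ∩ bad) := by
      rintro ω ⟨hω, hωG⟩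
      by_contra hcon
      simp only [mem_union, Set.mem_sdiff, mem_inter_iff, not_or, not_and, not_not] at hcon
      obtain ⟨⟨hlx, hly⟩, hnb⟩ := hcon
      have hlx := hlx hω
      have hnb := hnb hω
      have hHω := (mem_highEvent hX hab).1 hω
      have hc := hX.continuous ω
      obtain ⟨s, hs, hmin⟩ := isCompact_Icc.exists_isMinOn (nonempty_Icc.2 hab.le)
        (hc.continuousOn (s := Icc a b))
      have hmin' : ∀ r ∈ Icc a b, X s ω ≤ X r ω := fun r hr => hmin hr
      have hm : minOn X (Icc a b) ω = X s ω := by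
        refine IsLeast.csInf_eq ⟨⟨s, hs, rfl⟩, ?_⟩
        rintro _ ⟨r, hr, rfl⟩
        exact hmin' r hr
      have hsL : X s ω ≤ u + L / u := by
        by_contra! hlt
        refine hly ⟨hHω, fun p hp r hr => ?_⟩
        refine lt_of_le_of_lt ?_ (hlt.trans_le (hmin' r hr.2))
        have : y p ≤ L := by simp only [hy]; split_ifs <;> linarith
        gcongr
      by_cases hfar : ∀ p ∈ T, ε ≤ |s - p|
      · have e1 := hκ s hs hfar
        simp only [hbad, mem_ofPred_eq, not_exists, not_and, not_lt] at hnb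
        have e2 := (abs_le.1 (hnb s hs)).1
        have e3 : u * (1 + κ) ≤ u * ∑ p ∈ T, θ p * covFun X P p s := by gcongr
        have e4 : L / u < κ / 2 * u := by
          rw [div_lt_iff₀ hu0]
          rw [div_lt_iff₀ hκ0] at hu2
          have : u * κ ≤ u * u * κ := mul_le_mul_of_nonneg_right (by nlinarith) hκ0.le
          nlinarith
        linarith
      · push Not at hfar
        obtain ⟨p, hp, hsp⟩ := hfar
        have hsI : s ∈ Icc (p - ε) (p + ε) ∩ Icc a b := by
          have := abs_lt.1 hsp
          exact ⟨⟨by linarith, by linarith⟩, hs⟩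
        by_cases hpt : p ∈ range t
        · obtain ⟨j, rfl⟩ := hpt
          refine hωG ?_
          have : Nonempty (Fin k) := ⟨j⟩
          simp only [hGood, mem_ofPred_eq]
          rw [hm]
          have hloc : ∀ i, X s ω ≤ localMin X a b ε (t i) ω := fun i => by
            refine le_csInf ((nonempty_Icc_inter hε (h.subset _ (htT i))).image _) ?_
            rintro _ ⟨r, hr, rfl⟩
            exact hmin' r hr.2
          refine le_antisymm ?_ (le_ciInf hloc)
          refine (ciInf_le (finite_range _).bddBelow j).trans ?_
          refine csInf_le ⟨X s ω, ?_⟩ ⟨s, hsI, rfl⟩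
          rintro _ ⟨r, hr, rfl⟩
          exact hmin' r hr.2
        · have e1 := hlx.2 p hp s hsI
          have : x p = L := by simp only [hx, if_neg hpt]
          rw [this] at e1
          linarith
    have hle : P.real (highEvent X a b u ∩ Goodᶜ) ≤
        (P.real (highEvent X a b u) - P.real (levelEvent X a b ε T x u)) +
          P.real (levelEvent X a b ε T y u) + P.real (highEvent X a b u ∩ bad) := by
      refine (measureReal_mono hsub).trans ((measureReal_union_le _ _).trans ?_)
      gcongr
      refine (measureReal_union_le _ _).trans ?_
      gcongr
      rw [measureReal_sdiff (fun ω hω => (mem_highEvent hX hab).2 hω.1)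
        (measurableSet_levelEvent hX hab hε h.subset x u)]
    rw [div_le_iff₀ (hH0 u)]
    refine hle.trans (le_of_eq ?_)
    rw [add_mul, add_mul, sub_mul, one_mul, div_mul_cancel₀ _ (hH0 u).ne',
      div_mul_cancel₀ _ (hH0 u).ne', measureReal_def P (highEvent X a b u ∩ bad)]
    congr 1
    rw [← measureReal_def P (highEvent X a b u), div_mul_cancel₀ _ (hH0 u).ne']
  have hlim2 : Tendsto (fun u => 1 - (cond P (highEvent X a b u)) Goodᶜ) atTop (𝓝 1) := by
    have h1 : Tendsto (fun u => (cond P (highEvent X a b u)) Goodᶜ) atTop (𝓝 0) := by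
      rw [← ENNReal.tendsto_toReal_iff (fun u => measure_ne_top _ _) (by simp)]
      simpa only [ENNReal.toReal_zero, measureReal_def] using hlim
    have := ENNReal.Tendsto.sub (tendsto_const_nhds (x := (1 : ENNReal))) h1 (Or.inl (by simp))
    simpa using this
  refine tendsto_of_tendsto_of_tendsto_of_le_of_le hlim2 tendsto_const_nhds (fun u => ?_)
    fun u => prob_le_one
  refine tsub_le_iff_right.2 ?_
  have := measure_union_le (μ := cond P (highEvent X a b u)) Good Goodᶜ
  rwa [union_compl_self, measure_univ] at this

/-- Weak convergence of the rescaled local minima to independent exponential variables. -/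
theorem IsOptimalDual.tendsto_integral_localMin (hX : IsCenteredContinuousGaussian X P)
    (hab : a < b) (h : IsOptimalDual X P a b T θ) (hε : 0 < ε)
    (hsep : ∀ p ∈ T, ∀ q ∈ T, p ≠ q → 2 * ε < |p - q|)
    (ht : Function.Injective t) (htT : ∀ j, t j ∈ T) (hθ0 : ∀ p ∈ T, p ∉ range t → θ p = 0)
    (hθpos : ∀ j, 0 < θ (t j)) (f : BoundedContinuousFunction (Fin k → ℝ) ℝ) :
    Tendsto (fun u => ∫ ω, f (fun j => u * (localMin X a b ε (t j) ω - u))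
      ∂(cond P (highEvent X a b u))) atTop
      (𝓝 (∫ x, f x ∂(Measure.pi fun j => expMeasure (θ (t j))))) := by
  have hprob : ∀ u, IsProbabilityMeasure (cond P (highEvent X a b u)) := fun u =>
    cond_isProbabilityMeasure (h.measure_highEvent_ne_zero hX hab u)
  have hexp : ∀ j, IsProbabilityMeasure (expMeasure (θ (t j))) := fun j =>
    isProbabilityMeasure_expMeasure (hθpos j)
  set V : ℝ → Ω → Fin k → ℝ := fun u ω j => u * (localMin X a b ε (t j) ω - u) with hV
  have hVm : ∀ u, Measurable (V u) := fun u => measurable_pi_lambda _ fun j =>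
    ((measurable_minOn hX (isCompact_Icc.inter isCompact_Icc)
      (nonempty_Icc_inter hε (h.subset _ (htT j)))).sub_const u).const_mul u
  set μ : ℝ → ProbabilityMeasure (Fin k → ℝ) := fun u =>
    ⟨(cond P (highEvent X a b u)).map (V u),
      Measure.isProbabilityMeasure_map (hVm u).aemeasurable⟩ with hμ
  have key : Tendsto μ atTop (𝓝 ⟨Measure.pi fun j => expMeasure (θ (t j)), inferInstance⟩) := by
    refine tendsto_probabilityMeasure_of_tendsto_orthant fun y => ?_
    -- Negative thresholds hold automatically given a high minimum, matching the fact that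
    -- exponential variables are nonnegative; contact points outside the support get level 0.
    set x : ℝ → ℝ := Function.extend t (fun j => max (y j) 0) 0 with hx
    have hxt : ∀ j, x (t j) = max (y j) 0 := fun j => ht.extend_apply _ _ j
    have hxn : ∀ p, p ∉ range t → x p = 0 := fun p hp => by
      rw [hx, Function.extend_apply' _ _ _ (fun ⟨j, hj⟩ => hp ⟨j, hj⟩)]; rfl
    have hx0 : ∀ p ∈ T, 0 ≤ x p := fun p _ => by
      by_cases hp : p ∈ range t
      · obtain ⟨j, rfl⟩ := hp
        rw [hxt]; exact le_max_right _ _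
      · rw [hxn p hp]
    have hlim := h.tendsto_levelEvent hX hab hε hsep hx0
    have hval : (Measure.pi fun j => expMeasure (θ (t j))).real (univ.pi fun j => Ioi (y j)) =
        Real.exp (-∑ p ∈ T, θ p * x p) := by
      rw [sum_eq_sum_of_support ht htT (fun p hp hpt => by rw [hθ0 p hp hpt, zero_mul]),
        measureReal_def, Measure.pi_pi, ENNReal.toReal_prod, ← Finset.sum_neg_distrib,
        Real.exp_sum]
      refine Finset.prod_congr rfl fun j _ => ?_
      rw [← measureReal_def, measureReal_expMeasure_Ioi (hθpos j), hxt]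
    simp only [ProbabilityMeasure.coe_mk]
    rw [hval]
    refine hlim.congr' ?_
    filter_upwards [eventually_gt_atTop 0] with u hu
    rw [hμ]
    simp only [ProbabilityMeasure.coe_mk]
    rw [map_measureReal_apply (hVm u) (MeasurableSet.univ_pi fun _ => measurableSet_Ioi),
      measureReal_cond hX hab]
    congr 2
    ext ω
    rw [mem_inter_iff, mem_highEvent hX hab, mem_preimage, mem_univ_pi]
    have hj : ∀ j, V u ω j ∈ Ioi (y j) ↔
        ∀ s ∈ Icc (t j - ε) (t j + ε) ∩ Icc a b, u + y j / u < X s ω := by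
      intro j
      rw [← lt_minOn_iff (isCompact_Icc.inter isCompact_Icc)
        (nonempty_Icc_inter hε (h.subset _ (htT j))) (hX.continuous ω), mem_Ioi, hV]
      simp only
      rw [← lt_sub_iff_add_lt', div_lt_iff₀' hu]
      rfl
    refine and_congr_right fun hω => ?_
    simp only [hj]
    constructor
    · intro hp j s hs
      have h1 := hp (t j) (htT j) s hs
      rw [hxt] at h1
      refine lt_of_le_of_lt ?_ h1
      gcongr
      exact le_max_left _ _
    · intro hp p hpT s hs
      by_cases hpt : p ∈ range t
      · obtain ⟨j, rfl⟩ := hpt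
        rw [hxt]
        rcases le_total (y j) 0 with h0 | h0
        · rw [max_eq_right h0, zero_div, add_zero]
          exact hω s hs.2
        · rw [max_eq_left h0]
          exact hp j s hs
      · rw [hxn p hpt, zero_div, add_zero]
        exact hω s hs.2
  have := (ProbabilityMeasure.tendsto_iff_forall_integral_tendsto.1 key) f
  refine this.congr fun u => ?_
  simp only [hμ, ProbabilityMeasure.coe_mk]
  rw [integral_map (hVm u).aemeasurable f.continuous.aestronglyMeasurable]

end

/-! ### Potentials, first-order optimality and finitely supported measures -/

/-- The potential `t ↦ ∫ R(s,t) ν(ds)`. -/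
def potential (R : ℝ → ℝ → ℝ) (ν : Measure ℝ) (t : ℝ) : ℝ := ∫ s, R s t ∂ν

/-- All finite covariance matrices are non-singular. -/
def IsNondegenerate (R : ℝ → ℝ → ℝ) : Prop :=
  ∀ (T : Finset ℝ) (c : ℝ → ℝ), ∑ p ∈ T, c p * ∑ q ∈ T, c q * R q p = 0 → ∀ p ∈ T, c p = 0

theorem integral_sub_sub_add {α : Type*} [MeasurableSpace α] {μ : Measure α} {f₁ f₂ f₃ f₄ : α → ℝ}
    (h₁ : Integrable f₁ μ) (h₂ : Integrable f₂ μ) (h₃ : Integrable f₃ μ) (h₄ : Integrable f₄ μ) :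
    ∫ x, (f₁ x - f₂ x - f₃ x + f₄ x) ∂μ =
      ∫ x, f₁ x ∂μ - ∫ x, f₂ x ∂μ - ∫ x, f₃ x ∂μ + ∫ x, f₄ x ∂μ := by
  have h₁₂ : Integrable (fun x => f₁ x - f₂ x) μ := h₁.sub h₂
  have h₁₃ : Integrable (fun x => f₁ x - f₂ x - f₃ x) μ := h₁₂.sub h₃
  rw [integral_add h₁₃ h₄, integral_sub h₁₂ h₃, integral_sub h₁ h₂]

section Energy

variable {R : ℝ → ℝ → ℝ} {a b : ℝ} {ν : Measure ℝ}

theorem energy_eq_integral_potential : energy R ν = ∫ t, potential R ν t ∂ν := rfl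

theorem IsProbOn.ae_mem (h : IsProbOn a b ν) : ∀ᵐ t ∂ν, t ∈ Icc a b := h.2

theorem IsProbOn.restrict_eq (h : IsProbOn a b ν) : ν.restrict (Icc a b) = ν :=
  Measure.restrict_eq_self_of_ae_mem h.ae_mem

theorem IsProbOn.integrable (h : IsProbOn a b ν) {E : Type*} [NormedAddCommGroup E] {f : ℝ → E}
    (hf : Continuous f) : Integrable f ν := by
  have := h.1
  have h1 := hf.integrableOn_Icc (μ := ν) (a := a) (b := b)
  rwa [IntegrableOn, h.restrict_eq] at h1

theorem IsProbOn.continuous_potential (h : IsProbOn a b ν)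
    (hR : Continuous fun p : ℝ × ℝ => R p.1 p.2) : Continuous (potential R ν) := by
  have := h.1
  have h1 : Continuous fun t => ∫ s in Icc a b, R s t ∂ν :=
    continuous_parametric_integral_of_continuous (f := fun t s => R s t)
      (hR.comp continuous_swap) isCompact_Icc
  rwa [h.restrict_eq] at h1

theorem integral_mixture {h s : ℝ} (hh : h ∈ Icc (0 : ℝ) 1) {f : ℝ → ℝ} (hf : Integrable f ν) :
    ∫ t, f t ∂(ENNReal.ofReal (1 - h) • ν + ENNReal.ofReal h • Measure.dirac s) =
      (1 - h) * ∫ t, f t ∂ν + h * f s := by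
  rw [integral_add_measure (hf.smul_measure (by simp))
    ((integrable_dirac (by simp)).smul_measure (by simp)), integral_smul_measure,
    integral_smul_measure, integral_dirac, ENNReal.toReal_ofReal (by linarith [hh.2]),
    ENNReal.toReal_ofReal hh.1]
  rfl

theorem isProbOn_mixture (hν : IsProbOn a b ν) {h s : ℝ} (hh : h ∈ Icc (0 : ℝ) 1)
    (hs : s ∈ Icc a b) :
    IsProbOn a b (ENNReal.ofReal (1 - h) • ν + ENNReal.ofReal h • Measure.dirac s) := by
  have := hν.1
  constructor
  · constructor
    simp only [Measure.add_apply, Measure.smul_apply, measure_univ, smul_eq_mul, mul_one]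
    rw [← ENNReal.ofReal_add (by linarith [hh.2]) hh.1]
    simp
  · simp only [Measure.add_apply, Measure.smul_apply, smul_eq_mul, hν.2, mul_zero, zero_add]
    rw [Measure.dirac_apply' _ measurableSet_Icc.compl]
    simp [hs.1, hs.2]

/-- First order optimality condition for a minimizer. -/
theorem IsMinimizer.energy_le_potential (hν : IsMinimizer R a b ν)
    (hR : Continuous fun p : ℝ × ℝ => R p.1 p.2) (hsymm : ∀ s t, R s t = R t s) {s : ℝ}
    (hs : s ∈ Icc a b) : energy R ν ≤ potential R ν s := by
  have hgc := hν.1.continuous_potential hR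
  -- The energy of `(1-h)ν + hδ_s` is quadratic in `h`; subtract the energy of `ν`, divide by `h`,
  -- and let `h` tend to 0.
  have key : ∀ h ∈ Ioc (0 : ℝ) 1,
      0 ≤ 2 * (potential R ν s - energy R ν) +
        h * (energy R ν - 2 * potential R ν s + R s s) := by
    intro h hh
    have hh' : h ∈ Icc (0 : ℝ) 1 := ⟨hh.1.le, hh.2⟩
    have h1 := hν.2 _ (isProbOn_mixture hν.1 hh' hs)
    have hRs : ∀ t, Continuous fun s => R s t := fun t =>
      hR.comp (continuous_id.prodMk continuous_const)
    have hRs' : Continuous fun t => R s t := hR.comp (continuous_const.prodMk continuous_id)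
    have hsw : ∫ t, R s t ∂ν = potential R ν s := by
      simp only [potential, hsymm s]
    have h2 : energy R (ENNReal.ofReal (1 - h) • ν + ENNReal.ofReal h • Measure.dirac s) =
        (1 - h) * ((1 - h) * energy R ν + h * potential R ν s) +
          h * ((1 - h) * potential R ν s + h * R s s) := by
      have e1 : ∀ t, potential R
          (ENNReal.ofReal (1 - h) • ν + ENNReal.ofReal h • Measure.dirac s) t =
            (1 - h) * potential R ν t + h * R s t := fun t =>
        integral_mixture hh' (hν.1.integrable (hRs t))
      have e2 : Integrable (fun t => (1 - h) * potential R ν t + h * R s t) ν :=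
        hν.1.integrable ((continuous_const.mul hgc).add (continuous_const.mul hRs'))
      rw [energy_eq_integral_potential]
      simp_rw [e1]
      rw [integral_mixture hh' e2, integral_add ((hν.1.integrable hgc).const_mul _)
        ((hν.1.integrable hRs').const_mul _), integral_const_mul, integral_const_mul, hsw,
        energy_eq_integral_potential]
    rw [h2] at h1
    have h3 : 0 ≤ h * (2 * (potential R ν s - energy R ν) +
        h * (energy R ν - 2 * potential R ν s + R s s)) := by nlinarith
    exact nonneg_of_mul_nonneg_right h3 hh.1
  have hlim : Tendsto (fun h : ℝ => 2 * (potential R ν s - energy R ν) +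
        h * (energy R ν - 2 * potential R ν s + R s s)) (𝓝[>] 0)
        (𝓝 (2 * (potential R ν s - energy R ν))) := by
    have : Continuous fun h : ℝ => 2 * (potential R ν s - energy R ν) +
        h * (energy R ν - 2 * potential R ν s + R s s) := by fun_prop
    simpa using (this.tendsto 0).mono_left nhdsWithin_le_nhds
  have := ge_of_tendsto hlim (by
    filter_upwards [Ioc_mem_nhdsGT (zero_lt_one' ℝ)] with h hh
    exact key h hh)
  linarith

theorem ae_eq_of_integral_le (hν : IsProbOn a b ν) {g : ℝ → ℝ} (hg : Continuous g) {e : ℝ}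
    (hle : ∀ t ∈ Icc a b, e ≤ g t) (hint : ∫ t, g t ∂ν ≤ e) : ∀ᵐ t ∂ν, g t = e := by
  have := hν.1
  have h1 : 0 ≤ᵐ[ν] fun t => g t - e := by
    filter_upwards [hν.ae_mem] with t ht
    exact sub_nonneg.2 (hle t ht)
  have h2 : ∫ t, (g t - e) ∂ν = 0 := by
    refine le_antisymm ?_ (integral_nonneg_of_ae h1)
    rw [integral_sub (hν.integrable hg) (integrable_const _)]
    simpa using hint
  have h3 := (integral_eq_zero_iff_of_nonneg_ae h1
    ((hν.integrable hg).sub (integrable_const _))).1 h2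
  filter_upwards [h3] with t ht
  exact sub_eq_zero.1 ht

theorem integral_eq_sum_of_finset [IsFiniteMeasure ν] {T : Finset ℝ} (hT : ∀ᵐ t ∂ν, t ∈ T)
    (f : ℝ → ℝ) : ∫ t, f t ∂ν = ∑ p ∈ T, ν.real {p} * f p := by
  have h1 : ν.restrict (T : Set ℝ) = ν := Measure.restrict_eq_self_of_ae_mem hT
  have h2 := setIntegral_finset (μ := ν) (f := f) T IntegrableOn.finset
  rw [h1] at h2
  exact h2

theorem eq_of_measureReal_singleton_eq {ν' : Measure ℝ} [IsFiniteMeasure ν] [IsFiniteMeasure ν']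
    {T : Finset ℝ} (hT : ∀ᵐ t ∂ν, t ∈ T) (hT' : ∀ᵐ t ∂ν', t ∈ T)
    (h : ∀ p ∈ T, ν.real {p} = ν'.real {p}) : ν = ν' := by
  refine Measure.ext fun s hs => ?_
  rw [← measureReal_eq_measureReal_iff, ← integral_indicator_one hs, ← integral_indicator_one hs,
    integral_eq_sum_of_finset hT, integral_eq_sum_of_finset hT']
  exact Finset.sum_congr rfl fun p hp => by rw [h p hp]

/-- Removing the other points of `T` leaves a neighbourhood of `p` whose mass sits at `p` alone. -/
theorem measureReal_singleton_pos_iff [IsFiniteMeasure ν] {T : Finset ℝ} (hT : ∀ᵐ t ∂ν, t ∈ T)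
    {p : ℝ} : 0 < ν.real {p} ↔ p ∈ ν.support := by
  rw [Measure.mem_support_iff_forall, measureReal_def, ENNReal.toReal_pos_iff]
  constructor
  · intro h U hU
    exact h.1.trans_le (measure_mono (singleton_subset_iff.2 (mem_of_mem_nhds hU)))
  · intro h
    refine ⟨?_, measure_lt_top _ _⟩
    have hU : (((T.erase p : Finset ℝ) : Set ℝ))ᶜ ∈ 𝓝 p :=
      (T.erase p).finite_toSet.isClosed.isOpen_compl.mem_nhds (by simp)
    refine (h _ hU).trans_le (measure_mono_ae ?_)
    filter_upwards [hT] with t ht htU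
    by_contra hne
    exact htU (Finset.mem_coe.2 (Finset.mem_erase.2 ⟨hne, ht⟩))

end Energy

/-! ### Uniqueness of the minimizer and construction of the dual -/

section GaussianPaths

variable {Ω : Type*} [MeasurableSpace Ω] {P : Measure Ω} [IsProbabilityMeasure P]
  {X : ℝ → Ω → ℝ} {a b : ℝ} {ν : Measure ℝ}

/-- Positivity of the energy of a difference of measures, one of them finitely supported. -/
theorem IsCenteredContinuousGaussian.energy_sub_nonneg (hX : IsCenteredContinuousGaussian X P)
    (hν : IsProbOn a b ν) (T : Finset ℝ) (w : ℝ → ℝ) :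
    0 ≤ energy (covFun X P) ν - 2 * ∑ p ∈ T, w p * potential (covFun X P) ν p +
      ∑ p ∈ T, w p * ∑ q ∈ T, w q * covFun X P q p := by
  have hprob := hν.1
  have hRc := hX.continuous_covFun
  set S : Ω → ℝ := fun ω => ∑ p ∈ T, w p * X p ω with hS
  have hSm : Measurable S := hX.measurable_sum T w
  have hSL2 : MemLp S 2 P := memLp_finsetSum _ fun q _ => (hX.memLp q).const_mul _
  obtain ⟨H, hH, hHle⟩ := hX.exists_integrable_bound a b
  have hXm : Measurable fun z : ℝ × Ω => X z.1 z.2 :=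
    measurable_uncurry_of_continuous_of_measurable hX.continuous hX.measurable
  set F : Ω × (ℝ × ℝ) → ℝ := fun z => (X z.2.1 z.1 - S z.1) * (X z.2.2 z.1 - S z.1) with hF
  have hFm : Measurable F := by
    have h1 : Measurable fun z : Ω × (ℝ × ℝ) => X z.2.1 z.1 :=
      hXm.comp (measurable_snd.fst.prodMk measurable_fst)
    have h2 : Measurable fun z : Ω × (ℝ × ℝ) => X z.2.2 z.1 :=
      hXm.comp (measurable_snd.snd.prodMk measurable_fst)
    have h3 : Measurable fun z : Ω × (ℝ × ℝ) => S z.1 := hSm.comp measurable_fst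
    exact (h1.sub h3).mul (h2.sub h3)
  have hFi : Integrable F (P.prod (ν.prod ν)) := by
    have hb : Integrable (fun ω => 2 * H ω + 2 * S ω ^ 2) P :=
      (hH.const_mul 2).add (hSL2.integrable_sq.const_mul 2)
    refine (hb.comp_fst (ν.prod ν)).mono' hFm.aestronglyMeasurable ?_
    have e1 := Measure.quasiMeasurePreserving_fst (μ := P) (ν := ν.prod ν) |>.ae hHle
    have e2 := Measure.quasiMeasurePreserving_snd (μ := P) (ν := ν.prod ν) |>.ae
      (Measure.quasiMeasurePreserving_fst (μ := ν) (ν := ν) |>.ae hν.ae_mem)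
    have e3 := Measure.quasiMeasurePreserving_snd (μ := P) (ν := ν.prod ν) |>.ae
      (Measure.quasiMeasurePreserving_snd (μ := ν) (ν := ν) |>.ae hν.ae_mem)
    filter_upwards [e1, e2, e3] with z h1 h2 h3
    have h4 := (abs_le.1 (h1 _ h2 _ h2)).2
    have h5 := (abs_le.1 (h1 _ h3 _ h3)).2
    rw [hF, Real.norm_eq_abs, abs_le]
    simp only
    generalize X z.2.1 z.1 = x at *
    generalize X z.2.2 z.1 = y at *
    generalize S z.1 = s at *
    constructor <;> nlinarith [sq_nonneg (x - y), sq_nonneg (x + y - 2 * s), sq_nonneg (x + s),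
      sq_nonneg (y + s)]
  have hswap := integral_integral_swap (f := fun ω z => F (ω, z)) hFi
  have hleft : 0 ≤ ∫ ω, ∫ z, F (ω, z) ∂(ν.prod ν) ∂P := by
    refine integral_nonneg fun ω => ?_
    simp only [hF]
    rw [integral_prod_mul (fun s => X s ω - S ω) (fun s => X s ω - S ω)]
    -- For fixed `ω` the double integral factors as the square of `∫ (X_s - S) ν(ds)`; Fubini then
    -- transfers the sign to the covariances.
    exact mul_self_nonneg _
  rw [hswap] at hleft
  have hinner : ∀ z : ℝ × ℝ, ∫ ω, F (ω, z) ∂P = covFun X P z.1 z.2 -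
      ∑ p ∈ T, w p * covFun X P p z.1 - ∑ p ∈ T, w p * covFun X P p z.2 +
        ∑ p ∈ T, w p * ∑ q ∈ T, w q * covFun X P q p := by
    intro z
    have i1 := hX.integrable_mul z.1 z.2
    have i2 : ∀ t, Integrable (fun ω => X t ω * S ω) P := fun t => (hX.memLp t).integrable_mul hSL2
    have i3 := hSL2.integrable_sq
    have : ∀ ω, F (ω, z) = X z.1 ω * X z.2 ω - X z.1 ω * S ω - X z.2 ω * S ω + S ω ^ 2 :=
      fun ω => by simp only [hF]; ring
    simp_rw [this]
    rw [integral_sub_sub_add i1 (i2 _) (i2 _) i3, hX.integral_mul_sum, hX.integral_mul_sum, hX.integral_sum_sq]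
    rfl
  simp_rw [hinner] at hleft
  set Q := ∑ p ∈ T, w p * ∑ q ∈ T, w q * covFun X P q p with hQ
  set m : ℝ → ℝ := fun t => ∑ p ∈ T, w p * covFun X P p t with hm
  have hmc : Continuous m := hX.continuous_potential T w
  have hcont : Continuous fun z : ℝ × ℝ => covFun X P z.1 z.2 - m z.1 - m z.2 + Q :=
    ((hRc.sub (hmc.comp continuous_fst)).sub (hmc.comp continuous_snd)).add continuous_const
  have hint : Integrable (fun z : ℝ × ℝ => covFun X P z.1 z.2 - m z.1 - m z.2 + Q)
      (ν.prod ν) := by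
    have h1 := hcont.continuousOn.integrableOn_compact (μ := ν.prod ν)
      ((isCompact_Icc (a := a) (b := b)).prod (isCompact_Icc (a := a) (b := b)))
    rwa [IntegrableOn, ← Measure.prod_restrict, hν.restrict_eq] at h1
  have hmi : ∫ t, m t ∂ν = ∑ p ∈ T, w p * potential (covFun X P) ν p := by
    rw [hm, integral_finsetSum]
    · refine Finset.sum_congr rfl fun p _ => ?_
      rw [integral_const_mul]
      simp only [potential, covFun_comm p]
    · intro p _
      exact (hν.integrable (hRc.comp (continuous_const.prodMk continuous_id))).const_mul _
  have heval : ∫ z : ℝ × ℝ, (covFun X P z.1 z.2 - m z.1 - m z.2 + Q) ∂(ν.prod ν) =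
      energy (covFun X P) ν - 2 * ∑ p ∈ T, w p * potential (covFun X P) ν p + Q := by
    rw [integral_prod_symm _ hint]
    have h1 : ∀ t, ∫ s, (covFun X P s t - m s - m t + Q) ∂ν =
        potential (covFun X P) ν t - (∫ s, m s ∂ν) - m t + Q := by
      intro t
      have i1 : Integrable (fun s => covFun X P s t) ν :=
        hν.integrable (hRc.comp (continuous_id.prodMk continuous_const))
      have i2 := hν.integrable hmc
      rw [integral_sub_sub_add i1 i2 (integrable_const _) (integrable_const _)]
      simp [potential]
    simp_rw [h1]
    have i1 := hν.integrable (hν.continuous_potential hRc)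
    have i2 := hν.integrable hmc
    rw [integral_sub_sub_add i1 (integrable_const _) i2 (integrable_const _), hmi,
      energy_eq_integral_potential]
    simp
    ring
  rw [heval] at hleft
  exact hleft

/-- A kernel vector of the covariance matrix annihilates the quadratic form, so the matrix is
injective and hence surjective. -/
theorem IsNondegenerate.solvable {R : ℝ → ℝ → ℝ} (hR : IsNondegenerate R) (T : Finset ℝ)
    (z : ℝ → ℝ) : ∃ c : ℝ → ℝ, ∀ q ∈ T, ∑ p ∈ T, c p * R p q = z q := by
  classical
  let L : (T → ℝ) →ₗ[ℝ] (T → ℝ) :=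
    { toFun := fun c q => ∑ p : T, c p * R p q
      map_add' := fun c d => by ext q; simp [add_mul, Finset.sum_add_distrib]
      map_smul' := fun r c => by ext q; simp [Finset.mul_sum, mul_assoc] }
  have hinj : Function.Injective L := by
    rw [injective_iff_map_eq_zero]
    intro c hc
    set c' : ℝ → ℝ := fun p => if h : p ∈ T then c ⟨p, h⟩ else 0 with hc'
    have hcc : ∀ p : T, c' p = c p := fun p => by simp [hc']
    have h1 : ∑ p ∈ T, c' p * ∑ q ∈ T, c' q * R q p = 0 := by
      rw [← Finset.sum_coe_sort T]
      refine Finset.sum_eq_zero fun p _ => ?_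
      rw [← Finset.sum_coe_sort T]
      simp_rw [hcc]
      have := congrFun hc p
      simp only [L, LinearMap.coe_mk, AddHom.coe_mk, Pi.zero_apply] at this
      rw [this, mul_zero]
    ext p
    rw [← hcc]
    exact hR T c' h1 p p.2
  obtain ⟨c, hc⟩ := (LinearMap.injective_iff_surjective.1 hinj) fun q => z q
  refine ⟨fun p => if h : p ∈ T then c ⟨p, h⟩ else 0, fun q hq => ?_⟩
  have := congrFun hc ⟨q, hq⟩
  simp only [L, LinearMap.coe_mk, AddHom.coe_mk] at this
  rw [← this, ← Finset.sum_coe_sort T]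
  exact Finset.sum_congr rfl fun p _ => by simp

/-- A minimizer whose potential touches its minimal value only finitely often is finitely
supported and unique, and gives rise to an optimal dual. -/
theorem IsMinimizer.unique_and_isOptimalDual (hX : IsCenteredContinuousGaussian X P)
    (hR : IsNondegenerate (covFun X P)) (hν : IsMinimizer (covFun X P) a b ν)
    (hfin : {t ∈ Icc a b | potential (covFun X P) ν t = energy (covFun X P) ν}.Finite) :
    (∀ᵐ t ∂ν, t ∈ hfin.toFinset) ∧ 0 < energy (covFun X P) ν ∧
      IsOptimalDual X P a b hfin.toFinset (fun p => ν.real {p} / energy (covFun X P) ν) ∧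
      ∀ ν', IsMinimizer (covFun X P) a b ν' → ν' = ν := by
  have hprob := hν.1.1
  have hRc := hX.continuous_covFun
  set T := hfin.toFinset with hT
  set E := energy (covFun X P) ν with hE
  set g := potential (covFun X P) ν with hg
  have hgc : Continuous g := hν.1.continuous_potential hRc
  have hgE : ∀ t ∈ Icc a b, E ≤ g t := fun t ht =>
    hν.energy_le_potential hRc covFun_comm ht
  have hTiff : ∀ t, t ∈ T ↔ t ∈ Icc a b ∧ g t = E := fun t => by
    rw [hT, Set.Finite.mem_toFinset]; rfl
  have hae : ∀ᵐ t ∂ν, t ∈ T := by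
    filter_upwards [hν.1.ae_mem, ae_eq_of_integral_le hν.1 hgc hgE le_rfl] with t h1 h2
    exact (hTiff t).2 ⟨h1, h2⟩
  set w : ℝ → ℝ := fun p => ν.real {p} with hw
  have hgsum : ∀ t, g t = ∑ p ∈ T, w p * covFun X P p t := fun t =>
    integral_eq_sum_of_finset hae _
  have hEsum : E = ∑ p ∈ T, w p * ∑ q ∈ T, w q * covFun X P q p := by
    rw [hE, energy_eq_integral_potential, integral_eq_sum_of_finset hae]
    exact Finset.sum_congr rfl fun p _ => by rw [← hgsum]
  have hwsum : ∑ p ∈ T, w p = 1 := by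
    have := integral_eq_sum_of_finset hae (fun _ => 1)
    simpa only [mul_one, integral_const, probReal_univ, smul_eq_mul] using this.symm
  have hE0 : 0 < E := by
    refine lt_of_le_of_ne ?_ fun h0 => ?_
    · rw [hEsum, ← hX.integral_sum_sq]
      exact integral_nonneg fun ω => sq_nonneg _
    · rw [← h0] at hEsum
      have := hR T w hEsum.symm
      rw [Finset.sum_eq_zero this] at hwsum
      exact zero_ne_one hwsum
  have hθ : ∀ t, ∑ p ∈ T, w p / E * covFun X P p t = g t / E := fun t => by
    rw [hgsum, Finset.sum_div]
    exact Finset.sum_congr rfl fun p _ => by ring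
  refine ⟨hae, hE0, ⟨fun p hp => ((hTiff p).1 hp).1, fun p _ => by positivity, fun t ht => ?_,
    fun t ht => ?_, hR.solvable T⟩, fun ν' hν' => ?_⟩
  · rw [hθ, one_le_div hE0]
    exact hgE t ht
  · rw [hθ, div_eq_one_iff_eq hE0.ne', hTiff]
    exact ⟨fun h => ⟨ht, h⟩, fun h => h.2⟩
  · have hprob' := hν'.1.1
    have hE' : energy (covFun X P) ν' = E := le_antisymm (hν'.2 _ hν.1) (hν.2 _ hν'.1)
    have hcross : ∑ p ∈ T, w p * potential (covFun X P) ν' p = ∫ t, g t ∂ν' := by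
      simp_rw [hgsum]
      rw [integral_finsetSum]
      · refine Finset.sum_congr rfl fun p _ => ?_
        rw [integral_const_mul]
        simp only [potential, covFun_comm p]
      · intro p _
        exact (hν'.1.integrable (hRc.comp (continuous_const.prodMk continuous_id))).const_mul _
    -- Both energies are `E`, so positivity reads `∫ g dν' ≤ E`. As `g ≥ E` on `[a,b]`, the second
    -- minimizer also lives on `T`, and the quadratic form of the difference of the masses vanishes.
    have h1 := hX.energy_sub_nonneg hν'.1 T w
    rw [hE', hcross, ← hEsum] at h1
    have hae' : ∀ᵐ t ∂ν', t ∈ T := by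
      filter_upwards [hν'.1.ae_mem, ae_eq_of_integral_le hν'.1 hgc hgE (by linarith)] with t h2 h3
      exact (hTiff t).2 ⟨h2, h3⟩
    set w' : ℝ → ℝ := fun p => ν'.real {p} with hw'
    have hg' : ∀ t, potential (covFun X P) ν' t = ∑ p ∈ T, w' p * covFun X P p t := fun t =>
      integral_eq_sum_of_finset hae' _
    have hE'sum : E = ∑ p ∈ T, w' p * ∑ q ∈ T, w' q * covFun X P q p := by
      rw [← hE', energy_eq_integral_potential, integral_eq_sum_of_finset hae']
      exact Finset.sum_congr rfl fun p _ => by rw [← hg']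
    have hw'sum : ∑ p ∈ T, w' p = 1 := by
      have := integral_eq_sum_of_finset hae' (fun _ => 1)
      simpa only [mul_one, integral_const, probReal_univ, smul_eq_mul] using this.symm
    have hgT : ∀ p ∈ T, ∑ q ∈ T, w q * covFun X P q p = E := fun p hp => by
      rw [← hgsum]; exact ((hTiff p).1 hp).2
    have hdiff : ∑ p ∈ T, (w' p - w p) * ∑ q ∈ T, (w' q - w q) * covFun X P q p = 0 := by
      have e1 : ∀ p ∈ T, (w' p - w p) * ∑ q ∈ T, (w' q - w q) * covFun X P q p =
          w' p * (∑ q ∈ T, w' q * covFun X P q p) - w p * potential (covFun X P) ν' p -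
            (w' p - w p) * E := by
        intro p hp
        simp_rw [sub_mul _ _ (covFun X P _ _)]
        rw [Finset.sum_sub_distrib, hgT p hp, ← hg']
        ring
      rw [Finset.sum_congr rfl e1, Finset.sum_sub_distrib, Finset.sum_sub_distrib, ← hE'sum,
        hcross, ← Finset.sum_mul, Finset.sum_sub_distrib, hwsum, hw'sum,
        integral_eq_sum_of_finset hae']
      have : ∑ p ∈ T, ν'.real {p} * g p = E := by
        rw [Finset.sum_congr rfl fun p hp => by rw [((hTiff p).1 hp).2], ← Finset.sum_mul]
        change (∑ p ∈ T, w' p) * E = E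
        rw [hw'sum, one_mul]
      rw [this]
      ring
    have hww := hR T (fun p => w' p - w p) hdiff
    exact eq_of_measureReal_singleton_eq hae' hae fun p hp => sub_eq_zero.1 (hww p hp)

end GaussianPaths

/-! ### Finiteness of the contact set in the power series case -/

/-- An analytic function takes a value finitely often on a compact interval, or it is constant. -/
theorem finite_eq_or_forall_eq {g : ℝ → ℝ} (hg : AnalyticOnNhd ℝ g univ) (a b e : ℝ) :
    {t ∈ Icc a b | g t = e}.Finite ∨ ∀ t, g t = e := by
  by_contra! h
  obtain ⟨hinf, t, ht⟩ := h
  obtain ⟨x, -, hx⟩ := Set.Infinite.exists_accPt_of_subset_isCompact hinf isCompact_Icc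
    fun t ht => ht.1
  have hfr : ∃ᶠ y in 𝓝[≠] x, g y = e :=
    (accPt_iff_frequently_nhdsNE.1 hx).mono fun y hy => hy.2
  exact ht (congrFun (hg.eq_of_frequently_eq analyticOnNhd_const hfr) t)

section PowerSeries

theorem HasPowerExpansion.analyticOnNhd {R : ℝ → ℝ → ℝ} (hR : HasPowerExpansion R) (s : ℝ) :
    AnalyticOnNhd ℝ (fun t => R s t) univ := by
  obtain ⟨r, hr⟩ := hR
  have hr' : ∀ t, HasSum (fun p : ℕ × ℕ => r p.2 p.1 * s ^ p.2 * t ^ p.1) (R s t) := fun t =>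
    (Equiv.prodComm ℕ ℕ).hasSum_iff.1 (by simpa [Function.comp_def] using hr s t)
  -- Setting `t = 1` extracts summability of the coefficient of `t ^ n`; the resulting one-variable
  -- series converges for every `t`.
  have hfib : ∀ n, Summable fun m => r m n * s ^ m := fun n => by
    simpa using (hr' 1).summable.prod_factor n
  set c : ℕ → ℝ := fun n => ∑' m, r m n * s ^ m with hc
  have hsum : ∀ t, HasSum (fun n => c n * t ^ n) (R s t) := fun t =>
    (hr' t).prod_fiberwise fun n => (hfib n).hasSum.mul_right _
  set p := FormalMultilinearSeries.ofScalars ℝ c with hp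
  have hrad : p.radius = ⊤ := by
    refine ENNReal.eq_top_of_forall_nnreal_le fun x => ?_
    refine p.le_radius_of_tendsto (l := 0) ?_
    have := (hsum x).summable.norm.tendsto_atTop_zero
    simpa [hp, FormalMultilinearSeries.ofScalars_norm] using this
  have hball : HasFPowerSeriesOnBall (fun t => R s t) p 0 ⊤ :=
    { r_le := hrad.ge
      r_pos := ENNReal.zero_lt_top
      hasSum := fun {t} _ => by
        simpa [hp, FormalMultilinearSeries.ofScalars_apply_eq, mul_comm] using hsum t }
  simpa using hball.analyticOnNhd

theorem LimsupNonpos.eventually_lt {R : ℝ → ℝ → ℝ} {a b : ℝ} (hR : LimsupNonpos R a b) {s : ℝ}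
    (hs : s ∈ Icc a b) {δ : ℝ} (hδ : 0 < δ) : ∀ᶠ t in atTop, R s t < δ := by
  have h1 : limsup (fun t => ((R s t : ℝ) : EReal)) atTop < (δ : EReal) :=
    (hR s hs).trans_lt (by exact_mod_cast hδ)
  filter_upwards [eventually_lt_of_limsup_lt h1] with t ht
  exact_mod_cast ht

/-- The potential is a finite combination of analytic functions. Were it constant, it would equal
the positive energy everywhere, but the limsup condition at the finitely many support points pushes
it below half of that for large `t`. -/
theorem finite_touching_of_powerExpansion {R : ℝ → ℝ → ℝ} {a b : ℝ} {ν : Measure ℝ}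
    (hR : HasPowerExpansion R) (hpos : NonnegNondegenerate R) (hlim : LimsupNonpos R a b)
    (hν : IsProbOn a b ν) (hfin : ν.support.Finite) :
    {t ∈ Icc a b | potential R ν t = energy R ν}.Finite := by
  have hprob := hν.1
  have hae : ∀ᵐ t ∂ν, t ∈ hfin.toFinset := by
    filter_upwards [Measure.support_mem_ae (μ := ν)] with t ht
    exact hfin.mem_toFinset.2 ht
  have hpot : ∀ t, potential R ν t = ∑ p ∈ hfin.toFinset, ν.real {p} * R p t := fun t =>
    integral_eq_sum_of_finset hae _
  have han : AnalyticOnNhd ℝ (potential R ν) univ := by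
    have : AnalyticOnNhd ℝ (fun t => ∑ p ∈ hfin.toFinset, ν.real {p} * R p t) univ :=
      Finset.analyticOnNhd_fun_sum _ fun p _ => analyticOnNhd_const.mul (hR.analyticOnNhd p)
    simpa only [← hpot] using this
  refine (finite_eq_or_forall_eq han a b (energy R ν)).resolve_right fun hconst => ?_
  have hE := hpos a b ν hν
  have hsub : ν.support ⊆ Icc a b := Measure.support_subset_of_isClosed isClosed_Icc hν.ae_mem
  have hev : ∀ᶠ t in atTop, ∀ p ∈ hfin.toFinset, R p t < energy R ν / 2 :=
    (Filter.eventually_all_finset _).2 fun p hp =>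
      hlim.eventually_lt (hsub (hfin.mem_toFinset.1 hp)) (half_pos hE)
  obtain ⟨t, ht⟩ := hev.exists
  have hsum : ∑ p ∈ hfin.toFinset, ν.real {p} = 1 := by
    have := integral_eq_sum_of_finset hae (fun _ => 1)
    simpa only [mul_one, integral_const, probReal_univ, smul_eq_mul] using this.symm
  have : energy R ν ≤ energy R ν / 2 := by
    calc energy R ν = ∑ p ∈ hfin.toFinset, ν.real {p} * R p t := by rw [← hpot, hconst]
      _ ≤ ∑ p ∈ hfin.toFinset, ν.real {p} * (energy R ν / 2) :=
        Finset.sum_le_sum fun p hp => mul_le_mul_of_nonneg_left (ht p hp).le measureReal_nonneg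
      _ = energy R ν / 2 := by rw [← Finset.sum_mul, hsum, one_mul]
  linarith

end PowerSeries

/-- A vanishing quadratic form means a linear combination of the `X_q` that is almost surely zero,
hence a kernel vector of a covariance matrix of zeroth derivatives. -/
theorem SmoothNondegenerate.isNondegenerate {Ω : Type*} [MeasurableSpace Ω] {P : Measure Ω}
    [IsProbabilityMeasure P] {X : ℝ → Ω → ℝ} (hX : IsCenteredContinuousGaussian X P)
    (h : SmoothNondegenerate X P) : IsNondegenerate (covFun X P) := by
  classical
  intro T c hc p hp
  rw [← hX.integral_sum_sq] at hc
  have hL2 : MemLp (fun ω => ∑ q ∈ T, c q * X q ω) 2 P :=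
    memLp_finsetSum _ fun q _ => (hX.memLp q).const_mul _
  have hzero := (integral_eq_zero_iff_of_nonneg_ae (ae_of_all _ fun ω => sq_nonneg _)
    hL2.integrable_sq).1 hc
  have hcov : ∀ t, ∑ q ∈ T, c q * covFun X P q t = 0 := fun t => by
    rw [← hX.integral_mul_sum]
    refine integral_eq_zero_of_ae ?_
    filter_upwards [hzero] with ω hω
    have : ∑ q ∈ T, c q * X q ω = 0 := by simpa using hω
    simp [this]
  have hder : ∀ t, derivProc X 0 t = X t := fun t => by
    ext ω; simp [derivProc]
  have hcoveq : ∀ s t, cov[X s, X t; P] = covFun X P s t := fun s t => by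
    rw [covariance_eq_sub (hX.memLp s) (hX.memLp t), hX.centered, zero_mul, sub_zero]
    rfl
  let I : Finset (ℝ × ℕ) := T.map ⟨fun p => (p, 0), fun p q h => (Prod.ext_iff.1 h).1⟩
  have hI2 : ∀ q : I, q.1.2 = 0 := fun q => by
    obtain ⟨p, -, hp⟩ := Finset.mem_map.1 q.2
    rw [← hp]; rfl
  have hv := Matrix.eq_zero_of_mulVec_eq_zero (h.nonsingular I) (v := fun q => c q.1.1) (by
    ext r
    simp only [Matrix.mulVec, dotProduct, Matrix.of_apply, hI2, hder, hcoveq, Pi.zero_apply]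
    rw [Finset.sum_coe_sort I fun q => covFun X P r.1.1 q.1 * c q.1, Finset.sum_map, ← hcov r.1.1]
    refine Finset.sum_congr rfl fun q _ => ?_
    rw [covFun_comm q, mul_comm]
    rfl)
  exact congrFun hv ⟨(p, 0), Finset.mem_map.2 ⟨p, hp, rfl⟩⟩

/-! ### Existence of a minimizer -/

section Existence

variable {R : ℝ → ℝ → ℝ} {a b : ℝ}

/-- A continuous kernel has an energy minimizing probability measure on a compact interval. -/
theorem exists_isMinimizer (hab : a < b) (hR : Continuous fun p : ℝ × ℝ => R p.1 p.2) :
    ∃ ν, IsMinimizer R a b ν := by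
  have hne : Nonempty (ProbabilityMeasure (Icc a b)) :=
    ⟨⟨Measure.dirac ⟨a, left_mem_Icc.2 hab.le⟩, inferInstance⟩⟩
  let f : BoundedContinuousFunction (Icc a b × Icc a b) ℝ :=
    BoundedContinuousFunction.mkOfCompact ⟨fun z => R z.2.1 z.1.1, hR.comp
      ((continuous_subtype_val.comp continuous_snd).prodMk
        (continuous_subtype_val.comp continuous_fst))⟩
  -- Written against `μ × μ`, the energy is weakly continuous, and the probability measures on a
  -- compact interval form a compact space.
  let J : ProbabilityMeasure (Icc a b) → ℝ := fun μ => ∫ z, f z ∂(μ.prod μ : Measure _)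
  have hJ : Continuous J := by
    rw [continuous_iff_continuousAt]
    intro μ
    have h1 : Tendsto (fun μ' : ProbabilityMeasure (Icc a b) => μ'.prod μ') (𝓝 μ)
        (𝓝 (μ.prod μ)) :=
      (ProbabilityMeasure.continuous_prod.comp (continuous_id.prodMk continuous_id)).tendsto μ
    exact ProbabilityMeasure.tendsto_iff_forall_integral_tendsto.1 h1 f
  have hJE : ∀ μ : ProbabilityMeasure (Icc a b),
      J μ = energy R ((μ : Measure (Icc a b)).map Subtype.val) := fun μ => by
    have hmap : ∀ g : ℝ → ℝ, ∫ t, g t ∂((μ : Measure (Icc a b)).map Subtype.val) =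
        ∫ t : Icc a b, g t ∂(μ : Measure (Icc a b)) := fun g =>
      (MeasurableEmbedding.subtype_coe measurableSet_Icc).integral_map g
    simp only [J, energy, hmap, ProbabilityMeasure.toMeasure_prod]
    rw [integral_prod _ (f.integrable _)]
    rfl
  obtain ⟨μ, -, hμ⟩ := isCompact_univ.exists_isMinOn univ_nonempty hJ.continuousOn
  refine ⟨(μ : Measure (Icc a b)).map Subtype.val, ⟨?_, ?_⟩, fun ν' hν' => ?_⟩
  · exact Measure.isProbabilityMeasure_map measurable_subtype_coe.aemeasurable
  · rw [Measure.map_apply measurable_subtype_coe measurableSet_Icc.compl]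
    convert measure_empty (μ := (μ : Measure (Icc a b)))
    ext x
    simp
  · have hprob := hν'.1
    have hcm : (ν'.comap (Subtype.val : Icc a b → ℝ)).map Subtype.val = ν' := by
      rw [map_comap_subtype_coe measurableSet_Icc, hν'.restrict_eq]
    have hpc : IsProbabilityMeasure (ν'.comap (Subtype.val : Icc a b → ℝ)) := by
      constructor
      rw [← hprob.measure_univ]
      nth_rewrite 2 [← hcm]
      rw [Measure.map_apply measurable_subtype_coe MeasurableSet.univ, preimage_univ]
    let μ' : ProbabilityMeasure (Icc a b) := ⟨_, hpc⟩
    have h1 : J μ' = energy R ν' := (hJE μ').trans (congrArg _ hcm)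
    rw [← hJE, ← h1]
    exact hμ (mem_univ _)

end Existence

/-! ### The stationary case by entire extension of transforms -/

section Stationary

theorem differentiable_complexMGF_id {μ : Measure ℝ}
    (h : ∀ t : ℝ, Integrable (fun x => Real.exp (t * x)) μ) :
    Differentiable ℂ (complexMGF id μ) := by
  have huniv : integrableExpSet id μ = univ := eq_univ_of_forall fun t => h t
  have := differentiableOn_complexMGF (X := id) (μ := μ)
  simp only [huniv, interior_univ, mem_univ] at this
  exact differentiableOn_univ.1 this

/-- The zero set is closed, so it contains the support of `F`; the accumulation point then triggers
the identity theorem. -/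
theorem eq_zero_of_ae_eq_zero {F : Measure ℝ} {x₀ : ℝ} (hacc : AccPt x₀ (𝓟 F.support))
    {H : ℂ → ℂ} (hH : Differentiable ℂ H) (h0 : ∀ᵐ x : ℝ ∂F, H x = 0) : H = 0 := by
  have hsub : F.support ⊆ {x : ℝ | H x = 0} := Measure.support_subset_of_isClosed
    (isClosed_eq (hH.continuous.comp Complex.continuous_ofReal) continuous_const) h0
  have hfr : ∃ᶠ x : ℝ in 𝓝[≠] x₀, H x = 0 :=
    (accPt_iff_frequently_nhdsNE.1 hacc).mono fun y hy => hsub hy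
  have htend : Tendsto (fun x : ℝ => (x : ℂ)) (𝓝[≠] x₀) (𝓝[≠] (x₀ : ℂ)) := by
    refine tendsto_nhdsWithin_of_tendsto_nhds_of_eventually_within _
      (Complex.continuous_ofReal.continuousAt.tendsto.mono_left nhdsWithin_le_nhds) ?_
    filter_upwards [self_mem_nhdsWithin] with x hx
    simpa using hx
  exact (hH.differentiableOn.analyticOnNhd isOpen_univ).eq_of_frequently_eq
    (analyticOnNhd_const (v := (0 : ℂ))) (htend.frequently hfr)

theorem differentiable_integral_comp_sub {a b : ℝ} {ν : Measure ℝ} (hν : IsProbOn a b ν)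
    {Ψ : ℂ → ℂ} (hΨ : Differentiable ℂ Ψ) :
    Differentiable ℂ fun z => ∫ s : ℝ, Ψ (z - s) ∂ν := by
  intro z₀
  have := hν.1
  have hΨ' : Continuous (deriv Ψ) := (hΨ.contDiff (n := 1)).continuous_deriv le_rfl
  obtain ⟨C, hC⟩ := ((isCompact_closedBall z₀ 1).prod (isCompact_Icc (a := a) (b := b)))
    |>.exists_bound_of_continuousOn (f := fun p : ℂ × ℝ => deriv Ψ (p.1 - p.2))
      (hΨ'.comp (continuous_fst.sub (Complex.continuous_ofReal.comp continuous_snd))).continuousOn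
  have hc : ∀ {f : ℂ → ℂ}, Continuous f → ∀ z : ℂ, Integrable (fun s : ℝ => f (z - s)) ν :=
    fun hf z => hν.integrable (hf.comp (continuous_const.sub Complex.continuous_ofReal))
  exact (hasDerivAt_integral_of_dominated_loc_of_deriv_le (bound := fun _ => C)
    (F' := fun z s => deriv Ψ (z - s)) (Metric.closedBall_mem_nhds z₀ one_pos)
    (.of_forall fun z => (hc hΨ.continuous z).aestronglyMeasurable) (hc hΨ.continuous z₀)
    (hc hΨ' z₀).aestronglyMeasurable
    (by filter_upwards [hν.ae_mem] with s hs z hz using hC (z, s) ⟨hz, hs⟩)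
    (integrable_const _)
    (ae_of_all _ fun s z _ => (hΨ (z - s)).hasDerivAt.comp_sub_const z (s : ℂ))).2.differentiableAt

variable {R : ℝ → ℝ → ℝ} {F : Measure ℝ} {a b : ℝ} {ν : Measure ℝ}

theorem IsSpectralMeasure.eq_complexMGF (hF : IsSpectralMeasure R F) (s t : ℝ) :
    (R s t : ℂ) = complexMGF id F (Complex.I * (t - s)) := by
  rw [hF.repr, complexMGF]
  refine integral_congr_ae (ae_of_all _ fun x => ?_)
  simp [mul_assoc]

theorem IsSpectralMeasure.analyticOnNhd_potential (hF : IsSpectralMeasure R F)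
    (hexp : ∀ t : ℝ, Integrable (fun x => Real.exp (t * x)) F) (hν : IsProbOn a b ν) :
    AnalyticOnNhd ℝ (potential R ν) univ := by
  have hd : Differentiable ℂ fun z : ℂ => ∫ s : ℝ, complexMGF id F (Complex.I * (z - s)) ∂ν :=
    differentiable_integral_comp_sub hν (Ψ := fun z => complexMGF id F (Complex.I * z))
      ((differentiable_complexMGF_id hexp).comp (differentiable_id.const_mul _))
  have h1 : ∀ t, potential R ν t =
      (∫ s : ℝ, complexMGF id F (Complex.I * ((t : ℂ) - s)) ∂ν).re := fun t => by
    simp_rw [← hF.eq_complexMGF]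
    rw [integral_complex_ofReal, Complex.ofReal_re, potential]
  have h2 := (hd.differentiableOn.analyticOnNhd isOpen_univ).restrictScalars (𝕜 := ℝ)
  intro t _
  have h3 := (Complex.reCLM.analyticAt _).comp ((h2 _ (mem_univ _)).comp
    (Complex.ofRealCLM.analyticAt t))
  convert h3 using 1
  ext t
  exact h1 t

theorem cexp_I_mul_conj (x : ℝ) :
    (starRingEnd ℂ) (Complex.exp (Complex.I * x)) = Complex.exp (-(Complex.I * x)) := by
  rw [← Complex.exp_conj, map_mul, Complex.conj_I, Complex.conj_ofReal, neg_mul]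

theorem linearCombination_exp_eq_zero {T : Finset ℝ} {c : ℝ → ℝ}
    (h : ∀ x : ℝ, ∑ p ∈ T, (c p : ℂ) * Complex.exp (Complex.I * (p * x)) = 0) :
    ∀ p ∈ T, c p = 0 := by
  let χ : ℝ → (Multiplicative ℝ →* ℂ) := fun p =>
    { toFun := fun x => Complex.exp (Complex.I * (p * (x.toAdd : ℝ)))
      map_one' := by simp
      map_mul' := fun x y => by
        rw [← Complex.exp_add]
        congr 1
        push_cast [toAdd_mul]
        ring }
  have hinj : Function.Injective χ := by
    intro p q hpq
    by_contra hne
    have hne' : p - q ≠ 0 := sub_ne_zero.2 hne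
    -- At `π / (p - q)` the two characters differ by the factor `-1`.
    have h1 : Complex.exp (Complex.I * (p * ((Real.pi / (p - q) : ℝ) : ℂ))) =
        Complex.exp (Complex.I * (q * ((Real.pi / (p - q) : ℝ) : ℂ))) :=
      DFunLike.congr_fun hpq (Multiplicative.ofAdd (Real.pi / (p - q)))
    have h2 : Complex.exp (Complex.I * (p * ((Real.pi / (p - q) : ℝ) : ℂ)) -
        Complex.I * (q * ((Real.pi / (p - q) : ℝ) : ℂ))) = 1 := by
      rw [Complex.exp_sub, h1, div_self (Complex.exp_ne_zero _)]
    have h3 : Complex.I * (p * ((Real.pi / (p - q) : ℝ) : ℂ)) -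
        Complex.I * (q * ((Real.pi / (p - q) : ℝ) : ℂ)) = Real.pi * Complex.I := by
      have : ((p : ℂ) - q) ≠ 0 := by exact_mod_cast hne'
      push_cast
      field_simp
    rw [h3, Complex.exp_pi_mul_I] at h2
    norm_num at h2
  have hli := (linearIndependent_monoidHom (Multiplicative ℝ) ℂ).comp χ hinj
  intro p hp
  have := linearIndependent_iff'.1 hli T (fun p => (c p : ℂ)) (by
    ext x
    simpa [χ] using h x.toAdd) p hp
  exact_mod_cast this

/-- The quadratic form is `∫ |h|² dF` for the exponential sum `h` with coefficients `c`. If it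
vanishes, the entire function `h` is zero, and distinct characters are linearly independent. -/
theorem IsSpectralMeasure.isNondegenerate (hF : IsSpectralMeasure R F) {x₀ : ℝ}
    (hacc : AccPt x₀ (𝓟 F.support)) : IsNondegenerate R := by
  have hfin := hF.finite
  intro T c hc
  set h : ℂ → ℂ := fun z => ∑ p ∈ T, (c p : ℂ) * Complex.exp (Complex.I * (p * z)) with hh
  have hd : Differentiable ℂ h := by
    refine Differentiable.fun_sum fun p _ => ?_
    fun_prop
  have hi : ∀ y : ℝ, Integrable (fun x : ℝ => Complex.exp (Complex.I * ((y * x : ℝ) : ℂ))) F :=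
    fun y => Integrable.of_bound (by fun_prop) 1 (ae_of_all _ fun x => by
      rw [mul_comm, Complex.norm_exp_ofReal_mul_I])
  have hsq : ∀ x : ℝ, ((‖h x‖ ^ 2 : ℝ) : ℂ) = ∑ p ∈ T, ∑ q ∈ T, ((c p * c q : ℝ) : ℂ) *
      Complex.exp (Complex.I * (((p - q) * x : ℝ) : ℂ)) := fun x => by
    rw [Complex.ofReal_pow, ← Complex.mul_conj', hh]
    simp only
    rw [map_sum, Finset.sum_mul_sum]
    refine Finset.sum_congr rfl fun p _ => Finset.sum_congr rfl fun q _ => ?_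
    rw [map_mul, Complex.conj_ofReal, ← Complex.ofReal_mul q x, cexp_I_mul_conj,
      mul_mul_mul_comm, ← Complex.exp_add]
    push_cast
    congr 2
    ring
  have hint : ∫ x : ℝ, ‖h x‖ ^ 2 ∂F = 0 := by
    have h1 : ((∫ x : ℝ, ‖h x‖ ^ 2 ∂F : ℝ) : ℂ) = 0 := by
      rw [← integral_complex_ofReal]
      simp_rw [hsq]
      rw [integral_finsetSum _ fun p _ => integrable_finsetSum _ fun q _ => (hi _).const_mul _]
      rw [Finset.sum_congr rfl fun p _ => integral_finsetSum _ fun q _ => (hi _).const_mul _]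
      simp_rw [integral_const_mul, ← hF.repr]
      rw [← Complex.ofReal_zero, ← hc]
      push_cast
      refine Finset.sum_congr rfl fun p _ => ?_
      rw [Finset.mul_sum]
      exact Finset.sum_congr rfl fun q _ => by ring
    exact_mod_cast h1
  have hnorm : Integrable (fun x : ℝ => ‖h x‖ ^ 2) F := by
    refine Integrable.of_bound ((hd.continuous.comp
      Complex.continuous_ofReal).norm.pow 2).aestronglyMeasurable ((∑ p ∈ T, |c p|) ^ 2)
      (ae_of_all _ fun x => ?_)
    rw [Real.norm_eq_abs, abs_of_nonneg (sq_nonneg _)]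
    refine pow_le_pow_left₀ (norm_nonneg _) ((norm_sum_le _ _).trans_eq
      (Finset.sum_congr rfl fun p _ => ?_)) 2
    rw [norm_mul, Complex.norm_real, ← Complex.ofReal_mul, mul_comm Complex.I,
      Complex.norm_exp_ofReal_mul_I, mul_one, Real.norm_eq_abs]
  have hae := (integral_eq_zero_iff_of_nonneg_ae (ae_of_all _ fun x => sq_nonneg _) hnorm).1 hint
  have h0 := eq_zero_of_ae_eq_zero hacc hd (by
    filter_upwards [hae] with x hx
    simpa using hx)
  exact linearCombination_exp_eq_zero fun x => congrFun h0 x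

/-- Fubini turns the `ν`-average of the translated potential into a spectral integral against the
squared modulus of the transform of `ν`. The translation by `y` is what detects a constant
potential. -/
theorem IsSpectralMeasure.integral_potential_add (hF : IsSpectralMeasure R F)
    [IsProbabilityMeasure ν] (y : ℝ) :
    ((∫ t, potential R ν (t + y) ∂ν : ℝ) : ℂ) = ∫ x : ℝ, Complex.exp (Complex.I * (y * x)) *
      ((‖complexMGF id ν (Complex.I * x)‖ ^ 2 : ℝ) : ℂ) ∂F := by
  have hfin := hF.finite
  let G : ℝ → ℝ × ℝ → ℂ := fun x z => Complex.exp (Complex.I * (((z.1 + y - z.2) * x : ℝ) : ℂ))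
  have hG : Integrable (Function.uncurry G) (F.prod (ν.prod ν)) :=
    Integrable.of_bound (by simp only [G, Function.uncurry_def]; fun_prop) 1
      (ae_of_all _ fun x => by
        simp only [G, Function.uncurry_def]
        rw [mul_comm, Complex.norm_exp_ofReal_mul_I])
  have hswap := integral_integral_swap hG
  have hin : ∀ x : ℝ, ∫ z, G x z ∂(ν.prod ν) = Complex.exp (Complex.I * (y * x)) *
      ((‖complexMGF id ν (Complex.I * x)‖ ^ 2 : ℝ) : ℂ) := fun x => by
    have e1 : ∀ z, G x z = Complex.exp (Complex.I * (y * x)) *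
        (Complex.exp (Complex.I * x * z.1) * (starRingEnd ℂ) (Complex.exp (Complex.I * x * z.2))) :=
      fun z => by
        rw [mul_assoc Complex.I, mul_assoc Complex.I, ← Complex.ofReal_mul x z.2,
          cexp_I_mul_conj, ← Complex.exp_add, ← Complex.exp_add]
        simp only [G]
        congr 1
        push_cast
        ring
    simp_rw [e1]
    rw [integral_const_mul, integral_prod_mul (fun t : ℝ => Complex.exp (Complex.I * x * t))
      (fun s : ℝ => (starRingEnd ℂ) (Complex.exp (Complex.I * x * s))), integral_conj,
      Complex.ofReal_pow, ← Complex.mul_conj']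
    rfl
  have hout : ∀ z : ℝ × ℝ, ∫ x, G x z ∂F = (R z.2 (z.1 + y) : ℂ) := fun z =>
    (hF.repr z.2 (z.1 + y)).symm
  have hGi := hG.integral_prod_right
  simp only [Function.uncurry_apply_pair, hout] at hGi
  simp_rw [hin, hout] at hswap
  rw [hswap, integral_prod _ hGi, ← integral_complex_ofReal]
  refine integral_congr_ae (ae_of_all _ fun t => ?_)
  simp only [potential]
  rw [integral_complex_ofReal]

/-- A constant potential would have the same `ν`-average after translation by 0 and by 1, so `(1 -
cos x)|ν̂(x)|²` would have zero `F`-integral. Then the entire function `(1 - cos z) ν̂(z)` vanishes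
identically, which contradicts `ν̂(0) = 1`. -/
theorem IsSpectralMeasure.finite_touching (hF : IsSpectralMeasure R F)
    (hexp : ∀ t : ℝ, Integrable (fun x => Real.exp (t * x)) F) {x₀ : ℝ}
    (hacc : AccPt x₀ (𝓟 F.support)) (hν : IsProbOn a b ν) :
    {t ∈ Icc a b | potential R ν t = energy R ν}.Finite := by
  have hfin := hF.finite
  have hprob := hν.1
  refine (finite_eq_or_forall_eq (hF.analyticOnNhd_potential hexp hν) a b _).resolve_right
    fun hconst => ?_
  have hdν : Differentiable ℂ fun z : ℂ => complexMGF id ν (Complex.I * z) :=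
    (differentiable_complexMGF_id (μ := ν) fun t => hν.integrable (by fun_prop)).comp
      (differentiable_id.const_mul _)
  set m : ℝ → ℝ := fun x => ‖complexMGF id ν (Complex.I * x)‖ ^ 2 with hm
  have hmc : Continuous m := (hdν.continuous.comp Complex.continuous_ofReal).norm.pow 2
  have hm1 : ∀ x, m x ≤ 1 := fun x => by
    have h1 := norm_complexMGF_le_mgf (X := id) (μ := ν) (z := Complex.I * x)
    simp at h1
    exact pow_le_one₀ (norm_nonneg _) h1
  have hre : ∀ y : ℝ, ∫ t, potential R ν (t + y) ∂ν = ∫ x, Real.cos (y * x) * m x ∂F := fun y => by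
    have h1 := hF.integral_potential_add (ν := ν) y
    have h2 : Integrable (fun x : ℝ => Complex.exp (Complex.I * (y * x)) * ((m x : ℝ) : ℂ)) F :=
      Integrable.of_bound (by fun_prop) 1 (ae_of_all _ fun x => by
        rw [norm_mul, ← Complex.ofReal_mul, mul_comm Complex.I, Complex.norm_exp_ofReal_mul_I,
          one_mul, Complex.norm_real, Real.norm_eq_abs, abs_of_nonneg (by positivity)]
        exact hm1 x)
    have h3 := congrArg Complex.re h1
    rw [Complex.ofReal_re] at h3
    rw [h3]
    refine (integral_re (𝕜 := ℂ) h2).symm.trans (integral_congr_ae (ae_of_all _ fun x => ?_))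
    simp only [RCLike.re_eq_complex_re, Complex.re_mul_ofReal]
    rw [← Complex.ofReal_mul, mul_comm Complex.I, Complex.exp_ofReal_mul_I_re]
  have hi : ∀ y : ℝ, Integrable (fun x => Real.cos (y * x) * m x) F := fun y =>
    Integrable.of_bound (by fun_prop) 1 (ae_of_all _ fun x => by
      rw [norm_mul, Real.norm_eq_abs, Real.norm_eq_abs, abs_of_nonneg (a := m x) (by positivity)]
      exact mul_le_one₀ (Real.abs_cos_le_one _) (by positivity) (hm1 x))
  have hzero : ∫ x, (1 - Real.cos x) * m x ∂F = 0 := by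
    have h0 := hre 0
    have h1 := hre 1
    simp only [hconst] at h0 h1
    have e : ∀ x, (1 - Real.cos x) * m x = Real.cos (0 * x) * m x - Real.cos (1 * x) * m x :=
      fun x => by simp; ring
    simp_rw [e]
    rw [integral_sub (hi 0) (hi 1), ← h0, ← h1, sub_self]
  have hint : Integrable (fun x => (1 - Real.cos x) * m x) F :=
    ((hi 0).sub (hi 1)).congr (ae_of_all _ fun x => by simp; ring)
  have hae := (integral_eq_zero_iff_of_nonneg_ae (ae_of_all _ fun x =>
    mul_nonneg (sub_nonneg.2 (Real.cos_le_one x)) (by positivity)) hint).1 hzero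
  have hH : Differentiable ℂ fun z : ℂ =>
      (1 - Complex.cos z) * complexMGF id ν (Complex.I * z) :=
    ((differentiable_const _).sub Complex.differentiable_cos).mul hdν
  have h0 := eq_zero_of_ae_eq_zero hacc hH (by
    filter_upwards [hae] with x hx
    rcases mul_eq_zero.1 hx with h | h
    · rw [← Complex.ofReal_cos, ← Complex.ofReal_one, ← Complex.ofReal_sub, h]
      simp
    · rw [norm_eq_zero.1 (pow_eq_zero_iff two_ne_zero |>.1 h), mul_zero])
  have hlim : Tendsto (fun x : ℝ => complexMGF id ν (Complex.I * x)) (𝓝[>] 0)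
      (𝓝 (complexMGF id ν (Complex.I * (0 : ℝ)))) :=
    ((hdν.continuous.comp Complex.continuous_ofReal).tendsto 0).mono_left nhdsWithin_le_nhds
  -- The factor `1 - cos` vanishes at 0 itself, so the value there is reached by continuity from
  -- `(0, π)`, where it does not vanish.
  have hev : ∀ᶠ x : ℝ in 𝓝[>] 0, complexMGF id ν (Complex.I * x) = 0 := by
    filter_upwards [Ioo_mem_nhdsGT Real.pi_pos] with x hx
    have h1 : (1 - Complex.cos x) * complexMGF id ν (Complex.I * x) = 0 := congrFun h0 x
    refine (mul_eq_zero.1 h1).resolve_left fun h2 => ?_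
    have h3 : Real.cos x = 1 := by
      have : Complex.cos x = 1 := (sub_eq_zero.1 h2).symm
      exact_mod_cast this
    have := Real.cos_lt_cos_of_nonneg_of_le_pi le_rfl hx.2.le hx.1
    rw [Real.cos_zero, h3] at this
    exact lt_irrefl _ this
  have h1 : complexMGF id ν (Complex.I * (0 : ℝ)) = 0 :=
    tendsto_nhds_unique (hlim.congr' hev) tendsto_const_nhds
  simp [complexMGF] at h1

end Stationary

/-! ### Identification of the rates and assembly -/

/-- If the potential of a measure equals `e` at all points of its support, then `Σ⁻¹ 1` is the
vector of masses divided by `e`. -/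
theorem theta_eq {R : ℝ → ℝ → ℝ} (hR : IsNondegenerate R) (hsymm : ∀ s t, R s t = R t s) {k : ℕ}
    {t : Fin k → ℝ} (ht : Function.Injective t) {ν : Measure ℝ} [IsFiniteMeasure ν]
    (hν : ∀ᵐ s ∂ν, s ∈ range t) {e : ℝ} (he : e ≠ 0) (hpot : ∀ j, potential R ν (t j) = e)
    (j : Fin k) : theta R t j = ν.real {t j} / e := by
  classical
  have hsum : ∀ c : Fin k → ℝ, ∀ s, ∑ q ∈ Finset.univ.image t,
      (Function.extend t c 0) q * R q s = ∑ j, c j * R (t j) s := fun c s => by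
    rw [Finset.sum_image fun i _ j _ h => ht h]
    exact Finset.sum_congr rfl fun j _ => by rw [ht.extend_apply]
  have hinj : Function.Injective (covMat R t).mulVec := by
    rw [← Matrix.coe_mulVecLin, injective_iff_map_eq_zero]
    intro c hc
    have h1 : ∀ i, ∑ j, c j * R (t j) (t i) = 0 := fun i => by
      have := congrFun hc i
      simp only [Matrix.mulVecLin_apply, Matrix.mulVec, dotProduct, covMat, Matrix.of_apply,
        Pi.zero_apply] at this
      rw [← this]
      exact Finset.sum_congr rfl fun j _ => by rw [hsymm (t i), mul_comm]
    have h2 := hR (Finset.univ.image t) (Function.extend t c 0) (by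
      refine Finset.sum_eq_zero fun p hp => ?_
      obtain ⟨i, -, rfl⟩ := Finset.mem_image.1 hp
      rw [hsum, h1, mul_zero])
    ext i
    simpa [ht.extend_apply] using h2 (t i) (Finset.mem_image_of_mem _ (Finset.mem_univ i))
  have hunit : IsUnit (covMat R t) := Matrix.mulVec_injective_iff_isUnit.1 hinj
  have hae : ∀ᵐ s ∂ν, s ∈ Finset.univ.image t := by
    filter_upwards [hν] with s ⟨i, hi⟩
    exact Finset.mem_image.2 ⟨i, Finset.mem_univ i, hi⟩
  have hw : (covMat R t).mulVec (fun j => ν.real {t j} / e) = fun _ => 1 := by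
    ext i
    have h1 : ∑ j, ν.real {t j} * R (t j) (t i) = e := by
      rw [← hpot i, potential, integral_eq_sum_of_finset hae, Finset.sum_image fun i _ j _ h => ht h]
    simp only [Matrix.mulVec, dotProduct, covMat, Matrix.of_apply]
    rw [← div_self he]
    nth_rewrite 2 [← h1]
    rw [Finset.sum_div]
    exact Finset.sum_congr rfl fun j _ => by rw [hsymm (t i)]; ring
  rw [theta, ← hw, Matrix.mulVec_mulVec, Matrix.nonsing_inv_mul _
    ((Matrix.isUnit_iff_isUnit_det _).1 hunit), Matrix.one_mulVec]

theorem eventually_separated (T : Finset ℝ) :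
    ∀ᶠ ε : ℝ in 𝓝[>] 0, ∀ p ∈ T, ∀ q ∈ T, p ≠ q → 2 * ε < |p - q| := by
  rw [Filter.eventually_all_finset]
  intro p _
  rw [Filter.eventually_all_finset]
  intro q _
  rcases eq_or_ne p q with h | h
  · simp [h]
  · have : 0 < |p - q| / 2 := half_pos (abs_pos.2 (sub_ne_zero.2 h))
    filter_upwards [Ioo_mem_nhdsGT this] with ε hε _
    linarith [hε.2]

section Asymptotics

variable {Ω : Type*} [MeasurableSpace Ω] {P : Measure Ω} [IsProbabilityMeasure P]
  {X : ℝ → Ω → ℝ} {a b : ℝ}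

/-- There is a minimizer whose potential touches its minimal value finitely often. -/
theorem exists_isMinimizer_finite_touching (hX : IsCenteredContinuousGaussian X P) (hab : a < b)
    (h : ((HasPowerExpansion (covFun X P) ∧ NonnegNondegenerate (covFun X P) ∧
            SmoothNondegenerate X P ∧ LimsupNonpos (covFun X P) a b) ∧
          ∃ ν : Measure ℝ, IsMinimizer (covFun X P) a b ν ∧ ν.support.Finite) ∨
        StationaryCase (covFun X P)) :
    IsNondegenerate (covFun X P) ∧ ∃ ν, IsMinimizer (covFun X P) a b ν ∧
      {t ∈ Icc a b | potential (covFun X P) ν t = energy (covFun X P) ν}.Finite := by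
  rcases h with ⟨⟨hpow, hpos, hsm, hlim⟩, ν, hν, hfin⟩ | ⟨F, hF, hexp, x₀, hacc⟩
  · exact ⟨hsm.isNondegenerate hX, ν, hν,
      finite_touching_of_powerExpansion hpow hpos hlim hν.1 hfin⟩
  · obtain ⟨ν, hν⟩ := exists_isMinimizer hab hX.continuous_covFun
    exact ⟨hF.isNondegenerate hacc, ν, hν, hF.finite_touching hexp hacc hν.1⟩

end Asymptotics

end HighMinima

end

open HighMinima in
theorem theorem6p4 {Ω : Type*} [MeasurableSpace Ω] (P : Measure Ω) [IsProbabilityMeasure P]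
    (X : ℝ → Ω → ℝ) (hX : IsCenteredContinuousGaussian X P)
    (a b : ℝ) (hab : a < b)
    (h : ((HasPowerExpansion (covFun X P) ∧ NonnegNondegenerate (covFun X P) ∧
            SmoothNondegenerate X P ∧ LimsupNonpos (covFun X P) a b) ∧
          ∃ ν : Measure ℝ, IsMinimizer (covFun X P) a b ν ∧ ν.support.Finite) ∨
        StationaryCase (covFun X P)) :
    ∃ ν : Measure ℝ, IsMinimizer (covFun X P) a b ν ∧
      (∀ ν' : Measure ℝ, IsMinimizer (covFun X P) a b ν' → ν' = ν) ∧
      ν.support.Finite ∧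
      ∀ (k : ℕ) (t : Fin k → ℝ), StrictMono t → Set.range t = ν.support →
        (∀ j, t j ∈ Set.Ioo a b → 0 < iteratedDeriv 2 (condMean (covFun X P) t) (t j)) →
        Tendsto
          (fun ε : ℝ => liminf
            (fun u : ℝ => (cond P (highEvent X a b u))
              {ω | (⨅ j, localMin X a b ε (t j) ω) = minOn X (Set.Icc a b) ω}) atTop)
          (𝓝[>] 0) (𝓝 1) ∧
        (∀ j, 0 < theta (covFun X P) t j) ∧
        ∀ᶠ ε : ℝ in 𝓝[>] 0, ∀ f : BoundedContinuousFunction (Fin k → ℝ) ℝ,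
          Tendsto
            (fun u : ℝ => ∫ ω, f (fun j => u * (localMin X a b ε (t j) ω - u))
              ∂(cond P (highEvent X a b u)))
            atTop
            (𝓝 (∫ x, f x ∂(Measure.pi fun j => expMeasure (theta (covFun X P) t j)))) := by
  obtain ⟨hR, ν, hν, hfin⟩ := exists_isMinimizer_finite_touching hX hab h
  obtain ⟨hae, hE, hdual, huniq⟩ := hν.unique_and_isOptimalDual hX hR hfin
  have hprob := hν.1.1
  have hsub : ν.support ⊆ hfin.toFinset :=
    Measure.support_subset_of_isClosed (Finset.finite_toSet _).isClosed hae
  refine ⟨ν, hν, huniq, (Finset.finite_toSet _).subset hsub, fun k t ht hrange _ => ?_⟩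
  have htT : ∀ j, t j ∈ hfin.toFinset := fun j => hsub (hrange ▸ Set.mem_range_self j)
  have hθ : ∀ j, theta (covFun X P) t j = ν.real {t j} / energy (covFun X P) ν :=
    theta_eq hR covFun_comm ht.injective
      (by rw [hrange]; exact Measure.support_mem_ae) hE.ne'
      fun j => (hfin.mem_toFinset.1 (htT j)).2
  have hpos : ∀ j, 0 < ν.real {t j} / energy (covFun X P) ν := fun j =>
    div_pos ((measureReal_singleton_pos_iff hae).2 (hrange ▸ Set.mem_range_self j)) hE
  have hzero : ∀ p ∈ hfin.toFinset, p ∉ Set.range t →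
      ν.real {p} / energy (covFun X P) ν = 0 := fun p _ hp => by
    rw [hrange, ← measureReal_singleton_pos_iff hae, not_lt] at hp
    rw [le_antisymm hp measureReal_nonneg, zero_div]
  simp only [hθ]
  refine ⟨?_, hpos, ?_⟩
  -- Once the `ε`-neighbourhoods of the contact points are separated, the inner liminf already
  -- equals 1, so the outer limit is that of an eventually constant function.
  · refine tendsto_const_nhds.congr' ?_
    filter_upwards [eventually_separated hfin.toFinset, self_mem_nhdsWithin] with ε hsep hε
    exact (hdual.tendsto_cond_iInf_localMin hX hab hε hsep htT hzero).liminf_eq.symm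
  · filter_upwards [eventually_separated hfin.toFinset, self_mem_nhdsWithin] with ε hsep hε f
    exact hdual.tendsto_integral_localMin hX hab hε hsep ht.injective htT hzero hpos f
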